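/- Let $(\mathcal X,d)$ be a metric space and $\mu$ a regular Borel measure on $\mathcal X$ such that every ball $B(x,\rho)=\{y: d(x,y)<\rho\}$ $(\rho>0)$ has finite positive measure, and suppose that for some constants $C_1>1$, $n>0$ one has $\mu(B(x,\lambda \rho))\le C_1\lambda^n\mu(B(x,\rho))$ for all $x\in\mathcal X$, $\rho\in(0,\infty)$, $\lambda\in(1,\infty)$. All functions $u$ are real-valued and $\mu$-measurable; $u\in L^\sigma_{\rm loc}$ means $u\in L^\sigma(B)$ for every ball $B$; $u_B=\frac1{\mu(B)}\int_B u\,d\mu$ is the average of $u$ over a ball $B$. For $s,\sigma\in(0,\infty)$, $\epsilon\in[0,s]$, $x\in\mathcal X$, $t\in(0,\infty)$ put $$C^{s,\sigma}_t(u)(x)=t^{-s}\Big(\frac1{\mu(B(x,t))}\int_{B(x,t)}|u(x)-u(y)|^\sigma d\mu(y)\Big)^{1/\sigma},\qquad A^{s,\sigma}_t(u)(x)=t^{-s}\Big(\frac1{\mu(B(x,t))}\int_{B(x,t)}|u(y)-u_{B(x,t)}|^\sigma d\mu(y)\Big)^{1/\sigma},$$ $$I^{s,\sigma}_t(u)(x)=t^{-s}\Big(\inf_{c\in\mathbb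 R}\frac1{\mu(B(x,t))}\int_{B(x,t)}|u(y)-c|^\sigma d\mu(y)\Big)^{1/\sigma},\qquad S^{s,\epsilon,\sigma}_t(u)(x)=t^{\epsilon-s}\sup_{\rho\in(0,t]}\rho^{-\epsilon}\Big(\inf_{c\in\mathbb R}\frac1{\mu(B(x,\rho))}\int_{B(x,\rho)}|u(y)-c|^\sigma d\mu(y)\Big)^{1/\sigma}.$$ For $\vec E=\vec C^{s,\sigma},\vec A^{s,\sigma},\vec I^{s,\sigma},\vec S^{s,\epsilon,\sigma}$ write $\vec E(u)(x,t)$ for the corresponding quantity, and for $p,q\in(0,\infty]$ let $\vec E\dot F_{p,q}(\mathcal X)$ be the set of all $u\in L^\sigma_{\rm loc}$ (for $\vec A^{s,\sigma}$ also $u\in L^1_{\rm loc}$, so that the averages $u_{B(x,t)}$ are defined) with $\|u\|_{\vec E\dot F_{p,q}}<\infty$, where $$\|u\|_{\vec E\dot F_{p,q}}=\Big\|\Big(\int_0^\infty[\vec E(u)(\cdot,t)]^q\frac{dt}t\Big)^{1/q}\Big\|_{L^p(\mathcal X)}\quad(p<\infty;\ \text{with } \sup_{t>0} \text{ if } q=\infty),$$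 $$\|u\|_{\vec E\dot F_{\infty,q}}=\sup_{x\in\mathcal X}\sup_{\rho>0}\Big(\int_0^\rho\,\frac1{\mu(B(x,\rho))}\int_{B(x,\rho)}[\vec E(u)(y,t)]^q d\mu(y)\frac{dt}t\Big)^{1/q}\quad(q<\infty),\qquad \|u\|_{\vec E\dot F_{\infty,\infty}}=\sup_{t>0}\|\vec E(u)(\cdot,t)\|_{L^\infty(\mathcal X)}.$$ A sequence $\vec g=\{g_k\}_{k\in\mathbb Z}$ of nonnegative measurable functions is a fractional $s$-Hajłasz gradient of $u$, written $\vec g\in\mathbb D^s(u)$, if there is $E\subset\mathcal X$ with $\mu(E)=0$ such that $|u(x)-u(y)|\le d(x,y)^s[g_k(x)+g_k(y)]$ for all $k\in\mathbb Z$ and all $x,y\in\mathcal X\setminus E$ with $2^{-k-1}\le d(x,y)<2^{-k}$. The space $\dot M^s_{p,q}(\mathcal X)$ consists of all measurable $u$ with $\|u\|_{\dot M^s_{p,q}}<\infty$, where $$\|u\|_{\dot M^s_{p,q}}=\inf_{\vec g\in\mathbb D^s(u)}\big\|\,\|\{g_k\}_{k}\|_{\ell^q}\big\|_{L^p(\mathcal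 X)}\quad(p<\infty\text{ or }p=q=\infty),$$ $$\|u\|_{\dot M^s_{\infty,q}}=\inf_{\vec g\in\mathbb D^s(u)}\sup_{k\in\mathbb Z}\sup_{x\in\mathcal X}\Big\{\sum_{j\ge k}\frac1{\mu(B(x,2^{-k}))}\int_{B(x,2^{-k})}[g_j(y)]^q d\mu(y)\Big\}^{1/q}\quad(q<\infty).$$ For two such spaces, $X=Y$ means that they consist of the same functions and that there is a constant $C$, independent of $u$, with $\|u\|_Y\le C\|u\|_X$ and $\|u\|_X\le C\|u\|_Y$ for all $u$ in them. Finally, for $p\in(0,\infty]$ let $p_*(s)=np/(n-ps)$ if $p<n/s$ and $p_*(s)=\infty$ if $p\ge n/s$. **Theorem.** Let $s\in(0,\infty)$, $p,q\in(0,\infty]$ and $r=\min\{p,q\}$. (i) If $\sigma\in(0,r)$, then $\dot M^s_{p,q}(\mathcal X)=\vec C^{s,\sigma}\dot F_{p,q}(\mathcal X)$. (ii) If $\sigma\in(0,r_*(s))$, then $\dot M^s_{p,q}(\mathcal X)=\vec I^{s,\sigma}\dot F_{p,q}(\mathcal X)$. (iii) If $\epsilon\in[0,s)$ and $\sigma\in(0,r_*(s))$,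 then $\dot M^s_{p,q}(\mathcal X)=\vec S^{s,\epsilon,\sigma}\dot F_{p,q}(\mathcal X)$. (iv) If $r\in(n/(n+s),\infty]$ and $\sigma\in(0,r_*(s))$, then $\dot M^s_{p,q}(\mathcal X)=\vec A^{s,\sigma}\dot F_{p,q}(\mathcal X)$. -/

import Mathlib

open MeasureTheory Metric Set
open scoped ENNReal NNReal

namespace HajlaszTL

noncomputable section

/-- A class of real functions on `X` (`carrier`) together with its (quasi-semi)norm. -/
structure FunctionSpace (X : Type*) where
  carrier : Set (X → ℝ)
  norm : (X → ℝ) → ℝ≥0∞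

/-- Continuous inclusion: `u ∈ A` implies `u ∈ B` and `‖u‖_B ≤ C ‖u‖_A`, with `C` independent
of `u`. -/
def FunctionSpace.Included {X : Type*} (A B : FunctionSpace X) : Prop :=
  ∃ C : ℝ≥0, ∀ u ∈ A.carrier, u ∈ B.carrier ∧ B.norm u ≤ C * A.norm u

/-- Equality of function spaces: the same functions, with equivalent (quasi-semi)norms. -/
def FunctionSpace.Equal {X : Type*} (A B : FunctionSpace X) : Prop :=
  A.Included B ∧ B.Included A

/-- The exponent `p_*(s)` in dimension `n`: it is `np/(n-ps)` if `p < n/s`, and `∞` otherwise. -/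
def starExponent (n s : ℝ) (p : ℝ≥0∞) : ℝ≥0∞ :=
  if p < ENNReal.ofReal (n / s) then
    ENNReal.ofReal (n * p.toReal / (n - p.toReal * s))
  else ∞

/-- The `ℓ^q(ℤ)` quasi-norm of a nonnegative sequence, `0 < q ≤ ∞`. -/
def lqNorm (q : ℝ≥0∞) (a : ℤ → ℝ≥0∞) : ℝ≥0∞ :=
  if q = ∞ then ⨆ k : ℤ, a k else (∑' k : ℤ, a k ^ q.toReal) ^ (1 / q.toReal)

/-- The `L^q((0,∞), dt/t)` quasi-norm of a nonnegative function, `0 < q ≤ ∞`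
(the supremum over `t > 0` if `q = ∞`). -/
def dtNorm (q : ℝ≥0∞) (f : ℝ → ℝ≥0∞) : ℝ≥0∞ :=
  if q = ∞ then ⨆ (t : ℝ) (_ : 0 < t), f t
  else (∫⁻ t in Ioi (0 : ℝ), f t ^ q.toReal * ENNReal.ofReal (1 / t)) ^ (1 / q.toReal)

variable {X : Type*} [MetricSpace X] [MeasurableSpace X]

/-- `u ∈ L^σ_loc`: `u ∈ L^σ(B)` for each ball `B`. -/
def MemLpLoc (μ : Measure X) (σ : ℝ) (u : X → ℝ) : Prop :=
  ∀ (x : X) (r : ℝ), MemLp u (ENNReal.ofReal σ) (μ.restrict (ball x r))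

/-- `C^{s,σ}_t(u)(x)`. -/
def opC (μ : Measure X) (s σ : ℝ) (u : X → ℝ) (x : X) (t : ℝ) : ℝ≥0∞ :=
  ENNReal.ofReal (t ^ (-s)) * (⨍⁻ y in ball x t, ‖u x - u y‖ₑ ^ σ ∂μ) ^ (1 / σ)

/-- `A^{s,σ}_t(u)(x)`; it is meaningful for `u` integrable on balls. -/
def opA (μ : Measure X) (s σ : ℝ) (u : X → ℝ) (x : X) (t : ℝ) : ℝ≥0∞ :=
  ENNReal.ofReal (t ^ (-s)) *
    (⨍⁻ y in ball x t, ‖u y - ⨍ z in ball x t, u z ∂μ‖ₑ ^ σ ∂μ) ^ (1 / σ)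

/-- `I^{s,σ}_t(u)(x)`. -/
def opI (μ : Measure X) (s σ : ℝ) (u : X → ℝ) (x : X) (t : ℝ) : ℝ≥0∞ :=
  ENNReal.ofReal (t ^ (-s)) *
    (⨅ c : ℝ, ⨍⁻ y in ball x t, ‖u y - c‖ₑ ^ σ ∂μ) ^ (1 / σ)

/-- `S^{s,ε,σ}_t(u)(x)`. -/
def opS (μ : Measure X) (s ε σ : ℝ) (u : X → ℝ) (x : X) (t : ℝ) : ℝ≥0∞ :=
  ENNReal.ofReal (t ^ (ε - s)) *
    ⨆ r ∈ Ioc (0 : ℝ) t, ENNReal.ofReal (r ^ (-ε)) *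
      (⨅ c : ℝ, ⨍⁻ y in ball x r, ‖u y - c‖ₑ ^ σ ∂μ) ^ (1 / σ)

/-- The Triebel-Lizorkin type quasi-norm of a nonnegative function `F` on `X × (0,∞)`. -/
def normF (μ : Measure X) (p q : ℝ≥0∞) (F : X → ℝ → ℝ≥0∞) : ℝ≥0∞ :=
  if p = ∞ then
    if q = ∞ then ⨆ (t : ℝ) (_ : 0 < t), eLpNorm (fun x => F x t) ∞ μ
    else ⨆ (x : X) (r : ℝ) (_ : 0 < r),
      (∫⁻ t in Ioo (0 : ℝ) r, (⨍⁻ y in ball x r, F y t ^ q.toReal ∂μ) * ENNReal.ofReal (1 / t))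
        ^ (1 / q.toReal)
  else eLpNorm (fun x => dtNorm q (F x)) p μ

/-- The space of Triebel-Lizorkin type given by `C^{s,σ}`. -/
def spaceC (μ : Measure X) (s σ : ℝ) (p q : ℝ≥0∞) : FunctionSpace X where
  carrier := {u | MemLpLoc μ σ u ∧ normF μ p q (opC μ s σ u) < ∞}
  norm u := normF μ p q (opC μ s σ u)

/-- The space of Triebel-Lizorkin type given by `I^{s,σ}`. -/
def spaceI (μ : Measure X) (s σ : ℝ) (p q : ℝ≥0∞) : FunctionSpace X where
  carrier := {u | MemLpLoc μ σ u ∧ normF μ p q (opI μ s σ u) < ∞}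
  norm u := normF μ p q (opI μ s σ u)

/-- The space of Triebel-Lizorkin type given by `S^{s,ε,σ}`. -/
def spaceS (μ : Measure X) (s ε σ : ℝ) (p q : ℝ≥0∞) : FunctionSpace X where
  carrier := {u | MemLpLoc μ σ u ∧ normF μ p q (opS μ s ε σ u) < ∞}
  norm u := normF μ p q (opS μ s ε σ u)

/-- The space of Triebel-Lizorkin type given by `A^{s,σ}`. The functions are also locally
integrable, so that the averages in `A^{s,σ}` are defined (this is automatic if `1 ≤ σ`). -/
def spaceA (μ : Measure X) (s σ : ℝ) (p q : ℝ≥0∞) : FunctionSpace X where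
  carrier := {u | MemLpLoc μ σ u ∧ MemLpLoc μ 1 u ∧ normF μ p q (opA μ s σ u) < ∞}
  norm u := normF μ p q (opA μ s σ u)

/-- `g` is a fractional `s`-Hajłasz gradient of `u`. The value `∞` is admitted for the `g k`; this
does not affect the spaces, since for finite quasi-norm each `g k` is finite almost everywhere. -/
def IsHajlaszGradient (μ : Measure X) (s : ℝ) (u : X → ℝ) (g : ℤ → X → ℝ≥0∞) : Prop :=
  (∀ k, AEMeasurable (g k) μ) ∧
    ∃ E : Set X, μ E = 0 ∧ ∀ (k : ℤ) (x y : X), x ∉ E → y ∉ E →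
      (2 : ℝ) ^ (-k - 1) ≤ dist x y → dist x y < (2 : ℝ) ^ (-k) →
        ENNReal.ofReal |u x - u y| ≤ ENNReal.ofReal (dist x y ^ s) * (g k x + g k y)

/-- The quasi-norm of a sequence `g` entering the Hajłasz-Triebel-Lizorkin quasi-norm: the
`L^p(X, ℓ^q)` quasi-norm, unless `p = ∞` and `q < ∞`, where it is of Carleson type. -/
def gradNorm (μ : Measure X) (p q : ℝ≥0∞) (g : ℤ → X → ℝ≥0∞) : ℝ≥0∞ :=
  if p = ∞ ∧ q ≠ ∞ then
    ⨆ (k : ℤ) (x : X),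
      (∑' j : {j : ℤ // k ≤ j}, ⨍⁻ y in ball x ((2 : ℝ) ^ (-k)), g j y ^ q.toReal ∂μ)
        ^ (1 / q.toReal)
  else eLpNorm (fun x => lqNorm q (fun k => g k x)) p μ

/-- The Hajłasz-Triebel-Lizorkin quasi-norm. -/
def normM (μ : Measure X) (s : ℝ) (p q : ℝ≥0∞) (u : X → ℝ) : ℝ≥0∞ :=
  ⨅ (g : ℤ → X → ℝ≥0∞) (_ : IsHajlaszGradient μ s u g), gradNorm μ p q g

/-- The homogeneous Hajłasz-Triebel-Lizorkin space. -/
def spaceM (μ : Measure X) (s : ℝ) (p q : ℝ≥0∞) : FunctionSpace X where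
  carrier := {u | AEMeasurable u μ ∧ normM μ s p q u < ∞}
  norm u := normM μ s p q u

end

end HajlaszTL

/-! All the norms are compared with one discrete quantity, the sequence a_k(x) = 2^{ks} osc_k(x),
where osc_k(x) is the L^σ mean oscillation of u over the ball of radius 2^{-k} about x
(`scaledOsc`). It is measured in `gradNorm`, the sequence norm of the Hajłasz space.

From oscillations to gradients: by Lebesgue density, at almost every x and for every constant c,
|u(x) - c| is controlled by the mean deviation of u from c on the ball of radius 2^{-k} plus the sum
of osc_j(x) over j ≥ k (`exists_ae_enorm_sub_le`). Comparing u(x) and u(y) with a common c shows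
that tail sums of oscillations, suitably scaled, form a Hajłasz gradient. In terms of a_k such a
tail is a geometric smoothing (`hardySum`), which is harmless by a discrete Hardy inequality valid
for every q > 0.

From gradients to oscillations: the condition σ < r_*(s) provides an l < min(p, q, σ) with t = n(1/l
- 1/σ) < s. Since t < s, on a ball of radius comparable to 2^{-k} a gradient sequence of order s
collapses to a single gradient of order t, again a geometric smoothing of the g_j. The
Sobolev–Poincaré inequality (`exists_sobolevPoincare`) then bounds osc_k by the L^l average of that
function, and because l < p and l < q these averages are bounded in L^p(ℓ^q) and in its Carleson
variant (`exists_gradNorm_setLAverage_le`). The latter is a Fefferman–Stein type inequality, derived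
from the scalar maximal theorem.

The four functionals: each dominates I, and I at radii t in [2^{-k}, 2^{1-k}) dominates a_k.
Conversely each is bounded by a smoothing of the a_k: C by the almost everywhere estimate above, S
because ε < s leaves the ratio 2^{-(s-ε)}, A by Jensen's inequality at the exponent max(σ, 1), which
is admissible when r > n/(n+s) since then r_*(s) > 1. Integrals in dt/t are exchanged for sums over
dyadic shells, and `spaceM_equal` assembles the two inclusions. -/

namespace HajlaszTL

/-- Balls have finite positive measure, and the measure is doubling with dimension `n`. -/
structure IsDoubling {X : Type*} [MetricSpace X] [MeasurableSpace X] (μ : Measure X)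
    (C n : ℝ) : Prop where
  one_lt : 1 < C
  dim_pos : 0 < n
  measure_ball_pos : ∀ (x : X) (ρ : ℝ), 0 < ρ → 0 < μ (ball x ρ)
  measure_ball_lt_top : ∀ (x : X) (ρ : ℝ), μ (ball x ρ) < ∞
  measure_ball_mul_le : ∀ (x : X) (ρ a : ℝ), 0 < ρ → 1 < a →
    μ (ball x (a * ρ)) ≤ ENNReal.ofReal (C * a ^ n) * μ (ball x ρ)

/-! ### Averages over balls and consequences of doubling -/

section Average

variable {X : Type*} [MeasurableSpace X] {μ : Measure X}

lemma setLAverage_le_mul {A B : Set X} {K : ℝ≥0∞} (hAB : A ⊆ B) (hA : μ A ≠ 0)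
    (hB : μ B ≠ ∞) (h : μ B ≤ K * μ A) (f : X → ℝ≥0∞) :
    ⨍⁻ y in A, f y ∂μ ≤ K * ⨍⁻ y in B, f y ∂μ := by
  have hA' : μ A ≠ ∞ := ne_top_of_le_ne_top hB (measure_mono hAB)
  have hB' : μ B ≠ 0 := fun h0 => hA (measure_mono_null hAB h0)
  rw [setLAverage_eq, setLAverage_eq, ENNReal.div_le_iff hA hA']
  calc ∫⁻ y in A, f y ∂μ ≤ ∫⁻ y in B, f y ∂μ := lintegral_mono_set hAB
    _ = (∫⁻ y in B, f y ∂μ) / μ B * μ B := (ENNReal.div_mul_cancel hB' hB).symm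
    _ ≤ (∫⁻ y in B, f y ∂μ) / μ B * (K * μ A) := by gcongr
    _ = _ := by ring

lemma setLAverage_rpow_le {A : Set X} (hA : μ A ≠ 0) (hA' : μ A ≠ ∞) {f : X → ℝ≥0∞}
    (hf : AEMeasurable f μ) {a : ℝ} (ha : 1 ≤ a) :
    (⨍⁻ y in A, f y ∂μ) ^ a ≤ ⨍⁻ y in A, f y ^ a ∂μ := by
  have hpos : 0 < a := by linarith
  have : IsProbabilityMeasure ((μ.restrict A univ)⁻¹ • μ.restrict A) := by
    constructor
    simp [ENNReal.inv_mul_cancel hA hA']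
  have h := eLpNorm'_le_eLpNorm'_of_exponent_le (μ := (μ.restrict A univ)⁻¹ • μ.restrict A)
    one_pos ha (hf.restrict.smul_measure _).aestronglyMeasurable
  simp only [eLpNorm', enorm_eq_self, ENNReal.rpow_one, one_div, inv_one] at h
  rw [laverage, laverage]
  calc _ ≤ _ := ENNReal.rpow_le_rpow h hpos.le
    _ = _ := by rw [← ENNReal.rpow_mul, inv_mul_cancel₀ hpos.ne', ENNReal.rpow_one]

lemma setLAverage_add_le {A : Set X} {f g : X → ℝ≥0∞} (hf : AEMeasurable f μ) :
    ⨍⁻ y in A, (f y + g y) ∂μ = ⨍⁻ y in A, f y ∂μ + ⨍⁻ y in A, g y ∂μ := by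
  rw [laverage, laverage, laverage]
  exact lintegral_add_left' (hf.restrict.smul_measure _) _

lemma setLAverage_const_mul {A : Set X} {f : X → ℝ≥0∞} (c : ℝ≥0∞) (hf : AEMeasurable f μ) :
    ⨍⁻ y in A, c * f y ∂μ = c * ⨍⁻ y in A, f y ∂μ := by
  rw [laverage, laverage]
  exact lintegral_const_mul'' _ (hf.restrict.smul_measure _)

lemma setLAverage_tsum {ι : Type*} [Countable ι] {A : Set X} {f : ι → X → ℝ≥0∞}
    (hf : ∀ i, AEMeasurable (f i) μ) :
    ⨍⁻ y in A, ∑' i, f i y ∂μ = ∑' i, ⨍⁻ y in A, f i y ∂μ := by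
  simp only [laverage]
  exact lintegral_tsum fun i => (hf i).restrict.smul_measure _

lemma setLAverage_mono {A : Set X} {f g : X → ℝ≥0∞} (h : ∀ y, f y ≤ g y) :
    ⨍⁻ y in A, f y ∂μ ≤ ⨍⁻ y in A, g y ∂μ := by
  rw [laverage, laverage]
  exact lintegral_mono h

lemma setLAverage_mono_on {A : Set X} (hA : MeasurableSet A) {f g : X → ℝ≥0∞}
    (h : ∀ y ∈ A, f y ≤ g y) :
    ⨍⁻ y in A, f y ∂μ ≤ ⨍⁻ y in A, g y ∂μ := by
  rw [setLAverage_eq, setLAverage_eq]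
  gcongr 1
  exact setLIntegral_mono' hA h

lemma setLAverage_congr_ae {A : Set X} {f g : X → ℝ≥0∞} (h : f =ᵐ[μ] g) :
    ⨍⁻ y in A, f y ∂μ = ⨍⁻ y in A, g y ∂μ :=
  laverage_congr (ae_restrict_of_ae h)

end Average

variable {X : Type*} [MetricSpace X] [MeasurableSpace X]

namespace IsDoubling

variable {μ : Measure X} {C n : ℝ}

lemma ball_ne_zero (h : IsDoubling μ C n) (x : X) {ρ : ℝ} (hρ : 0 < ρ) : μ (ball x ρ) ≠ 0 :=
  (h.measure_ball_pos x ρ hρ).ne'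

lemma ball_ne_top (h : IsDoubling μ C n) (x : X) (ρ : ℝ) : μ (ball x ρ) ≠ ∞ :=
  (h.measure_ball_lt_top x ρ).ne

/-- `h1` places the ball about x inside the ball about y, and `h2` places the latter inside the
a-fold dilate of the former, so doubling at x compares their measures. Most later changes of ball
are instances of this. -/
lemma setLAverage_ball_le (h : IsDoubling μ C n) {x y : X} {ρ R a : ℝ} (hρ : 0 < ρ) (ha : 1 < a)
    (h1 : dist x y + ρ ≤ R) (h2 : dist x y + R ≤ a * ρ) (f : X → ℝ≥0∞) :
    ⨍⁻ z in ball x ρ, f z ∂μ ≤ ENNReal.ofReal (C * a ^ n) * ⨍⁻ z in ball y R, f z ∂μ := by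
  refine setLAverage_le_mul (ball_subset_ball' (by linarith)) (h.ball_ne_zero x hρ)
    (h.ball_ne_top y R) ?_ f
  refine (measure_mono (ball_subset_ball' ?_)).trans (h.measure_ball_mul_le x ρ a hρ ha)
  rw [dist_comm]; linarith

lemma sigmaFinite [BorelSpace X] (h : IsDoubling μ C n) : SigmaFinite μ := by
  rcases isEmpty_or_nonempty X with hX | ⟨⟨o⟩⟩
  · rw [Measure.eq_zero_of_isEmpty μ]; infer_instance
  · refine ⟨⟨⟨fun k => ball o k, fun _ => trivial, fun k => h.measure_ball_lt_top o k, ?_⟩⟩⟩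
    exact iUnion_ball_nat o

/-- A maximal ε-separated set is ε-dense, and it is countable because the ε/2-balls about its points
are disjoint and of positive measure in a σ-finite space. Second countability gives joint
measurability on X × X and the countability of disjoint families of balls. -/
lemma secondCountableTopology [BorelSpace X] (h : IsDoubling μ C n) :
    SecondCountableTopology X := by
  have := h.sigmaFinite
  refine Metric.secondCountable_of_almost_dense_set fun ε hε => ?_
  obtain ⟨s, hs⟩ : ∃ s : Set X, Maximal (fun s : Set X => s.Pairwise fun a b => ε ≤ dist a b) s := by
    refine zorn_subset _ fun c hc hchain => ⟨⋃₀ c, ?_, fun s hs => subset_sUnion_of_mem hs⟩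
    exact (Set.pairwise_sUnion hchain.directedOn).2 hc
  refine ⟨s, ?_, fun x => ?_⟩
  · have hcount := Measure.countable_meas_pos_of_disjoint_iUnion (μ := μ)
      (As := fun a : s => ball (a : X) (ε / 2)) (fun a => measurableSet_ball) (by
        intro a b hab
        refine ball_disjoint_ball ?_
        have := hs.prop a.2 b.2 (fun hh => hab (Subtype.ext hh))
        linarith)
    have huniv : {i : s | 0 < μ (ball (i : X) (ε / 2))} = univ :=
      eq_univ_of_forall fun i => h.measure_ball_pos _ _ (by linarith)
    rw [huniv, countable_univ_iff] at hcount
    exact hcount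
  · by_contra! hx
    have hmem : x ∈ s := by
      refine hs.le_of_ge (y := insert x s) ?_ (subset_insert x s) (mem_insert x s)
      refine (Set.pairwise_insert).2 ⟨hs.prop, fun b hb _ => ?_⟩
      exact ⟨(hx b hb).le, by rw [dist_comm]; exact (hx b hb).le⟩
    have := hx x hmem
    rw [dist_self] at this
    linarith

lemma isUnifLocDoublingMeasure (h : IsDoubling μ C n) : IsUnifLocDoublingMeasure μ := by
  refine ⟨⟨(C * 4 ^ n).toNNReal, ?_⟩⟩
  filter_upwards [self_mem_nhdsWithin] with ε hε x
  have hε : 0 < ε := hε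
  calc μ (closedBall x (2 * ε)) ≤ μ (ball x (4 * ε)) :=
        measure_mono (closedBall_subset_ball (by linarith))
    _ ≤ _ := h.measure_ball_mul_le x ε 4 hε (by norm_num)
    _ ≤ _ := by
      gcongr
      · exact le_rfl
      · exact ball_subset_closedBall

lemma isLocallyFiniteMeasure (h : IsDoubling μ C n) : IsLocallyFiniteMeasure μ :=
  ⟨fun x => ⟨ball x 1, ball_mem_nhds x one_pos, h.measure_ball_lt_top x 1⟩⟩

end IsDoubling

/-! ### Measurability in the centre and self-adjointness of averaging -/

section Measurability

variable {μ : Measure X} [BorelSpace X] [SecondCountableTopology X] [SFinite μ]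

lemma measurableSet_dist_lt (ρ : ℝ) : MeasurableSet {z : X × X | dist z.2 z.1 < ρ} :=
  (isOpen_lt (continuous_snd.dist continuous_fst) continuous_const).measurableSet

lemma measurable_setLIntegral_ball {f : X → ℝ≥0∞} (hf : AEMeasurable f μ) (ρ : ℝ) :
    Measurable fun x => ∫⁻ y in ball x ρ, f y ∂μ := by
  have h1 : (fun x => ∫⁻ y in ball x ρ, f y ∂μ)
      = fun x => ∫⁻ y, {z : X × X | dist z.2 z.1 < ρ}.indicator (fun z => hf.mk f z.2) (x, y) ∂μ := by
    funext x
    rw [lintegral_congr_ae (ae_restrict_of_ae hf.ae_eq_mk), ← lintegral_indicator measurableSet_ball]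
    rfl
  rw [h1]
  exact Measurable.lintegral_prod_right'
    ((hf.measurable_mk.comp measurable_snd).indicator (measurableSet_dist_lt ρ))

lemma measurable_measure_ball (ρ : ℝ) : Measurable fun x => μ (ball x ρ) := by
  have := measurable_setLIntegral_ball (μ := μ) (f := fun _ => 1) aemeasurable_const ρ
  simpa using this

lemma measurable_setLAverage_ball {f : X → ℝ≥0∞} (hf : AEMeasurable f μ) (ρ : ℝ) :
    Measurable fun x => ⨍⁻ y in ball x ρ, f y ∂μ := by
  simp only [setLAverage_eq]
  exact (measurable_setLIntegral_ball hf ρ).div (measurable_measure_ball ρ)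

/-- Averaging at a fixed radius is self-adjoint up to a constant: y lies in the ball about x exactly
when x lies in the ball about y, the two balls have comparable measure, and Tonelli exchanges the
integrals. -/
lemma IsDoubling.lintegral_setLAverage_mul_le {C n : ℝ} (h : IsDoubling μ C n)
    {f w : X → ℝ≥0∞} (hf : AEMeasurable f μ) (hw : AEMeasurable w μ) {ρ : ℝ} (hρ : 0 < ρ) :
    ∫⁻ x, (⨍⁻ y in ball x ρ, f y ∂μ) * w x ∂μ
      ≤ ENNReal.ofReal (C * 2 ^ n) * ∫⁻ y, f y * ⨍⁻ x in ball y ρ, w x ∂μ ∂μ := by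
  wlog hfm : Measurable f generalizing f
  · have := this hf.measurable_mk.aemeasurable hf.measurable_mk
    simp only [← setLAverage_congr_ae hf.ae_eq_mk] at this
    refine this.trans_eq ?_
    congr 1
    exact lintegral_congr_ae (hf.ae_eq_mk.mono fun x hx => by simp only [hx])
  wlog hwm : Measurable w generalizing w
  · have := this hw.measurable_mk.aemeasurable hw.measurable_mk
    simp only [← setLAverage_congr_ae hw.ae_eq_mk] at this
    refine le_trans (le_of_eq ?_) this
    exact lintegral_congr_ae (hw.ae_eq_mk.mono fun x hx => by simp only [hx])
  have hsymm : ∀ x y : X, (ball x ρ).indicator f y = f y * (ball y ρ).indicator 1 x := by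
    intro x y
    by_cases hxy : dist y x < ρ
    · rw [indicator_of_mem (by exact hxy), indicator_of_mem (by rw [mem_ball, dist_comm]; exact hxy)]
      simp
    · rw [indicator_of_notMem (by exact hxy),
        indicator_of_notMem (by rw [mem_ball, dist_comm]; exact hxy), mul_zero]
  have hmeas : Measurable fun z : X × X =>
      f z.2 * (ball z.2 ρ).indicator 1 z.1 * ((μ (ball z.1 ρ))⁻¹ * w z.1) := by
    refine Measurable.mul ((hfm.comp measurable_snd).mul ?_)
      (((measurable_measure_ball ρ).comp measurable_fst).inv.mul (hwm.comp measurable_fst))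
    have : (fun z : X × X => (ball z.2 ρ).indicator (1 : X → ℝ≥0∞) z.1)
        = {z : X × X | dist z.2 z.1 < ρ}.indicator 1 := by
      funext z
      simp only [indicator, mem_ball, mem_ofPred_eq, dist_comm, Pi.one_apply]
    rw [this]
    exact measurable_one.indicator (measurableSet_dist_lt ρ)
  calc ∫⁻ x, (⨍⁻ y in ball x ρ, f y ∂μ) * w x ∂μ
      = ∫⁻ x, ∫⁻ y, f y * (ball y ρ).indicator 1 x * ((μ (ball x ρ))⁻¹ * w x) ∂μ ∂μ := by
        refine lintegral_congr fun x => ?_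
        rw [lintegral_mul_const'' _ ?_]
        · rw [setLAverage_eq, ← lintegral_indicator measurableSet_ball, div_eq_mul_inv, mul_assoc]
          simp only [hsymm]
        · simp only [← hsymm]
          exact (hfm.indicator measurableSet_ball).aemeasurable
    _ = ∫⁻ y, ∫⁻ x, f y * (ball y ρ).indicator 1 x * ((μ (ball x ρ))⁻¹ * w x) ∂μ ∂μ :=
        lintegral_lintegral_swap hmeas.aemeasurable
    _ ≤ ∫⁻ y, ENNReal.ofReal (C * 2 ^ n) * (f y * ⨍⁻ x in ball y ρ, w x ∂μ) ∂μ := by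
        refine lintegral_mono fun y => ?_
        have hle : ∀ x, f y * (ball y ρ).indicator 1 x * ((μ (ball x ρ))⁻¹ * w x)
            ≤ (ENNReal.ofReal (C * 2 ^ n) * (f y * (μ (ball y ρ))⁻¹)) * (ball y ρ).indicator w x := by
          intro x
          by_cases hx : x ∈ ball y ρ
          · rw [indicator_of_mem hx, indicator_of_mem hx, Pi.one_apply, mul_one]
            have h1 : μ (ball y ρ) ≤ ENNReal.ofReal (C * 2 ^ n) * μ (ball x ρ) := by
              refine (measure_mono (ball_subset_ball' ?_)).trans
                (h.measure_ball_mul_le x ρ 2 hρ (by norm_num))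
              have := mem_ball.1 hx
              rw [dist_comm] at this
              linarith
            have h2 : (μ (ball x ρ))⁻¹ ≤ ENNReal.ofReal (C * 2 ^ n) * (μ (ball y ρ))⁻¹ := by
              rw [← div_eq_mul_inv, ENNReal.le_div_iff_mul_le (Or.inl (h.ball_ne_zero y hρ))
                (Or.inl (h.ball_ne_top y ρ)), mul_comm, ← div_eq_mul_inv]
              exact ENNReal.div_le_of_le_mul h1
            calc f y * ((μ (ball x ρ))⁻¹ * w x)
                ≤ f y * ((ENNReal.ofReal (C * 2 ^ n) * (μ (ball y ρ))⁻¹) * w x) := by gcongr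
              _ = _ := by ring
          · rw [indicator_of_notMem hx, indicator_of_notMem hx, mul_zero, zero_mul, mul_zero]
        refine (lintegral_mono hle).trans_eq ?_
        rw [lintegral_const_mul _ (hwm.indicator measurableSet_ball),
          lintegral_indicator measurableSet_ball, setLAverage_eq, div_eq_mul_inv]
        ring
    _ = _ := lintegral_const_mul _ (hfm.mul (measurable_setLAverage_ball hw ρ))

end Measurability

end HajlaszTL

/-! ### The Hardy–Littlewood maximal function -/

namespace HajlaszTL

variable {X : Type*} [MetricSpace X] [MeasurableSpace X]

noncomputable section

/-- The centred Hardy–Littlewood maximal function over dyadic radii. -/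
def dyadicMaximal (μ : Measure X) (f : X → ℝ≥0∞) (x : X) : ℝ≥0∞ :=
  ⨆ k : ℤ, ⨍⁻ y in ball x ((2 : ℝ) ^ (-k)), f y ∂μ

end

variable {μ : Measure X}

lemma setLAverage_le_dyadicMaximal (f : X → ℝ≥0∞) (x : X) (k : ℤ) :
    ⨍⁻ y in ball x ((2 : ℝ) ^ (-k)), f y ∂μ ≤ dyadicMaximal μ f x :=
  le_iSup (fun k : ℤ => ⨍⁻ y in ball x ((2 : ℝ) ^ (-k)), f y ∂μ) k

lemma measurable_dyadicMaximal [BorelSpace X] [SecondCountableTopology X] [SFinite μ]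
    {f : X → ℝ≥0∞} (hf : AEMeasurable f μ) : Measurable (dyadicMaximal μ f) :=
  Measurable.iSup fun _ => measurable_setLAverage_ball hf _

/-- The weak type (1,1) bound: the level set is covered by 5-fold dilates of disjoint balls on each
of which the average of f exceeds t. -/
lemma IsDoubling.mul_measure_lt_dyadicMaximal_le [BorelSpace X] [SecondCountableTopology X]
    {C n : ℝ} (h : IsDoubling μ C n) (f : X → ℝ≥0∞) (t : ℝ≥0∞) :
    t * μ {x | t < dyadicMaximal μ f x} ≤ ENNReal.ofReal (C * 5 ^ n) * ∫⁻ y, f y ∂μ := by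
  -- Vitali's lemma requires bounded radii, so the level set is exhausted by the points for which a
  -- ball of radius at most 2^N has a large average.
  let A : ℕ → Set X := fun N =>
    {x | ∃ k : ℤ, -(N : ℤ) ≤ k ∧ t < ⨍⁻ y in ball x ((2 : ℝ) ^ (-k)), f y ∂μ}
  have hA : {x | t < dyadicMaximal μ f x} = ⋃ N, A N := by
    ext x
    simp only [dyadicMaximal, lt_iSup_iff, mem_iUnion, mem_ofPred_eq, A]
    constructor
    · rintro ⟨k, hk⟩
      exact ⟨k.natAbs, k, by omega, hk⟩
    · rintro ⟨N, k, -, hk⟩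
      exact ⟨k, hk⟩
  have hmono : Monotone A := by
    rintro N N' hN x ⟨k, hk, hx⟩
    exact ⟨k, by omega, hx⟩
  rw [hA, hmono.measure_iUnion, ENNReal.mul_iSup]
  refine iSup_le fun N => ?_
  choose! k hk hkx using fun x (hx : x ∈ A N) => hx
  obtain ⟨u, huA, hdisj, hcov⟩ := Vitali.exists_disjoint_subfamily_covering_enlargement_ball
    (A N) (fun x => x) (fun x => (2 : ℝ) ^ (-k x)) ((2 : ℝ) ^ (N : ℤ))
    (fun x hx => zpow_le_zpow_right₀ one_le_two (by have := hk x hx; omega)) 5 (by norm_num)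
  have hpos : ∀ x, (0 : ℝ) < 2 ^ (-k x) := fun x => by positivity
  have hucount : u.Countable :=
    hdisj.countable_of_isOpen (fun x _ => isOpen_ball) fun x _ => nonempty_ball.2 (hpos x)
  have hsub : A N ⊆ ⋃ b ∈ u, ball b (5 * (2 : ℝ) ^ (-k b)) := by
    intro x hx
    obtain ⟨b, hb, hxb⟩ := hcov x hx
    exact mem_iUnion₂.2 ⟨b, hb, hxb (mem_ball_self (hpos x))⟩
  have : Countable u := hucount.to_subtype
  have hterm : ∀ b ∈ u, t * μ (ball b (5 * (2 : ℝ) ^ (-k b)))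
      ≤ ENNReal.ofReal (C * 5 ^ n) * ∫⁻ y in ball b ((2 : ℝ) ^ (-k b)), f y ∂μ := by
    intro b hb
    have h1 := hkx b (huA hb)
    rw [setLAverage_eq, ENNReal.lt_div_iff_mul_lt (Or.inl (h.ball_ne_zero b (hpos b)))
      (Or.inl (h.ball_ne_top b _))] at h1
    calc t * μ (ball b (5 * (2 : ℝ) ^ (-k b)))
        ≤ t * (ENNReal.ofReal (C * 5 ^ n) * μ (ball b ((2 : ℝ) ^ (-k b)))) := by
          gcongr
          exact h.measure_ball_mul_le b _ 5 (hpos b) (by norm_num)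
      _ = ENNReal.ofReal (C * 5 ^ n) * (t * μ (ball b ((2 : ℝ) ^ (-k b)))) := by ring
      _ ≤ _ := by gcongr
  calc t * μ (A N) ≤ t * ∑' b : u, μ (ball (b : X) (5 * (2 : ℝ) ^ (-k b))) := by
        gcongr
        exact (measure_mono hsub).trans (measure_biUnion_le μ hucount _)
    _ = ∑' b : u, t * μ (ball (b : X) (5 * (2 : ℝ) ^ (-k b))) := ENNReal.tsum_mul_left.symm
    _ ≤ ∑' b : u, ENNReal.ofReal (C * 5 ^ n) * ∫⁻ y in ball (b : X) ((2 : ℝ) ^ (-k b)), f y ∂μ :=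
        ENNReal.tsum_le_tsum fun b => hterm b b.2
    _ = ENNReal.ofReal (C * 5 ^ n) * ∫⁻ y in ⋃ b : u, ball (b : X) ((2 : ℝ) ^ (-k b)), f y ∂μ := by
        rw [ENNReal.tsum_mul_left, lintegral_iUnion (fun b => measurableSet_ball)]
        exact fun a b hab => hdisj a.2 b.2 fun hh => hab (Subtype.ext hh)
    _ ≤ _ := mul_le_mul' le_rfl (setLIntegral_le_lintegral _ _)

lemma tsum_int_eq_tsum_nat_sub {F : ℤ → ℝ≥0∞} (j₀ : ℤ) (hF : ∀ j, j₀ < j → F j = 0) :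
    ∑' j, F j = ∑' m : ℕ, F (j₀ - m) := by
  symm
  refine Function.Injective.tsum_eq (g := fun m : ℕ => j₀ - m) (fun a b hab => ?_) fun j hj => ?_
  · have hab : j₀ - (a : ℤ) = j₀ - b := hab
    omega
  · have : j ≤ j₀ := by
      by_contra hlt
      exact hj (hF j (by omega))
    exact ⟨(j₀ - j).toNat, by simp only; omega⟩

lemma exists_two_rpow_lt_le {a : ℝ≥0∞} (h0 : a ≠ 0) (ht : a ≠ ∞) :
    ∃ i : ℤ, (2 : ℝ≥0∞) ^ (i : ℝ) < a ∧ a ≤ 2 ^ ((i : ℝ) + 1) := by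
  obtain ⟨i, hi⟩ := ENNReal.exists_mem_Ioc_zpow h0 ht (by norm_num : (1 : ℝ≥0∞) < 2) (by norm_num)
  refine ⟨i, by rw [ENNReal.rpow_intCast]; exact hi.1, ?_⟩
  have := hi.2
  rw [← ENNReal.rpow_intCast] at this
  push_cast at this
  exact this

/-- One half of a dyadic layer-cake formula. For finite a > 0 the term with 2^i < a ≤ 2^{i+1}
already suffices; for a = ∞ the terms are unbounded. -/
lemma rpow_le_tsum_two_rpow {P : ℝ} (hP : 0 < P) (a : ℝ≥0∞) :
    a ^ P ≤ ∑' i : ℤ, if (2 : ℝ≥0∞) ^ (i : ℝ) < a then (2 : ℝ≥0∞) ^ (((i : ℝ) + 1) * P) else 0 := by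
  rcases eq_or_ne a 0 with rfl | h0
  · simp [hP]
  rcases eq_or_ne a ∞ with rfl | ht
  · rw [ENNReal.top_rpow_of_pos hP]
    refine (ENNReal.eq_top_of_forall_nnreal_le fun r => ?_).ge
    obtain ⟨m, hm⟩ := pow_unbounded_of_one_lt ((r : ℝ) ^ P⁻¹) (one_lt_two)
    refine le_trans ?_ (ENNReal.le_tsum (m : ℤ))
    have hlt : (2 : ℝ≥0∞) ^ (((m : ℤ)) : ℝ) < ∞ := by
      rw [ENNReal.rpow_intCast]; simp
    rw [if_pos hlt]
    have h1 : r ^ P⁻¹ ≤ (2 : ℝ≥0) ^ m := by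
      rw [← NNReal.coe_le_coe]; push_cast; exact hm.le
    have h2 : (r : ℝ≥0∞) ^ P⁻¹ ≤ (2 : ℝ≥0∞) ^ ((m : ℝ) + 1) := by
      rw [← ENNReal.coe_rpow_of_nonneg _ (inv_pos.2 hP).le]
      calc ((r ^ P⁻¹ : ℝ≥0) : ℝ≥0∞) ≤ ((2 ^ m : ℝ≥0) : ℝ≥0∞) := by exact_mod_cast h1
        _ = (2 : ℝ≥0∞) ^ (m : ℝ) := by rw [ENNReal.rpow_natCast]; push_cast; rfl
        _ ≤ _ := ENNReal.rpow_le_rpow_of_exponent_le (by norm_num) (by linarith)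
    have h3 := ENNReal.rpow_le_rpow h2 hP.le
    rw [← ENNReal.rpow_mul, inv_mul_cancel₀ hP.ne', ENNReal.rpow_one, ← ENNReal.rpow_mul] at h3
    simpa using h3
  · obtain ⟨i, h1, h2⟩ := exists_two_rpow_lt_le h0 ht
    refine le_trans ?_ (ENNReal.le_tsum i)
    rw [if_pos h1, ENNReal.rpow_mul]
    exact ENNReal.rpow_le_rpow h2 hP.le

/-- The other half: a geometric series descending from the largest dyadic level below a, which
converges because b > 0. -/
lemma tsum_two_rpow_le {b : ℝ} (hb : 0 < b) (a : ℝ≥0∞) :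
    ∑' i : ℤ, (if (2 : ℝ≥0∞) ^ (i : ℝ) < a then (2 : ℝ≥0∞) ^ ((i : ℝ) * b) else 0)
      ≤ (1 - (2 : ℝ≥0∞) ^ (-b))⁻¹ * a ^ b := by
  rcases eq_or_ne a 0 with rfl | h0
  · simp
  rcases eq_or_ne a ∞ with rfl | ht
  · rw [ENNReal.top_rpow_of_pos hb, ENNReal.mul_top]
    · exact le_top
    · rw [Ne, ENNReal.inv_eq_zero]
      exact ne_top_of_le_ne_top ENNReal.one_ne_top tsub_le_self
  obtain ⟨i₀, h1, h2⟩ := exists_two_rpow_lt_le h0 ht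
  rw [tsum_int_eq_tsum_nat_sub i₀]
  · calc _ ≤ ∑' m : ℕ, a ^ b * ((2 : ℝ≥0∞) ^ (-b)) ^ m := by
          refine ENNReal.tsum_le_tsum fun m => ?_
          split_ifs with hlt
          · rw [← ENNReal.rpow_natCast, ← ENNReal.rpow_mul]
            calc (2 : ℝ≥0∞) ^ (((i₀ - (m : ℤ) : ℤ) : ℝ) * b)
                = ((2 : ℝ≥0∞) ^ (i₀ : ℝ)) ^ b * 2 ^ (-b * m) := by
                  rw [← ENNReal.rpow_mul, ← ENNReal.rpow_add _ _ (by norm_num) (by norm_num)]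
                  push_cast
                  ring_nf
              _ ≤ _ := by gcongr
          · exact zero_le
      _ = _ := by rw [ENNReal.tsum_mul_left, ENNReal.tsum_geometric, mul_comm]
  · intro j hj
    rw [if_neg]
    rw [not_lt]
    refine h2.trans (ENNReal.rpow_le_rpow_of_exponent_le (by norm_num) ?_)
    exact_mod_cast hj

lemma one_sub_two_rpow_neg_inv_ne_top {b : ℝ} (hb : 0 < b) : (1 - (2 : ℝ≥0∞) ^ (-b))⁻¹ ≠ ∞ := by
  rw [Ne, ENNReal.inv_eq_top, tsub_eq_zero_iff_le, not_le]
  exact ENNReal.rpow_lt_one_of_one_lt_of_neg (by norm_num) (by linarith)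

/-- The Hardy–Littlewood maximal theorem. -/
theorem IsDoubling.exists_lintegral_dyadicMaximal_rpow_le [BorelSpace X]
    [SecondCountableTopology X] [SFinite μ] {C n : ℝ} (h : IsDoubling μ C n) {P : ℝ} (hP : 1 < P) :
    ∃ K : ℝ≥0∞, K ≠ ∞ ∧ ∀ f : X → ℝ≥0∞, AEMeasurable f μ →
      ∫⁻ x, dyadicMaximal μ f x ^ P ∂μ ≤ K * ∫⁻ x, f x ^ P ∂μ := by
  have hP0 : 0 < P := by linarith
  set D := ENNReal.ofReal (C * 5 ^ n) with hD
  refine ⟨D * 2 ^ (2 * P) * (1 - (2 : ℝ≥0∞) ^ (-(P - 1)))⁻¹, ?_, fun f hf => ?_⟩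
  · exact ENNReal.mul_ne_top (ENNReal.mul_ne_top ENNReal.ofReal_ne_top (by simp))
      (one_sub_two_rpow_neg_inv_ne_top (by linarith))
  wlog hfm : Measurable f generalizing f
  · have h1 := this _ hf.measurable_mk.aemeasurable hf.measurable_mk
    have h2 : dyadicMaximal μ (hf.mk f) = dyadicMaximal μ f := by
      funext x
      simp only [dyadicMaximal, setLAverage_congr_ae hf.ae_eq_mk]
    rw [h2] at h1
    refine h1.trans_eq ?_
    congr 1
    exact lintegral_congr_ae (hf.ae_eq_mk.mono fun x hx => by simp only [hx])
  set M := dyadicMaximal μ f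
  have hM : Measurable M := measurable_dyadicMaximal hf
  have hset : ∀ i : ℤ, MeasurableSet {x | (2 : ℝ≥0∞) ^ (i : ℝ) < M x} := fun i =>
    measurableSet_lt measurable_const hM
  -- The part of f of height at most 2^{i-1} contributes at most 2^{i-1} to any average, so where
  -- the maximal function exceeds 2^i the remaining part `g i` has maximal function above 2^{i-1}.
  -- The weak bound is applied to `g i` at that height.
  let g : ℤ → X → ℝ≥0∞ := fun i => {x | (2 : ℝ≥0∞) ^ ((i : ℝ) - 1) < f x}.indicator f
  have hsetf : ∀ i : ℤ, MeasurableSet {x | (2 : ℝ≥0∞) ^ ((i : ℝ) - 1) < f x} := fun i =>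
    measurableSet_lt measurable_const hfm
  have hweak : ∀ i : ℤ, (2 : ℝ≥0∞) ^ ((i : ℝ) - 1) * μ {x | (2 : ℝ≥0∞) ^ (i : ℝ) < M x}
      ≤ D * ∫⁻ x, g i x ∂μ := by
    intro i
    refine le_trans ?_ (h.mul_measure_lt_dyadicMaximal_le (g i) ((2 : ℝ≥0∞) ^ ((i : ℝ) - 1)))
    refine mul_le_mul' le_rfl (measure_mono ?_)
    intro x hx
    obtain ⟨k, hk⟩ : ∃ k : ℤ, (2 : ℝ≥0∞) ^ (i : ℝ) < ⨍⁻ y in ball x ((2 : ℝ) ^ (-k)), f y ∂μ :=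
      lt_iSup_iff.1 hx
    refine lt_of_lt_of_le ?_ (setLAverage_le_dyadicMaximal _ _ k)
    have hx2 : ⨍⁻ y in ball x ((2 : ℝ) ^ (-k)), f y ∂μ
        ≤ ⨍⁻ y in ball x ((2 : ℝ) ^ (-k)), g i y ∂μ + 2 ^ ((i : ℝ) - 1) := by
      have h3 := setLAverage_const (μ := μ) (h.ball_ne_zero x (by positivity : (0 : ℝ) < 2 ^ (-k)))
        (h.ball_ne_top x _) (2 ^ ((i : ℝ) - 1))
      rw [← h3, ← setLAverage_add_le (hfm.indicator (hsetf i)).aemeasurable]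
      refine setLAverage_mono fun y => ?_
      by_cases hy : (2 : ℝ≥0∞) ^ ((i : ℝ) - 1) < f y
      · simp only [indicator_of_mem (show y ∈ {x | (2 : ℝ≥0∞) ^ ((i : ℝ) - 1) < f x} from hy)]
        exact le_self_add
      · exact le_add_left (not_lt.1 hy)
    have h4 : (2 : ℝ≥0∞) ^ (i : ℝ) = 2 ^ ((i : ℝ) - 1) + 2 ^ ((i : ℝ) - 1) := by
      rw [← two_mul]
      nth_rewrite 2 [← ENNReal.rpow_one 2]
      rw [← ENNReal.rpow_add _ _ (by norm_num) (by norm_num)]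
      ring_nf
    have h5 := hk.trans_le hx2
    rw [h4] at h5
    exact lt_of_add_lt_add_right h5
  have hmul : ∀ i : ℤ, (2 : ℝ≥0∞) ^ (((i : ℝ) + 1) * P)
      = 2 ^ (2 * P) * (2 ^ (((i : ℝ) - 1) * (P - 1)) * 2 ^ ((i : ℝ) - 1)) := by
    intro i
    rw [← ENNReal.rpow_add _ _ (by norm_num) (by norm_num),
      ← ENNReal.rpow_add _ _ (by norm_num) (by norm_num)]
    ring_nf
  calc ∫⁻ x, M x ^ P ∂μ
      ≤ ∫⁻ x, ∑' i : ℤ, {x | (2 : ℝ≥0∞) ^ (i : ℝ) < M x}.indicator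
          (fun _ => (2 : ℝ≥0∞) ^ (((i : ℝ) + 1) * P)) x ∂μ := by
        refine lintegral_mono fun x => (rpow_le_tsum_two_rpow hP0 (M x)).trans_eq ?_
        simp only [indicator, mem_ofPred_eq]
    _ = ∑' i : ℤ, (2 : ℝ≥0∞) ^ (((i : ℝ) + 1) * P) * μ {x | (2 : ℝ≥0∞) ^ (i : ℝ) < M x} := by
        rw [lintegral_tsum fun i => (measurable_const.indicator (hset i)).aemeasurable]
        exact tsum_congr fun i => lintegral_indicator_const (hset i) _
    _ ≤ ∑' i : ℤ, D * 2 ^ (2 * P) * (2 ^ (((i : ℝ) - 1) * (P - 1)) * ∫⁻ x, g i x ∂μ) := by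
        refine ENNReal.tsum_le_tsum fun i => ?_
        calc _ = 2 ^ (2 * P) * 2 ^ (((i : ℝ) - 1) * (P - 1)) *
              (2 ^ ((i : ℝ) - 1) * μ {x | (2 : ℝ≥0∞) ^ (i : ℝ) < M x}) := by rw [hmul]; ring
          _ ≤ 2 ^ (2 * P) * 2 ^ (((i : ℝ) - 1) * (P - 1)) * (D * ∫⁻ x, g i x ∂μ) := by
            exact mul_le_mul' le_rfl (hweak i)
          _ = _ := by ring
    _ = D * 2 ^ (2 * P) * ∫⁻ x, ∑' i : ℤ, 2 ^ (((i : ℝ) - 1) * (P - 1)) * g i x ∂μ := by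
        rw [ENNReal.tsum_mul_left,
          lintegral_tsum fun i => ((hfm.indicator (hsetf i)).const_mul _).aemeasurable]
        congr 1
        exact tsum_congr fun i => (lintegral_const_mul _ (hfm.indicator (hsetf i))).symm
    _ ≤ D * 2 ^ (2 * P) * ∫⁻ x, (1 - (2 : ℝ≥0∞) ^ (-(P - 1)))⁻¹ * f x ^ P ∂μ := by
        -- The sum over the levels i with 2^{i-1} < f(x) is geometric with exponent P - 1 > 0 and
        -- yields f^{P-1}; the leftover factor f completes the power.
        gcongr with x
        calc ∑' i : ℤ, 2 ^ (((i : ℝ) - 1) * (P - 1)) * g i x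
            = ∑' i : ℤ, 2 ^ ((i : ℝ) * (P - 1)) * g (i + 1) x := by
              rw [← (Equiv.addRight (1 : ℤ)).tsum_eq]
              refine tsum_congr fun i => ?_
              simp
          _ = (∑' i : ℤ, (if (2 : ℝ≥0∞) ^ (i : ℝ) < f x then
                (2 : ℝ≥0∞) ^ ((i : ℝ) * (P - 1)) else 0)) * f x := by
              rw [← ENNReal.tsum_mul_right]
              refine tsum_congr fun i => ?_
              simp only [g, indicator, mem_ofPred_eq]
              push_cast
              simp only [add_sub_cancel_right]
              split_ifs <;> simp
          _ ≤ (1 - (2 : ℝ≥0∞) ^ (-(P - 1)))⁻¹ * f x ^ (P - 1) * f x := by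
              gcongr
              exact tsum_two_rpow_le (by linarith) (f x)
          _ = _ := by
              rw [mul_assoc]
              congr 1
              nth_rewrite 2 [← ENNReal.rpow_one (f x)]
              rw [← ENNReal.rpow_add_of_nonneg _ _ (by linarith) zero_le_one]
              ring_nf
    _ = _ := by
        rw [lintegral_const_mul _ (hfm.pow_const P)]
        ring

end HajlaszTL

/-! ### Vector-valued inequalities for averaging operators -/

namespace HajlaszTL

/-- Truncation in height and in space makes the integrals finite, so that the duality argument below
may divide by them; monotone convergence then removes it. -/
lemma iSup_indicator_min_rpow {X : Type*} [MetricSpace X] {Φ : X → ℝ≥0∞} {P : ℝ} (o x : X) :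
    Φ x ^ P ≤ ⨆ N : ℕ, (ball o N).indicator (fun x => min (Φ x) N ^ P) x := by
  have h1 : Filter.Tendsto (fun N : ℕ => min (Φ x) (N : ℝ≥0∞) ^ P) Filter.atTop (nhds (Φ x ^ P)) := by
    have h2 : Filter.Tendsto (fun N : ℕ => min (Φ x) (N : ℝ≥0∞)) Filter.atTop
        (nhds (min (Φ x) ∞)) := tendsto_const_nhds.min ENNReal.tendsto_nat_nhds_top
    rw [min_eq_left le_top] at h2
    exact (ENNReal.continuous_rpow_const.tendsto _).comp h2
  refine le_of_tendsto h1 ?_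
  obtain ⟨N₀, hN₀⟩ := exists_nat_gt (dist x o)
  filter_upwards [Filter.eventually_ge_atTop N₀] with N hN
  refine le_trans (le_of_eq ?_)
    (le_iSup (fun N : ℕ => (ball o N).indicator (fun x => min (Φ x) N ^ P) x) N)
  rw [indicator_of_mem]
  exact lt_of_lt_of_le hN₀ (by exact_mod_cast hN)

variable {X : Type*} [MetricSpace X] [MeasurableSpace X] {μ : Measure X}
  [BorelSpace X] [SecondCountableTopology X] [SFinite μ] {C n : ℝ}

lemma IsDoubling.lintegral_setLAverage_le (h : IsDoubling μ C n)
    {f : X → ℝ≥0∞} (hf : AEMeasurable f μ) {ρ : ℝ} (hρ : 0 < ρ) :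
    ∫⁻ x, (⨍⁻ y in ball x ρ, f y ∂μ) ∂μ ≤ ENNReal.ofReal (C * 2 ^ n) * ∫⁻ y, f y ∂μ := by
  have h1 := h.lintegral_setLAverage_mul_le hf (aemeasurable_const (b := (1 : ℝ≥0∞))) hρ
  have h2 : ∀ y, ⨍⁻ x in ball y ρ, (1 : ℝ≥0∞) ∂μ = 1 := fun y =>
    setLAverage_const (h.ball_ne_zero y hρ) (h.ball_ne_top y ρ) 1
  simpa only [h2, mul_one] using h1

/-- The dual form of the maximal theorem. For P > 1 the sum of averages is tested against a weight
w, self-adjointness moves each average onto w, where it is at most the maximal function of w, and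
Hölder's inequality with the maximal theorem in the conjugate exponent concludes. For P = 1 the L¹
bound for each average is enough. -/
lemma IsDoubling.exists_lintegral_tsum_setLAverage_rpow_le (h : IsDoubling μ C n) {P : ℝ}
    (hP : 1 ≤ P) :
    ∃ K : ℝ≥0∞, K ≠ ∞ ∧ ∀ H : ℤ → X → ℝ≥0∞, (∀ k, AEMeasurable (H k) μ) →
      ∫⁻ x, (∑' k : ℤ, ⨍⁻ y in ball x ((2 : ℝ) ^ (-k)), H k y ∂μ) ^ P ∂μ
        ≤ K * ∫⁻ x, (∑' k : ℤ, H k x) ^ P ∂μ := by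
  have hpos : ∀ k : ℤ, (0 : ℝ) < 2 ^ (-k) := fun k => by positivity
  set D := ENNReal.ofReal (C * 2 ^ n) with hD
  rcases hP.eq_or_lt with rfl | hP
  · refine ⟨D, ENNReal.ofReal_ne_top, fun H hH => ?_⟩
    simp only [ENNReal.rpow_one]
    rw [lintegral_tsum fun k => (measurable_setLAverage_ball (hH k) _).aemeasurable,
      lintegral_tsum hH, ← ENNReal.tsum_mul_left]
    exact ENNReal.tsum_le_tsum fun k => h.lintegral_setLAverage_le (hH k) (hpos k)
  have hP0 : 0 < P := by linarith
  have hconj : P.HolderConjugate (Real.conjExponent P) := Real.HolderConjugate.conjExponent hP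
  set P' := Real.conjExponent P with hP'
  obtain ⟨K, hK, hM⟩ := h.exists_lintegral_dyadicMaximal_rpow_le hconj.symm.lt
  have hP'0 : 0 < P' := hconj.symm.pos
  refine ⟨(D * K ^ (1 / P')) ^ P, ?_, fun H hH => ?_⟩
  · refine ENNReal.rpow_ne_top_of_nonneg hP0.le (ENNReal.mul_ne_top ENNReal.ofReal_ne_top ?_)
    exact ENNReal.rpow_ne_top_of_nonneg (by positivity) hK
  rcases isEmpty_or_nonempty X with hX | ⟨⟨o⟩⟩
  · rw [Measure.eq_zero_of_isEmpty μ]; simp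
  set Φ : X → ℝ≥0∞ := fun x => ∑' k : ℤ, ⨍⁻ y in ball x ((2 : ℝ) ^ (-k)), H k y ∂μ with hΦ
  have hΦm : Measurable Φ := Measurable.tsum fun k => measurable_setLAverage_ball (hH k) _
  let F : ℕ → X → ℝ≥0∞ := fun N => (ball o N).indicator fun x => min (Φ x) N ^ P
  have hFm : ∀ N, Measurable (F N) := fun N =>
    ((hΦm.min measurable_const).pow_const P).indicator measurableSet_ball
  have key : ∀ N, ∫⁻ x, F N x ∂μ ≤ (D * K ^ (1 / P')) ^ P * ∫⁻ x, (∑' k : ℤ, H k x) ^ P ∂μ := by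
    intro N
    set I := ∫⁻ x, F N x ∂μ with hI
    have hItop : I ≠ ∞ := by
      refine ne_top_of_le_ne_top (b := (N : ℝ≥0∞) ^ P * μ (ball o N)) ?_ ?_
      · exact ENNReal.mul_ne_top (ENNReal.rpow_ne_top_of_nonneg hP0.le (by simp))
          (h.ball_ne_top o _)
      · rw [hI, ← lintegral_indicator_const measurableSet_ball]
        refine lintegral_mono fun x => indicator_le_indicator ?_
        exact ENNReal.rpow_le_rpow (min_le_right _ _) hP0.le
    rcases eq_or_ne I 0 with hI0 | hI0
    · rw [hI0]; exact zero_le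
    -- The extremal weight for L^P duality: its conjugate power is the truncated integrand, so a
    -- power of `I` appears on both sides and can be cancelled.
    let w : X → ℝ≥0∞ := (ball o N).indicator fun x => min (Φ x) N ^ (P - 1)
    have hwm : Measurable w := ((hΦm.min measurable_const).pow_const _).indicator measurableSet_ball
    have hwP : ∀ x, w x ^ P' = F N x := by
      intro x
      by_cases hx : x ∈ ball o (N : ℝ)
      · simp only [w, F, indicator_of_mem hx]
        rw [← ENNReal.rpow_mul, hP', Real.conjExponent]
        congr 1
        field_simp [show P - 1 ≠ 0 by linarith]
      · simp only [w, F, indicator_of_notMem hx, ENNReal.zero_rpow_of_pos hP'0]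
    have h1 : I ≤ ∫⁻ x, Φ x * w x ∂μ := by
      refine lintegral_mono fun x => ?_
      by_cases hx : x ∈ ball o (N : ℝ)
      · simp only [w, F, indicator_of_mem hx]
        have : min (Φ x) N ^ P = min (Φ x) N * min (Φ x) N ^ (P - 1) := by
          nth_rewrite 2 [← ENNReal.rpow_one (min (Φ x) N)]
          rw [← ENNReal.rpow_add_of_nonneg _ _ zero_le_one (by linarith)]
          ring_nf
        rw [this]
        exact mul_le_mul' (min_le_left _ _) le_rfl
      · simp only [w, F, indicator_of_notMem hx, mul_zero, le_refl]
    have h2 : ∫⁻ x, Φ x * w x ∂μ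
        ≤ D * ∫⁻ x, (∑' k : ℤ, H k x) * dyadicMaximal μ w x ∂μ := by
      simp only [hΦ, ← ENNReal.tsum_mul_right]
      rw [lintegral_tsum
          (f := fun (k : ℤ) x => (⨍⁻ y in ball x ((2 : ℝ) ^ (-k)), H k y ∂μ) * w x)
          fun k => ((measurable_setLAverage_ball (hH k) _).mul hwm).aemeasurable,
        lintegral_tsum (f := fun (k : ℤ) x => H k x * dyadicMaximal μ w x)
          fun k => (hH k).mul (measurable_dyadicMaximal hwm.aemeasurable).aemeasurable,
        ← ENNReal.tsum_mul_left]
      refine ENNReal.tsum_le_tsum fun k => ?_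
      refine (h.lintegral_setLAverage_mul_le (hH k) hwm.aemeasurable (hpos k)).trans ?_
      refine mul_le_mul' le_rfl (lintegral_mono fun x => mul_le_mul' le_rfl ?_)
      exact setLAverage_le_dyadicMaximal _ _ _
    have h3 : ∫⁻ x, (∑' k : ℤ, H k x) * dyadicMaximal μ w x ∂μ
        ≤ (∫⁻ x, (∑' k : ℤ, H k x) ^ P ∂μ) ^ (1 / P) * (K ^ (1 / P') * I ^ (1 / P')) := by
      refine (ENNReal.lintegral_mul_le_Lp_mul_Lq μ hconj (AEMeasurable.tsum hH)
        (measurable_dyadicMaximal hwm.aemeasurable).aemeasurable).trans ?_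
      refine mul_le_mul' le_rfl ?_
      rw [← ENNReal.mul_rpow_of_nonneg _ _ (by positivity)]
      refine ENNReal.rpow_le_rpow ((hM w hwm.aemeasurable).trans_eq ?_) (by positivity)
      simp only [hwP, hI]
    have h4 : I ^ (1 / P) * I ^ (1 / P')
        ≤ (D * K ^ (1 / P') * (∫⁻ x, (∑' k : ℤ, H k x) ^ P ∂μ) ^ (1 / P)) * I ^ (1 / P') := by
      calc I ^ (1 / P) * I ^ (1 / P') = I := by
            rw [← ENNReal.rpow_add _ _ hI0 hItop, one_div, one_div, hconj.inv_add_inv_eq_one,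
              ENNReal.rpow_one]
        _ ≤ D * ((∫⁻ x, (∑' k : ℤ, H k x) ^ P ∂μ) ^ (1 / P) * (K ^ (1 / P') * I ^ (1 / P'))) :=
            (h1.trans h2).trans (mul_le_mul' le_rfl h3)
        _ = _ := by ring
    have h5 := (ENNReal.mul_le_mul_iff_left (by simp [hI0, hItop])
      (ENNReal.rpow_ne_top_of_nonneg (by positivity) hItop)).1 h4
    have h6 := ENNReal.rpow_le_rpow h5 hP0.le
    rw [ENNReal.mul_rpow_of_nonneg _ _ hP0.le, ← ENNReal.rpow_mul, ← ENNReal.rpow_mul,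
      one_div_mul_cancel hP0.ne', ENNReal.rpow_one, ENNReal.rpow_one] at h6
    exact h6
  calc ∫⁻ x, Φ x ^ P ∂μ ≤ ∫⁻ x, ⨆ N, F N x ∂μ :=
        lintegral_mono fun x => iSup_indicator_min_rpow o x
    _ = ⨆ N, ∫⁻ x, F N x ∂μ := by
        refine lintegral_iSup hFm fun N N' hN x => ?_
        simp only [F]
        refine (indicator_le_indicator_of_subset (ball_subset_ball (by exact_mod_cast hN))
          (fun _ => zero_le) x).trans (indicator_le_indicator ?_)
        refine ENNReal.rpow_le_rpow (min_le_min le_rfl (by exact_mod_cast hN)) hP0.le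
    _ ≤ _ := iSup_le key

/-- For p < q a factorisation replaces duality. With Φ = Σ F_k^q, write F_k = V^{(q-1)/q} G_k^{1/q},
where V is a power of Φ and Σ G_k = Φ^{p/q}. Hölder on each ball gives (avg F_k)^q ≤ (MV)^{q-1} avg
G_k, with M the maximal operator. Hölder in x then leaves the maximal theorem for V and the L¹ bound
for the averages of G_k. -/
lemma IsDoubling.exists_lintegral_tsum_setLAverage_rpow_rpow_le (h : IsDoubling μ C n) {p q : ℝ}
    (hp : 1 < p) (hpq : p < q) :
    ∃ K : ℝ≥0∞, K ≠ ∞ ∧ ∀ F : ℤ → X → ℝ≥0∞, (∀ k, AEMeasurable (F k) μ) →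
      ∫⁻ x, (∑' k : ℤ, (⨍⁻ y in ball x ((2 : ℝ) ^ (-k)), F k y ∂μ) ^ q) ^ (p / q) ∂μ
        ≤ K * ∫⁻ x, (∑' k : ℤ, F k x ^ q) ^ (p / q) ∂μ := by
  have hpos : ∀ k : ℤ, (0 : ℝ) < 2 ^ (-k) := fun k => by positivity
  have hq0 : 0 < q := by linarith
  have hq1 : 0 < q - 1 := by linarith
  set D := ENNReal.ofReal (C * 2 ^ n) with hD
  set θ := p / q with hθ
  have hθ0 : 0 < θ := by positivity
  have hθ1 : 0 < 1 - θ := by rw [hθ, sub_pos, div_lt_one hq0]; exact hpq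
  -- The exponent at which the maximal function of V is needed, equal to p(q-1)/(q-p); it exceeds 1
  -- precisely because p > 1.
  have hP : 1 < (q - 1) * θ / (1 - θ) := by
    rw [one_lt_div hθ1, hθ]
    have : (q - 1) * (p / q) - (1 - p / q) = p - 1 := by field_simp; ring
    linarith
  obtain ⟨K, hK, hM⟩ := h.exists_lintegral_dyadicMaximal_rpow_le hP
  set P := (q - 1) * θ / (1 - θ) with hPdef
  -- The added 1 keeps the constant nonzero, so that the inequality is trivial when the right-hand
  -- integral is infinite.
  refine ⟨K ^ (1 - θ) * D ^ θ + 1, ?_, fun F hF => ?_⟩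
  · exact ENNReal.add_ne_top.2 ⟨ENNReal.mul_ne_top (ENNReal.rpow_ne_top_of_nonneg hθ1.le hK)
      (ENNReal.rpow_ne_top_of_nonneg hθ0.le ENNReal.ofReal_ne_top), ENNReal.one_ne_top⟩
  set Φ : X → ℝ≥0∞ := fun x => ∑' k : ℤ, F k x ^ q with hΦ
  have hΦm : AEMeasurable Φ μ := AEMeasurable.tsum fun k => (hF k).pow_const q
  by_cases htop : ∫⁻ x, Φ x ^ θ ∂μ = ∞
  · rw [htop]
    rw [ENNReal.mul_top (by simp)]
    exact le_top
  -- The factorisation uses negative powers of Φ: the set where Φ = ∞ is null, and where Φ = 0 every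
  -- F_k vanishes.
  have hfin : ∀ᵐ x ∂μ, Φ x ≠ ∞ := by
    filter_upwards [ae_lt_top' (hΦm.pow_const θ) htop] with x hx h0
    rw [h0, ENNReal.top_rpow_of_pos hθ0] at hx
    exact lt_irrefl _ hx
  set a := (1 - θ) / q with ha
  have ha0 : 0 < a := by positivity
  let V : X → ℝ≥0∞ := fun x => Φ x ^ (a * (q / (q - 1)))
  let G : ℤ → X → ℝ≥0∞ := fun k x => (F k x * Φ x ^ (-a)) ^ q
  have hVm : AEMeasurable V μ := hΦm.pow_const _
  have hGm : ∀ k, AEMeasurable (G k) μ := fun k => ((hF k).mul (hΦm.pow_const _)).pow_const q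
  have hFle : ∀ x, Φ x = 0 → ∀ k, F k x = 0 := by
    intro x hx k
    have h1 := ENNReal.tsum_eq_zero.1 hx k
    rcases ENNReal.rpow_eq_zero_iff.1 h1 with h2 | h2
    · exact h2.1
    · linarith [h2.2]
  have hFVG : ∀ k, ∀ᵐ x ∂μ, F k x = V x ^ ((q - 1) / q) * G k x ^ (1 / q) := by
    intro k
    filter_upwards [hfin] with x hx
    simp only [V, G]
    rw [← ENNReal.rpow_mul, ← ENNReal.rpow_mul, mul_one_div_cancel hq0.ne', ENNReal.rpow_one]
    have h1 : a * (q / (q - 1)) * ((q - 1) / q) = a := by field_simp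
    rw [h1]
    rcases eq_or_ne (Φ x) 0 with h0 | h0
    · rw [hFle x h0 k]; simp
    · rw [mul_comm (F k x), ← mul_assoc, ← ENNReal.rpow_add _ _ h0 hx, add_neg_cancel,
        ENNReal.rpow_zero, one_mul]
  have hstep : ∀ k x, (⨍⁻ y in ball x ((2 : ℝ) ^ (-k)), F k y ∂μ) ^ q
      ≤ dyadicMaximal μ V x ^ (q - 1) * ⨍⁻ y in ball x ((2 : ℝ) ^ (-k)), G k y ∂μ := by
    intro k x
    have h1 : ⨍⁻ y in ball x ((2 : ℝ) ^ (-k)), F k y ∂μ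
        ≤ (⨍⁻ y in ball x ((2 : ℝ) ^ (-k)), V y ∂μ) ^ ((q - 1) / q)
          * (⨍⁻ y in ball x ((2 : ℝ) ^ (-k)), G k y ∂μ) ^ (1 / q) := by
      rw [setLAverage_congr_ae (hFVG k)]
      refine ENNReal.lintegral_mul_norm_pow_le (hVm.restrict.smul_measure _)
        ((hGm k).restrict.smul_measure _) (by positivity) (by positivity) ?_
      field_simp
      ring
    refine (ENNReal.rpow_le_rpow h1 hq0.le).trans ?_
    rw [ENNReal.mul_rpow_of_nonneg _ _ hq0.le, ← ENNReal.rpow_mul, ← ENNReal.rpow_mul,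
      one_div_mul_cancel hq0.ne', ENNReal.rpow_one, div_mul_cancel₀ _ hq0.ne']
    exact mul_le_mul' (ENNReal.rpow_le_rpow (setLAverage_le_dyadicMaximal _ _ _) hq1.le) le_rfl
  have hTm : Measurable fun x => ∑' k : ℤ, ⨍⁻ y in ball x ((2 : ℝ) ^ (-k)), G k y ∂μ :=
    Measurable.tsum fun k => measurable_setLAverage_ball (hGm k) _
  have hMm : Measurable (dyadicMaximal μ V) := measurable_dyadicMaximal hVm
  calc ∫⁻ x, (∑' k : ℤ, (⨍⁻ y in ball x ((2 : ℝ) ^ (-k)), F k y ∂μ) ^ q) ^ θ ∂μ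
      ≤ ∫⁻ x, (dyadicMaximal μ V x ^ P) ^ (1 - θ)
          * (∑' k : ℤ, ⨍⁻ y in ball x ((2 : ℝ) ^ (-k)), G k y ∂μ) ^ θ ∂μ := by
        refine lintegral_mono fun x => ?_
        have h1 : (dyadicMaximal μ V x ^ P) ^ (1 - θ) = (dyadicMaximal μ V x ^ (q - 1)) ^ θ := by
          rw [← ENNReal.rpow_mul, ← ENNReal.rpow_mul, hPdef, div_mul_cancel₀ _ hθ1.ne']
        rw [h1, ← ENNReal.mul_rpow_of_nonneg _ _ hθ0.le]
        refine ENNReal.rpow_le_rpow ?_ hθ0.le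
        rw [← ENNReal.tsum_mul_left]
        exact ENNReal.tsum_le_tsum fun k => hstep k x
    _ ≤ (∫⁻ x, dyadicMaximal μ V x ^ P ∂μ) ^ (1 - θ)
          * (∫⁻ x, ∑' k : ℤ, ⨍⁻ y in ball x ((2 : ℝ) ^ (-k)), G k y ∂μ ∂μ) ^ θ :=
        ENNReal.lintegral_mul_norm_pow_le (hMm.pow_const P).aemeasurable hTm.aemeasurable
          hθ1.le hθ0.le (by ring)
    _ ≤ (K * ∫⁻ x, Φ x ^ θ ∂μ) ^ (1 - θ) * (D * ∫⁻ x, Φ x ^ θ ∂μ) ^ θ := by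
        refine mul_le_mul' (ENNReal.rpow_le_rpow ((hM V hVm).trans_eq ?_) hθ1.le)
          (ENNReal.rpow_le_rpow ?_ hθ0.le)
        · congr 2
          funext x
          simp only [V]
          rw [← ENNReal.rpow_mul]
          congr 1
          rw [hPdef, ha]
          field_simp
        · rw [lintegral_tsum fun k => (measurable_setLAverage_ball (hGm k) _).aemeasurable]
          calc _ ≤ ∑' k, D * ∫⁻ x, G k x ∂μ :=
                ENNReal.tsum_le_tsum fun k => h.lintegral_setLAverage_le (hGm k) (hpos k)
            _ = D * ∫⁻ x, ∑' k, G k x ∂μ := by rw [ENNReal.tsum_mul_left, lintegral_tsum hGm]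
            _ = D * ∫⁻ x, Φ x ^ θ ∂μ := by
                congr 1
                refine lintegral_congr_ae ?_
                filter_upwards [hfin] with x hx
                rcases eq_or_ne (Φ x) 0 with h0 | h0
                · simp [G, hFle x h0, h0, hθ0, hq0]
                · simp only [G, ENNReal.mul_rpow_of_nonneg _ _ hq0.le, ENNReal.tsum_mul_right]
                  change Φ x * _ = _
                  nth_rewrite 1 [← ENNReal.rpow_one (Φ x)]
                  rw [← ENNReal.rpow_mul, ← ENNReal.rpow_add _ _ h0 hx]
                  congr 1
                  rw [ha]
                  field_simp
                  ring
    _ = K ^ (1 - θ) * D ^ θ * ∫⁻ x, Φ x ^ θ ∂μ := by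
        rw [ENNReal.mul_rpow_of_nonneg _ _ hθ1.le, ENNReal.mul_rpow_of_nonneg _ _ hθ0.le]
        have h1 : (∫⁻ x, Φ x ^ θ ∂μ) = (∫⁻ x, Φ x ^ θ ∂μ) ^ (1 - θ) * (∫⁻ x, Φ x ^ θ ∂μ) ^ θ := by
          rw [← ENNReal.rpow_add_of_nonneg _ _ hθ1.le hθ0.le, sub_add_cancel, ENNReal.rpow_one]
        nth_rewrite 3 [h1]
        ring
    _ ≤ _ := mul_le_mul' le_self_add le_rfl

end HajlaszTL

/-! ### Sequence norms and the discrete Hardy inequality -/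

namespace HajlaszTL

section Sequences

lemma tsum_subtype_le_eq_tsum_nat (k : ℤ) (F : ℤ → ℝ≥0∞) :
    ∑' j : {j : ℤ // k ≤ j}, F j = ∑' m : ℕ, F (k + m) := by
  symm
  let e : ℕ ≃ {j : ℤ // k ≤ j} :=
    { toFun := fun m => ⟨k + m, by omega⟩
      invFun := fun j => (j.1 - k).toNat
      left_inv := fun m => by simp
      right_inv := fun j => by
        have := j.2
        ext
        simp only
        omega }
  exact e.tsum_eq fun j : {j : ℤ // k ≤ j} => F j

variable {q : ℝ≥0∞}

lemma lqNorm_top (a : ℤ → ℝ≥0∞) : lqNorm ∞ a = ⨆ k, a k := by simp [lqNorm]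

lemma lqNorm_of_ne_top (hq : q ≠ ∞) (a : ℤ → ℝ≥0∞) :
    lqNorm q a = (∑' k : ℤ, a k ^ q.toReal) ^ (1 / q.toReal) := by simp [lqNorm, hq]

lemma lqNorm_le_mul (hq : q ≠ 0) {a b : ℤ → ℝ≥0∞} {c : ℝ≥0∞} (h : ∀ k, a k ≤ c * b k) :
    lqNorm q a ≤ c * lqNorm q b := by
  rcases eq_or_ne q ∞ with rfl | hqt
  · rw [lqNorm_top, lqNorm_top, ENNReal.mul_iSup]
    exact iSup_mono h
  · have hQ : 0 < q.toReal := ENNReal.toReal_pos hq hqt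
    rw [lqNorm_of_ne_top hqt, lqNorm_of_ne_top hqt]
    calc (∑' k : ℤ, a k ^ q.toReal) ^ (1 / q.toReal)
        ≤ (∑' k : ℤ, c ^ q.toReal * b k ^ q.toReal) ^ (1 / q.toReal) := by
          gcongr with k
          rw [← ENNReal.mul_rpow_of_nonneg _ _ hQ.le]
          exact ENNReal.rpow_le_rpow (h k) hQ.le
      _ = _ := by
          rw [ENNReal.tsum_mul_left, ENNReal.mul_rpow_of_nonneg _ _ (by positivity),
            ← ENNReal.rpow_mul, mul_one_div_cancel hQ.ne', ENNReal.rpow_one]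

lemma le_lqNorm (hq : q ≠ 0) (a : ℤ → ℝ≥0∞) (k : ℤ) : a k ≤ lqNorm q a := by
  rcases eq_or_ne q ∞ with rfl | hqt
  · rw [lqNorm_top]
    exact le_iSup a k
  · have hQ : 0 < q.toReal := ENNReal.toReal_pos hq hqt
    rw [lqNorm_of_ne_top hqt, one_div, ENNReal.le_rpow_inv_iff hQ]
    exact ENNReal.le_tsum (f := fun k => a k ^ q.toReal) k

/-- The constant in the discrete Hardy inequality for the exponent `Q`. -/
noncomputable def hardyConst (θ : ℝ≥0∞) (Q : ℝ) : ℝ≥0∞ := ((1 - θ ^ (1 / 2 : ℝ))⁻¹) ^ Q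

lemma one_sub_inv_ne_top {θ : ℝ≥0∞} (hθ : θ < 1) : (1 - θ)⁻¹ ≠ ∞ := by
  rw [Ne, ENNReal.inv_eq_top, tsub_eq_zero_iff_le, not_le]
  exact hθ

lemma hardyConst_ne_top {θ : ℝ≥0∞} (hθ : θ < 1) {Q : ℝ} (hQ : 0 ≤ Q) : hardyConst θ Q ≠ ∞ :=
  ENNReal.rpow_ne_top_of_nonneg hQ
    (one_sub_inv_ne_top (ENNReal.rpow_lt_one hθ (by norm_num)))

/-- One half of the geometric weight is spent on bounding each term η^i a_i, with η = θ^{1/2}, by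
the full Q-sum; the other half is summed. No convexity is involved, so every Q > 0 is allowed. -/
lemma tsum_pow_mul_rpow_le {θ : ℝ≥0∞} {Q : ℝ} (hQ : 0 < Q) (a : ℕ → ℝ≥0∞) :
    (∑' i, θ ^ i * a i) ^ Q
      ≤ hardyConst θ Q * ∑' i, (θ ^ (Q / 2)) ^ i * a i ^ Q := by
  set η := θ ^ (1 / 2 : ℝ) with hη
  set S := (∑' i, (θ ^ (Q / 2)) ^ i * a i ^ Q) with hS
  have hη2 : θ = η * η := by
    rw [hη, ← ENNReal.rpow_add_of_nonneg _ _ (by norm_num) (by norm_num)]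
    norm_num
  have hterm : ∀ i, η ^ i * a i ≤ S ^ (1 / Q) := by
    intro i
    rw [one_div, ENNReal.le_rpow_inv_iff hQ, ENNReal.mul_rpow_of_nonneg _ _ hQ.le]
    refine le_trans (le_of_eq ?_) (ENNReal.le_tsum i)
    congr 1
    rw [hη, ← ENNReal.rpow_natCast, ← ENNReal.rpow_natCast, ← ENNReal.rpow_mul, ← ENNReal.rpow_mul,
      ← ENNReal.rpow_mul]
    ring_nf
  have hsum : ∑' i, θ ^ i * a i ≤ (1 - η)⁻¹ * S ^ (1 / Q) := by
    rw [← ENNReal.tsum_geometric, ← ENNReal.tsum_mul_right]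
    refine ENNReal.tsum_le_tsum fun i => ?_
    calc θ ^ i * a i = η ^ i * (η ^ i * a i) := by rw [hη2, mul_pow]; ring
      _ ≤ _ := by gcongr; exact hterm i
  refine (ENNReal.rpow_le_rpow hsum hQ.le).trans_eq ?_
  rw [ENNReal.mul_rpow_of_nonneg _ _ hQ.le, ← ENNReal.rpow_mul, one_div_mul_cancel hQ.ne',
    ENNReal.rpow_one, hardyConst]

/-- The geometric smoothing of a sequence, shifted by `M`. -/
noncomputable def hardySum (θ : ℝ≥0∞) (M : ℕ) (a : ℤ → ℝ≥0∞) (k : ℤ) : ℝ≥0∞ :=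
  ∑' i : ℕ, θ ^ i * a (k - M + i)

lemma le_hardySum (θ : ℝ≥0∞) (M : ℕ) (a : ℤ → ℝ≥0∞) (k : ℤ) (i : ℕ) :
    θ ^ i * a (k - M + i) ≤ hardySum θ M a k :=
  ENNReal.le_tsum (f := fun i : ℕ => θ ^ i * a (k - M + i)) i

lemma tsum_shift (a : ℤ → ℝ≥0∞) (c : ℤ) : ∑' k, a (k + c) = ∑' k, a k :=
  (Equiv.addRight c).tsum_eq a

/-- After the preceding bound the sums are interchanged, and shift invariance over ℤ makes the inner
sum independent of i. -/
lemma exists_lqNorm_hardySum_le {θ : ℝ≥0∞} (hθ : θ < 1) (M : ℕ) (hq : q ≠ 0) :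
    ∃ K : ℝ≥0, ∀ a : ℤ → ℝ≥0∞, lqNorm q (hardySum θ M a) ≤ K * lqNorm q a := by
  rcases eq_or_ne q ∞ with rfl | hqt
  · refine ⟨(1 - θ)⁻¹.toNNReal, fun a => ?_⟩
    rw [ENNReal.coe_toNNReal (one_sub_inv_ne_top hθ), lqNorm_top, lqNorm_top]
    refine iSup_le fun k => ?_
    rw [← ENNReal.tsum_geometric, ← ENNReal.tsum_mul_right]
    exact ENNReal.tsum_le_tsum fun i => mul_le_mul' le_rfl (le_iSup a _)
  · have hQ : 0 < q.toReal := ENNReal.toReal_pos hq hqt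
    have hθ' : θ ^ (q.toReal / 2) < 1 := ENNReal.rpow_lt_one hθ (by positivity)
    set K := hardyConst θ q.toReal * (1 - θ ^ (q.toReal / 2))⁻¹ with hK
    have hKt : K ≠ ∞ := ENNReal.mul_ne_top (hardyConst_ne_top hθ hQ.le) (one_sub_inv_ne_top hθ')
    refine ⟨(K ^ (1 / q.toReal)).toNNReal, fun a => ?_⟩
    rw [ENNReal.coe_toNNReal (ENNReal.rpow_ne_top_of_nonneg (by positivity) hKt),
      lqNorm_of_ne_top hqt, lqNorm_of_ne_top hqt, ← ENNReal.mul_rpow_of_nonneg _ _ (by positivity)]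
    refine ENNReal.rpow_le_rpow ?_ (by positivity)
    calc ∑' k, hardySum θ M a k ^ q.toReal
        ≤ ∑' k : ℤ, hardyConst θ q.toReal *
            ∑' i : ℕ, (θ ^ (q.toReal / 2)) ^ i * a (k - M + i) ^ q.toReal :=
          ENNReal.tsum_le_tsum fun k => tsum_pow_mul_rpow_le hQ _
      _ = hardyConst θ q.toReal * ∑' i : ℕ, (θ ^ (q.toReal / 2)) ^ i *
            ∑' k : ℤ, a (k + (i - M)) ^ q.toReal := by
          rw [ENNReal.tsum_mul_left, ENNReal.tsum_comm]
          simp only [ENNReal.tsum_mul_left]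
          congr 3
          funext i
          congr 3
          funext k
          congr 2
          ring
      _ = _ := by
          simp only [tsum_shift (fun k => a k ^ q.toReal), ENNReal.tsum_mul_right,
            ENNReal.tsum_geometric, hK, mul_assoc]

end Sequences

variable {X : Type*} [MetricSpace X] [MeasurableSpace X] {μ : Measure X} {p q : ℝ≥0∞}

lemma gradNorm_of_not (h : ¬(p = ∞ ∧ q ≠ ∞)) (g : ℤ → X → ℝ≥0∞) :
    gradNorm μ p q g = eLpNorm (fun x => lqNorm q (fun k => g k x)) p μ := by
  rw [gradNorm, if_neg h]

lemma gradNorm_top (hq : q ≠ ∞) (g : ℤ → X → ℝ≥0∞) :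
    gradNorm μ ∞ q g = ⨆ (k : ℤ) (x : X),
      (∑' m : ℕ, ⨍⁻ y in ball x ((2 : ℝ) ^ (-k)), g (k + m) y ^ q.toReal ∂μ)
        ^ (1 / q.toReal) := by
  rw [gradNorm, if_pos ⟨rfl, hq⟩]
  congr! 4 with k x
  congr 1
  exact tsum_subtype_le_eq_tsum_nat k
    fun j => ⨍⁻ y in ball x ((2 : ℝ) ^ (-k)), g j y ^ q.toReal ∂μ

lemma tsum_setLAverage_le_gradNorm_top (hq0 : q ≠ 0) (hq : q ≠ ∞) (g : ℤ → X → ℝ≥0∞) (k : ℤ)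
    (x : X) :
    ∑' m : ℕ, ⨍⁻ y in ball x ((2 : ℝ) ^ (-k)), g (k + m) y ^ q.toReal ∂μ
      ≤ gradNorm μ ∞ q g ^ q.toReal := by
  have hQ : 0 < q.toReal := ENNReal.toReal_pos hq0 hq
  rw [← ENNReal.rpow_inv_le_iff hQ, gradNorm_top hq, ← one_div]
  exact le_iSup₂ (f := fun (k : ℤ) (x : X) =>
    (∑' m : ℕ, ⨍⁻ y in ball x ((2 : ℝ) ^ (-k)), g (k + m) y ^ q.toReal ∂μ) ^ (1 / q.toReal)) k x

lemma gradNorm_top_le (hq0 : q ≠ 0) (hq : q ≠ ∞) {g : ℤ → X → ℝ≥0∞} {N : ℝ≥0∞}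
    (h : ∀ (k : ℤ) (x : X), ∑' m : ℕ, ⨍⁻ y in ball x ((2 : ℝ) ^ (-k)), g (k + m) y ^ q.toReal ∂μ
      ≤ N ^ q.toReal) :
    gradNorm μ ∞ q g ≤ N := by
  have hQ : 0 < q.toReal := ENNReal.toReal_pos hq0 hq
  rw [gradNorm_top hq]
  refine iSup₂_le fun k x => ?_
  rw [one_div, ENNReal.rpow_inv_le_iff hQ]
  exact h k x

lemma gradNorm_le_mul (hq0 : q ≠ 0) {a b : ℤ → X → ℝ≥0∞} {c : ℝ≥0}
    (h : ∀ k, ∀ᵐ x ∂μ, a k x ≤ c * b k x) : gradNorm μ p q a ≤ c * gradNorm μ p q b := by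
  by_cases hpq : p = ∞ ∧ q ≠ ∞
  · obtain ⟨rfl, hq⟩ := hpq
    have hQ : 0 < q.toReal := ENNReal.toReal_pos hq0 hq
    refine gradNorm_top_le hq0 hq fun k x => ?_
    rw [ENNReal.mul_rpow_of_nonneg _ _ hQ.le]
    refine le_trans ?_ (mul_le_mul' le_rfl (tsum_setLAverage_le_gradNorm_top hq0 hq b k x))
    rw [← ENNReal.tsum_mul_left]
    refine ENNReal.tsum_le_tsum fun m => ?_
    calc ⨍⁻ y in ball x ((2 : ℝ) ^ (-k)), a (k + m) y ^ q.toReal ∂μ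
        ≤ ⨍⁻ y in ball x ((2 : ℝ) ^ (-k)), (c : ℝ≥0∞) ^ q.toReal * b (k + m) y ^ q.toReal ∂μ := by
          refine setLAverage_mono_ae _ ?_
          filter_upwards [h (k + m)] with y hy
          rw [← ENNReal.mul_rpow_of_nonneg _ _ hQ.le]
          exact ENNReal.rpow_le_rpow hy hQ.le
      _ = _ := by
          simp only [laverage]
          exact lintegral_const_mul' _ _ (ENNReal.rpow_ne_top_of_nonneg hQ.le ENNReal.coe_ne_top)
  · rw [gradNorm_of_not hpq, gradNorm_of_not hpq]
    refine (eLpNorm_le_nnreal_smul_eLpNorm_of_ae_le_mul' (c := c)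
      (g := fun x => lqNorm q fun k => b k x) ?_ p).trans_eq ?_
    · filter_upwards [ae_all_iff.2 h] with x hx
      simp only [enorm_eq_self]
      exact lqNorm_le_mul hq0 hx
    · rw [ENNReal.smul_def, smul_eq_mul]

lemma gradNorm_le_of_lintegral_le (hp0 : p ≠ 0) (hp : p ≠ ∞) {K : ℝ≥0∞} (hK : K ≠ ∞)
    {a b : ℤ → X → ℝ≥0∞}
    (h : ∫⁻ x, lqNorm q (fun k => a k x) ^ p.toReal ∂μ
      ≤ K * ∫⁻ x, lqNorm q (fun k => b k x) ^ p.toReal ∂μ) :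
    gradNorm μ p q a ≤ (K ^ (1 / p.toReal)).toNNReal * gradNorm μ p q b := by
  have hP : 0 < p.toReal := ENNReal.toReal_pos hp0 hp
  rw [ENNReal.coe_toNNReal (ENNReal.rpow_ne_top_of_nonneg (by positivity) hK),
    gradNorm_of_not (fun h => hp h.1), gradNorm_of_not (fun h => hp h.1),
    eLpNorm_eq_lintegral_rpow_enorm_toReal hp0 hp, eLpNorm_eq_lintegral_rpow_enorm_toReal hp0 hp,
    ← ENNReal.mul_rpow_of_nonneg _ _ (by positivity)]
  simp only [enorm_eq_self]
  exact ENNReal.rpow_le_rpow h (by positivity)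

section Hardy

variable {C n : ℝ}

lemma IsDoubling.exists_setLAverage_zpow_le (h : IsDoubling μ C n) (M : ℕ) :
    ∃ K : ℝ≥0, ∀ (f : X → ℝ≥0∞) (x : X) (k : ℤ),
      ⨍⁻ y in ball x ((2 : ℝ) ^ (-k)), f y ∂μ
        ≤ K * ⨍⁻ y in ball x ((2 : ℝ) ^ (-(k - M))), f y ∂μ := by
  -- The exponent is M + 1 so that the dilation factor exceeds 1 even when M = 0.
  refine ⟨(C * (2 ^ (M + 1)) ^ n).toNNReal, fun f x k => ?_⟩
  have h1 : (2 : ℝ) ^ (-(k - M)) = 2 ^ M * 2 ^ (-k) := by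
    rw [← zpow_natCast, ← zpow_add₀ two_ne_zero]
    congr 1
    ring
  have hpos : (0 : ℝ) < 2 ^ (-k) := by positivity
  refine h.setLAverage_ball_le (a := 2 ^ (M + 1)) hpos ?_ ?_ ?_ f
  · exact one_lt_pow₀ one_lt_two (by omega)
  · rw [dist_self, zero_add, h1]
    exact le_mul_of_one_le_left hpos.le (one_le_pow₀ one_le_two)
  · rw [dist_self, zero_add, h1]
    gcongr
    · exact one_le_two
    · omega

/-- The discrete Hardy inequality for `gradNorm`. -/
theorem IsDoubling.exists_gradNorm_hardySum_le (h : IsDoubling μ C n) {θ : ℝ≥0∞} (hθ : θ < 1)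
    (M : ℕ) (hq0 : q ≠ 0) :
    ∃ K : ℝ≥0, ∀ a : ℤ → X → ℝ≥0∞, (∀ k, AEMeasurable (a k) μ) →
      gradNorm μ p q (fun k x => hardySum θ M (fun j => a j x) k) ≤ K * gradNorm μ p q a := by
  by_cases hpq : p = ∞ ∧ q ≠ ∞
  swap
  · obtain ⟨K, hK⟩ := exists_lqNorm_hardySum_le hθ M hq0
    refine ⟨K, fun a ha => ?_⟩
    rw [gradNorm_of_not hpq, gradNorm_of_not hpq]
    refine (eLpNorm_le_nnreal_smul_eLpNorm_of_ae_le_mul' (c := K)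
      (g := fun x => lqNorm q fun k => a k x) ?_ p).trans_eq ?_
    · filter_upwards with x
      simp only [enorm_eq_self]
      exact hK _
    · rw [ENNReal.smul_def, smul_eq_mul]
  obtain ⟨rfl, hq⟩ := hpq
  have hQ : 0 < q.toReal := ENNReal.toReal_pos hq0 hq
  have hθ' : θ ^ (q.toReal / 2) < 1 := ENNReal.rpow_lt_one hθ (by positivity)
  -- In the Carleson norm the shift brings in indices down to k - M, whereas balls of radius 2^{-k}
  -- only see indices from k on. The ball is therefore enlarged by M scales.
  obtain ⟨D, hD⟩ := h.exists_setLAverage_zpow_le M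
  set K := hardyConst θ q.toReal * (1 - θ ^ (q.toReal / 2))⁻¹ * D with hK
  have hKt : K ≠ ∞ := ENNReal.mul_ne_top (ENNReal.mul_ne_top (hardyConst_ne_top hθ hQ.le)
    (one_sub_inv_ne_top hθ')) ENNReal.coe_ne_top
  refine ⟨(K ^ (1 / q.toReal)).toNNReal, fun a ha => ?_⟩
  rw [ENNReal.coe_toNNReal (ENNReal.rpow_ne_top_of_nonneg (by positivity) hKt)]
  refine gradNorm_top_le hq0 hq fun k x => ?_
  rw [ENNReal.mul_rpow_of_nonneg _ _ hQ.le, ← ENNReal.rpow_mul, one_div_mul_cancel hQ.ne',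
    ENNReal.rpow_one]
  set N := gradNorm μ ∞ q a ^ q.toReal
  have hm : ∀ j, AEMeasurable (fun y => a j y ^ q.toReal) μ := fun j => (ha j).pow_const _
  calc ∑' m : ℕ, ⨍⁻ y in ball x ((2 : ℝ) ^ (-k)),
        hardySum θ M (fun j => a j y) (k + m) ^ q.toReal ∂μ
      ≤ ∑' m : ℕ, hardyConst θ q.toReal * ∑' i : ℕ, (θ ^ (q.toReal / 2)) ^ i *
          ⨍⁻ y in ball x ((2 : ℝ) ^ (-k)), a (k + m - M + i) y ^ q.toReal ∂μ := by
        refine ENNReal.tsum_le_tsum fun m => ?_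
        refine (setLAverage_mono fun y => tsum_pow_mul_rpow_le hQ _).trans_eq ?_
        rw [setLAverage_const_mul _ (AEMeasurable.tsum fun i => (hm _).const_mul _),
          setLAverage_tsum fun i => (hm _).const_mul _]
        congr 2
        funext i
        exact setLAverage_const_mul _ (hm _)
    _ = hardyConst θ q.toReal * ∑' i : ℕ, (θ ^ (q.toReal / 2)) ^ i *
          ∑' m : ℕ, ⨍⁻ y in ball x ((2 : ℝ) ^ (-k)), a (k + m - M + i) y ^ q.toReal ∂μ := by
        rw [ENNReal.tsum_mul_left, ENNReal.tsum_comm]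
        simp only [ENNReal.tsum_mul_left]
    _ ≤ hardyConst θ q.toReal * ∑' i : ℕ, (θ ^ (q.toReal / 2)) ^ i * (D * N) := by
        refine mul_le_mul' le_rfl (ENNReal.tsum_le_tsum fun i => mul_le_mul' le_rfl ?_)
        calc ∑' m : ℕ, ⨍⁻ y in ball x ((2 : ℝ) ^ (-k)), a (k + m - M + i) y ^ q.toReal ∂μ
            = ∑' m : ℕ, (fun m : ℕ => ⨍⁻ y in ball x ((2 : ℝ) ^ (-k)),
                a (k - M + m) y ^ q.toReal ∂μ) (m + i) := by
              refine tsum_congr fun m => ?_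
              simp only
              push_cast
              rw [show k + (m : ℤ) - M + i = k - M + (m + i) by ring]
          _ ≤ ∑' m : ℕ, ⨍⁻ y in ball x ((2 : ℝ) ^ (-k)), a (k - M + m) y ^ q.toReal ∂μ :=
              ENNReal.tsum_comp_le_tsum_of_injective (add_left_injective i) _
          _ ≤ ∑' m : ℕ, D * ⨍⁻ y in ball x ((2 : ℝ) ^ (-(k - M))),
                a (k - M + m) y ^ q.toReal ∂μ := ENNReal.tsum_le_tsum fun m => hD _ _ _
          _ ≤ D * N := by
              rw [ENNReal.tsum_mul_left]
              exact mul_le_mul' le_rfl (tsum_setLAverage_le_gradNorm_top hq0 hq a (k - M) x)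
    _ = K * N := by
        rw [ENNReal.tsum_mul_right, ENNReal.tsum_geometric, hK]
        ring

end Hardy

end HajlaszTL

/-! ### Averaging operators in the Hajłasz sequence norms -/

namespace HajlaszTL

variable {X : Type*} [MetricSpace X] [MeasurableSpace X] {μ : Measure X} {p q : ℝ≥0∞}
  [BorelSpace X] [SecondCountableTopology X] [SFinite μ] {C n : ℝ}

/-- All the small balls stay inside the doubled ball, so f may be cut off there before the global L¹
bound for averages is applied. This localisation is what the Carleson norm needs. -/
lemma IsDoubling.exists_setLAverage_setLAverage_le (h : IsDoubling μ C n) :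
    ∃ K : ℝ≥0, ∀ (f : X → ℝ≥0∞), AEMeasurable f μ → ∀ (x : X) (k j : ℤ), k ≤ j →
      ⨍⁻ y in ball x ((2 : ℝ) ^ (-k)), ⨍⁻ z in ball y ((2 : ℝ) ^ (-j)), f z ∂μ ∂μ
        ≤ K * ⨍⁻ y in ball x ((2 : ℝ) ^ (-(k - 1))), f y ∂μ := by
  refine ⟨(C * 4 ^ n).toNNReal * (C * 2 ^ n).toNNReal, fun f hf x k j hkj => ?_⟩
  have hpos : ∀ k : ℤ, (0 : ℝ) < 2 ^ (-k) := fun k => by positivity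
  have h1 : (2 : ℝ) ^ (-(k - 1)) = 2 * 2 ^ (-k) := by
    rw [show -(k - 1) = 1 + -k by ring, zpow_add₀ two_ne_zero, zpow_one]
  have h2 : (2 : ℝ) ^ (-j) ≤ 2 ^ (-k) := zpow_le_zpow_right₀ one_le_two (by omega)
  set B := ball x ((2 : ℝ) ^ (-k)) with hB
  set B' := ball x ((2 : ℝ) ^ (-(k - 1))) with hB'
  have hfB : AEMeasurable (B'.indicator f) μ := hf.indicator measurableSet_ball
  have hle : ∫⁻ y in B, ⨍⁻ z in ball y ((2 : ℝ) ^ (-j)), f z ∂μ ∂μ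
      ≤ ENNReal.ofReal (C * 2 ^ n) * ∫⁻ y in B', f y ∂μ := by
    rw [← lintegral_indicator measurableSet_ball (s := B')]
    refine le_trans ?_ (h.lintegral_setLAverage_le hfB (hpos j))
    refine le_trans ?_ (setLIntegral_le_lintegral B _)
    refine setLIntegral_mono' measurableSet_ball fun y hy => ?_
    refine setLAverage_mono_on measurableSet_ball fun z hz => ?_
    rw [indicator_of_mem]
    rw [hB', mem_ball, h1]
    have := dist_triangle z y x
    rw [mem_ball] at hy hz
    linarith
  rw [setLAverage_eq, setLAverage_eq, ENNReal.div_le_iff (h.ball_ne_zero x (hpos k))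
    (h.ball_ne_top x _)]
  refine hle.trans ?_
  have h3 : μ B' ≤ ENNReal.ofReal (C * 4 ^ n) * μ B := by
    refine (measure_mono (ball_subset_ball ?_)).trans
      (h.measure_ball_mul_le x _ 4 (hpos k) (by norm_num))
    rw [h1]
    linarith [hpos k]
  calc ENNReal.ofReal (C * 2 ^ n) * ∫⁻ y in B', f y ∂μ
      = ENNReal.ofReal (C * 2 ^ n) * ((∫⁻ y in B', f y ∂μ) / μ B' * μ B') := by
        rw [ENNReal.div_mul_cancel (h.ball_ne_zero x (hpos _)) (h.ball_ne_top x _)]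
    _ ≤ ENNReal.ofReal (C * 2 ^ n) * ((∫⁻ y in B', f y ∂μ) / μ B' *
          (ENNReal.ofReal (C * 4 ^ n) * μ B)) := by gcongr
    _ = _ := by
        rw [ENNReal.coe_mul, ENNReal.ofReal, ENNReal.ofReal]
        ring

/-- Vector-valued boundedness of averaging operators, in the scale `gradNorm`. -/
theorem IsDoubling.exists_gradNorm_setLAverage_le (h : IsDoubling μ C n) (hp0 : p ≠ 0)
    (hq0 : q ≠ 0) {l : ℝ} (hl : 0 < l) (hlp : ENNReal.ofReal l < p) (hlq : ENNReal.ofReal l < q) :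
    ∃ K : ℝ≥0, ∀ f : ℤ → X → ℝ≥0∞, (∀ k, AEMeasurable (f k) μ) →
      gradNorm μ p q (fun k x => (⨍⁻ y in ball x ((2 : ℝ) ^ (-k)), f k y ^ l ∂μ) ^ (1 / l))
        ≤ K * gradNorm μ p q f := by
  have hpos : ∀ k : ℤ, (0 : ℝ) < 2 ^ (-k) := fun k => by positivity
  have hinv : 0 < 1 / l := by positivity
  rcases eq_or_ne p ∞ with rfl | hp
  · rcases eq_or_ne q ∞ with rfl | hq
    · refine ⟨1, fun f hf => ?_⟩
      rw [ENNReal.coe_one, one_mul, gradNorm_of_not (by simp), gradNorm_of_not (by simp)]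
      simp only [lqNorm_top, eLpNorm_exponent_top, eLpNormEssSup, enorm_eq_self]
      set N := essSup (fun x => ⨆ k, f k x) μ with hN
      refine essSup_le_of_ae_le _ (Filter.Eventually.of_forall fun x => iSup_le fun k => ?_)
      have h1 : ⨍⁻ y in ball x ((2 : ℝ) ^ (-k)), f k y ^ l ∂μ ≤ N ^ l := by
        rw [← setLAverage_const (h.ball_ne_zero x (hpos k)) (h.ball_ne_top x _) (N ^ l)]
        refine setLAverage_mono_ae _ ?_
        filter_upwards [ENNReal.ae_le_essSup fun x => ⨆ k, f k x] with y hy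
        exact ENNReal.rpow_le_rpow ((le_iSup (fun k => f k y) k).trans hy) hl.le
      refine (ENNReal.rpow_le_rpow h1 hinv.le).trans_eq ?_
      rw [← ENNReal.rpow_mul, mul_one_div_cancel hl.ne', ENNReal.rpow_one]
    · have hQ : 0 < q.toReal := ENNReal.toReal_pos hq0 hq
      -- In the Carleson case Jensen with exponent q/l moves the power inside the average, and
      -- iterated averages are absorbed into one ball of twice the radius.
      have hlQ : 1 ≤ q.toReal / l := by
        rw [one_le_div hl]
        exact ((ENNReal.ofReal_lt_iff_lt_toReal hl.le hq).1 hlq).le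
      obtain ⟨K, hK⟩ := h.exists_setLAverage_setLAverage_le
      refine ⟨K ^ (1 / q.toReal), fun f hf => gradNorm_top_le hq0 hq fun k x => ?_⟩
      rw [ENNReal.mul_rpow_of_nonneg _ _ hQ.le, ← ENNReal.coe_rpow_of_nonneg _ hQ.le,
        ← NNReal.rpow_mul, one_div_mul_cancel hQ.ne', NNReal.rpow_one]
      calc _ ≤ ∑' m : ℕ, K * ⨍⁻ y in ball x ((2 : ℝ) ^ (-(k - 1))), f (k + m) y ^ q.toReal ∂μ := by
            refine ENNReal.tsum_le_tsum fun m => ?_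
            refine le_trans ?_ (hK _ ((hf _).pow_const _) x k (k + m) (by omega))
            refine setLAverage_mono fun y => ?_
            rw [← ENNReal.rpow_mul, one_div_mul_eq_div]
            refine (setLAverage_rpow_le (h.ball_ne_zero _ (hpos _)) (h.ball_ne_top _ _)
              ((hf _).pow_const _) hlQ).trans_eq ?_
            simp only [← ENNReal.rpow_mul, mul_div_cancel₀ _ hl.ne']
        _ = K * ∑' m : ℕ, (fun m : ℕ => ⨍⁻ y in ball x ((2 : ℝ) ^ (-(k - 1))),
              f (k - 1 + m) y ^ q.toReal ∂μ) (m + 1) := by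
            rw [ENNReal.tsum_mul_left]
            congr 1
            refine tsum_congr fun m => ?_
            simp only
            push_cast
            rw [show k - 1 + ((m : ℤ) + 1) = k + m by ring]
        _ ≤ K * ∑' m : ℕ, ⨍⁻ y in ball x ((2 : ℝ) ^ (-(k - 1))),
              f (k - 1 + m) y ^ q.toReal ∂μ :=
            mul_le_mul' le_rfl
              (ENNReal.tsum_comp_le_tsum_of_injective (add_left_injective 1) _)
        _ ≤ _ := mul_le_mul' le_rfl (tsum_setLAverage_le_gradNorm_top hq0 hq f (k - 1) x)
  have hP : 0 < p.toReal := ENNReal.toReal_pos hp0 hp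
  have hlP : l < p.toReal := (ENNReal.ofReal_lt_iff_lt_toReal hl.le hp).1 hlp
  rcases eq_or_ne q ∞ with rfl | hq
  -- For q = ∞ every average of f_k^l is at most the maximal function of the l-th power of sup_k
  -- f_k, and p/l > 1.
  · obtain ⟨K, hK, hM⟩ := h.exists_lintegral_dyadicMaximal_rpow_le ((one_lt_div hl).2 hlP)
    refine ⟨(K ^ (1 / p.toReal)).toNNReal, fun f hf => gradNorm_le_of_lintegral_le hp0 hp hK ?_⟩
    simp only [lqNorm_top]
    have h1 := hM (fun x => (⨆ k, f k x) ^ l) ((AEMeasurable.iSup hf).pow_const l)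
    simp only [← ENNReal.rpow_mul, mul_div_cancel₀ _ hl.ne'] at h1
    refine le_trans (lintegral_mono fun x => ?_) h1
    have h2 : p.toReal = l * (p.toReal / l) := by field_simp
    nth_rewrite 1 [h2]
    rw [ENNReal.rpow_mul]
    refine ENNReal.rpow_le_rpow ?_ (by positivity)
    rw [← ENNReal.le_rpow_inv_iff hl]
    refine iSup_le fun k => ?_
    rw [← one_div]
    refine ENNReal.rpow_le_rpow ?_ hinv.le
    refine le_trans (setLAverage_mono fun y => ?_) (setLAverage_le_dyadicMaximal _ x k)
    exact ENNReal.rpow_le_rpow (le_iSup (fun k => f k y) k) hl.le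
  have hQ : 0 < q.toReal := ENNReal.toReal_pos hq0 hq
  have hlQ : l < q.toReal := (ENNReal.ofReal_lt_iff_lt_toReal hl.le hq).1 hlq
  have hlq1 : ∀ a : ℝ≥0∞, (a ^ (1 / l)) ^ q.toReal = a ^ (q.toReal / l) := fun a => by
    rw [← ENNReal.rpow_mul, one_div_mul_eq_div]
  have hlq2 : ∀ a : ℝ≥0∞, (a ^ l) ^ (q.toReal / l) = a ^ q.toReal := fun a => by
    rw [← ENNReal.rpow_mul, mul_div_cancel₀ _ hl.ne']
  have hpq : ∀ a : ℝ≥0∞, (a ^ (1 / q.toReal)) ^ p.toReal = a ^ (p.toReal / q.toReal) := fun a => by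
    rw [← ENNReal.rpow_mul, one_div_mul_eq_div]
  -- Passing to F = f^l replaces the exponents p, q by p/l and q/l, both larger than 1. The two
  -- vector-valued inequalities cover q ≤ p and p < q.
  suffices hs : ∃ K : ℝ≥0∞, K ≠ ∞ ∧ ∀ F : ℤ → X → ℝ≥0∞, (∀ k, AEMeasurable (F k) μ) →
      ∫⁻ x, (∑' k : ℤ, (⨍⁻ y in ball x ((2 : ℝ) ^ (-k)), F k y ∂μ) ^ (q.toReal / l))
          ^ (p.toReal / q.toReal) ∂μ
        ≤ K * ∫⁻ x, (∑' k : ℤ, F k x ^ (q.toReal / l)) ^ (p.toReal / q.toReal) ∂μ by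
    obtain ⟨K, hK, hF⟩ := hs
    refine ⟨(K ^ (1 / p.toReal)).toNNReal, fun f hf => gradNorm_le_of_lintegral_le hp0 hp hK ?_⟩
    simp only [lqNorm_of_ne_top hq, hlq1, hpq]
    have h1 := hF (fun k x => f k x ^ l) fun k => (hf k).pow_const l
    simp only [hlq2] at h1
    exact h1
  rcases le_or_gt q.toReal p.toReal with hle | hlt
  · obtain ⟨K, hK, hH⟩ := h.exists_lintegral_tsum_setLAverage_rpow_le ((one_le_div hQ).2 hle)
    refine ⟨K, hK, fun F hF => ?_⟩
    refine le_trans ?_ (hH (fun k x => F k x ^ (q.toReal / l)) fun k => (hF k).pow_const _)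
    refine lintegral_mono fun x => ENNReal.rpow_le_rpow ?_ (by positivity)
    refine ENNReal.tsum_le_tsum fun k => ?_
    exact setLAverage_rpow_le (h.ball_ne_zero _ (hpos _)) (h.ball_ne_top _ _) (hF k)
      ((one_le_div hl).2 hlQ.le)
  · have h1 := h.exists_lintegral_tsum_setLAverage_rpow_rpow_le ((one_lt_div hl).2 hlP)
      (div_lt_div_of_pos_right hlt hl)
    rwa [div_div_div_cancel_right₀ hl.ne'] at h1

end HajlaszTL

/-! ### The Sobolev–Poincaré inequality -/

namespace HajlaszTL

variable {X : Type*} [MetricSpace X] [MeasurableSpace X] {μ : Measure X} {C n : ℝ}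

lemma IsDoubling.exists_mem_ball_le_setLAverage (h : IsDoubling μ C n) [BorelSpace X]
    {f : X → ℝ≥0∞}
    (hf : AEMeasurable f μ) {E : Set X} (hE : μ E = 0) (x : X) {ρ : ℝ} (hρ : 0 < ρ) :
    ∃ y ∉ E, dist y x < ρ ∧ f y ≤ ⨍⁻ z in ball x ρ, f z ∂μ := by
  have hN : μ.restrict (ball x ρ) (E ∪ (ball x ρ)ᶜ) = 0 := by
    refine measure_union_null (Measure.restrict_le_self.absolutelyContinuous hE) ?_
    rw [Measure.restrict_apply measurableSet_ball.compl, compl_inter_self, measure_empty]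
  have : IsFiniteMeasure (μ.restrict (ball x ρ)) :=
    ⟨by rw [Measure.restrict_apply_univ]; exact h.measure_ball_lt_top x ρ⟩
  obtain ⟨y, hy, hfy⟩ := exists_notMem_null_le_laverage
    (by rw [Ne, Measure.restrict_eq_zero]; exact h.ball_ne_zero x hρ) hf.restrict hN
  rw [mem_union, not_or, notMem_compl_iff] at hy
  exact ⟨y, hy.1, hy.2, hfy⟩

lemma ofReal_abs_sub_le (a b c : ℝ) :
    ENNReal.ofReal |a - c| ≤ ENNReal.ofReal |a - b| + ENNReal.ofReal |b - c| := by
  rw [← ENNReal.ofReal_add (abs_nonneg _) (abs_nonneg _)]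
  exact ENNReal.ofReal_le_ofReal (abs_sub_le a b c)

lemma ofReal_rpow_le_of_le_mul_div {d b R t : ℝ} (hd0 : 0 ≤ d) (hb : 0 < b) (hR : 0 < R)
    (ht : 0 ≤ t) (i : ℕ) (hd : d ≤ b * (R / 2 ^ i)) :
    ENNReal.ofReal (d ^ t)
      ≤ ENNReal.ofReal (b ^ t) * (ENNReal.ofReal (R ^ t) * ((2 : ℝ≥0∞) ^ (-t)) ^ i) := by
  have h2 : (2 : ℝ≥0∞) ^ (-t) = ENNReal.ofReal (2 ^ (-t)) := by
    rw [← ENNReal.ofReal_rpow_of_pos two_pos, ENNReal.ofReal_ofNat]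
  rw [h2, ← ENNReal.ofReal_pow (by positivity), ← ENNReal.ofReal_mul (by positivity),
    ← ENNReal.ofReal_mul (by positivity)]
  refine ENNReal.ofReal_le_ofReal ?_
  calc d ^ t ≤ (b * (R / 2 ^ i)) ^ t := Real.rpow_le_rpow hd0 hd ht
    _ = b ^ t * (R ^ t * (2 ^ (-t)) ^ i) := by
      rw [Real.mul_rpow hb.le (by positivity), Real.div_rpow hR.le (by positivity),
        Real.rpow_neg two_pos.le, inv_pow, ← Real.rpow_natCast, ← Real.rpow_natCast,
        ← Real.rpow_mul two_pos.le, ← Real.rpow_mul two_pos.le, mul_comm t, div_eq_mul_inv]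

lemma pow_rpow_comm (b : ℝ≥0∞) (i : ℕ) (z : ℝ) : (b ^ i) ^ z = (b ^ z) ^ i := by
  rw [← ENNReal.rpow_natCast, ← ENNReal.rpow_natCast, ← ENNReal.rpow_mul, ← ENNReal.rpow_mul,
    mul_comm]

/-- The least admissible N is taken. If N > 0, minimality gives b^{N-1} K^l ≤ g^l, which turns b^N
K^σ into b g^l K^{σ-l}. Thus the σ-th power of a bound growing like b^{N/σ} is linear in g^l, hence
integrable; this is the gain from l to σ. -/
lemma rpow_chain_le {K g b : ℝ≥0∞} {l σ : ℝ} (hl : 0 < l) (hlσ : l < σ)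
    (hN : ∃ N : ℕ, g ≤ (b ^ (1 / l)) ^ N * K) :
    ∃ N : ℕ, g ≤ (b ^ (1 / l)) ^ N * K ∧
      ((b ^ (1 / σ)) ^ N * K) ^ σ ≤ K ^ σ + b * g ^ l * K ^ (σ - l) := by
  classical
  have hσ : 0 < σ := hl.trans hlσ
  refine ⟨Nat.find hN, Nat.find_spec hN, ?_⟩
  rw [ENNReal.mul_rpow_of_nonneg _ _ hσ.le, ← ENNReal.rpow_natCast, ← ENNReal.rpow_mul,
    ← ENNReal.rpow_mul]
  have h1 : 1 / σ * ((Nat.find hN : ℝ) * σ) = Nat.find hN := by field_simp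
  rw [h1, ENNReal.rpow_natCast]
  rcases Nat.eq_zero_or_pos (Nat.find hN) with h0 | hpos
  · rw [h0, pow_zero, one_mul]
    exact le_self_add
  · obtain ⟨m, hm⟩ := Nat.exists_eq_succ_of_ne_zero hpos.ne'
    have hlt : (b ^ (1 / l)) ^ m * K < g := not_le.1 (Nat.find_min hN (by omega))
    refine le_add_left ?_
    have h2 := ENNReal.rpow_le_rpow hlt.le hl.le
    rw [ENNReal.mul_rpow_of_nonneg _ _ hl.le, ← ENNReal.rpow_natCast, ← ENNReal.rpow_mul,
      ← ENNReal.rpow_mul, show 1 / l * ((m : ℝ) * l) = m by field_simp, ENNReal.rpow_natCast] at h2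
    calc b ^ Nat.find hN * K ^ σ = b * (b ^ m * K ^ l) * K ^ (σ - l) := by
          have h3 : K ^ σ = K ^ l * K ^ (σ - l) := by
            rw [← ENNReal.rpow_add_of_nonneg _ _ hl.le (by linarith), add_sub_cancel]
          rw [hm, h3, pow_succ]
          ring
      _ ≤ _ := by gcongr

/-- The Sobolev–Poincaré inequality for functions with a Hajłasz gradient. -/
theorem IsDoubling.exists_sobolevPoincare [BorelSpace X] (h : IsDoubling μ C n) {l σ t : ℝ}
    (hl : 0 < l) (hlσ : l < σ) (ht : t = n * (1 / l - 1 / σ)) :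
    ∃ K : ℝ≥0, ∀ (u : X → ℝ) (g : X → ℝ≥0∞), AEMeasurable g μ → ∀ (E : Set X), μ E = 0 →
      ∀ (x₀ : X) (R : ℝ), 0 < R →
      (∀ x y, x ∉ E → y ∉ E → dist x y < 4 * R →
        ENNReal.ofReal |u x - u y| ≤ ENNReal.ofReal (dist x y ^ t) * (g x + g y)) →
      ∃ c : ℝ, (⨍⁻ y in ball x₀ R, ‖u y - c‖ₑ ^ σ ∂μ) ^ (1 / σ)
        ≤ K * (ENNReal.ofReal (R ^ t) * (⨍⁻ y in ball x₀ (2 * R), g y ^ l ∂μ) ^ (1 / l)) := by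
  have hn := h.dim_pos
  have hC := h.one_lt
  have hσ : 0 < σ := hl.trans hlσ
  have ht0 : 0 < t := by
    rw [ht]
    have : 1 / σ < 1 / l := one_div_lt_one_div_of_lt hl hlσ
    exact mul_pos hn (by linarith)
  -- Halving a radius costs at most a factor b in averages of g^l, up to a fixed constant, hence β
  -- in the size of g. The exponent t is chosen so that the gain 2^{-t} from the distance turns β
  -- into γ = b^{1/σ}.
  set b : ℝ≥0∞ := 2 ^ n with hb
  have hb1 : 1 < b := ENNReal.one_lt_rpow (by norm_num) hn
  have hbt : b ≠ ∞ := ENNReal.rpow_ne_top_of_nonneg hn.le (by norm_num)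
  set β := b ^ (1 / l) with hβ
  set γ := b ^ (1 / σ) with hγ
  have hβ1 : 1 < β := ENNReal.one_lt_rpow hb1 (by positivity)
  have hβt : β ≠ ∞ := ENNReal.rpow_ne_top_of_nonneg (by positivity) hbt
  have hγ1 : 1 < γ := ENNReal.one_lt_rpow hb1 (by positivity)
  have hγt : γ ≠ ∞ := ENNReal.rpow_ne_top_of_nonneg (by positivity) hbt
  have hτβ : (2 : ℝ≥0∞) ^ (-t) * β = γ := by
    rw [hβ, hγ, hb, ← ENNReal.rpow_mul, ← ENNReal.rpow_mul,
      ← ENNReal.rpow_add _ _ (by norm_num) (by norm_num), ht]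
    congr 1
    ring
  set A₀ := ENNReal.ofReal (C * 4 ^ n) with hA₀
  set A := A₀ ^ (1 / l) with hA
  have hAt : A ≠ ∞ := ENNReal.rpow_ne_top_of_nonneg (by positivity) ENNReal.ofReal_ne_top
  set B₁ := ENNReal.ofReal (2 ^ t) * (A + A * β) with hB₁
  -- The first summand starts the chain, whose first link has length below 3R. The second makes B₂ +
  -- B₁ ≤ B₂ γ, which closes the induction; it uses γ > 1.
  set B₂ := ENNReal.ofReal (3 ^ t) * (A + A) + B₁ / (γ - 1) with hB₂
  have hγ0 : γ - 1 ≠ 0 := (tsub_pos_of_lt hγ1).ne'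
  have hB₁t : B₁ ≠ ∞ := ENNReal.mul_ne_top ENNReal.ofReal_ne_top
    (ENNReal.add_ne_top.2 ⟨hAt, ENNReal.mul_ne_top hAt hβt⟩)
  have hB₂t : B₂ ≠ ∞ := ENNReal.add_ne_top.2 ⟨ENNReal.mul_ne_top ENNReal.ofReal_ne_top
    (ENNReal.add_ne_top.2 ⟨hAt, hAt⟩), ENNReal.div_ne_top hB₁t hγ0⟩
  have hB₂γ : B₂ + B₁ ≤ B₂ * γ := by
    have h1 : γ = 1 + (γ - 1) := (add_tsub_cancel_of_le hγ1.le).symm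
    calc B₂ + B₁ = B₂ + B₁ / (γ - 1) * (γ - 1) := by
          rw [ENNReal.div_mul_cancel hγ0 (ne_top_of_le_ne_top hγt tsub_le_self)]
      _ ≤ B₂ * 1 + B₂ * (γ - 1) := by
          rw [mul_one]
          gcongr
          exact le_add_self
      _ = B₂ * γ := by rw [← mul_add, ← h1]
  set B₃ := B₂ + (1 + A) with hB₃
  have hB₃t : B₃ ≠ ∞ := ENNReal.add_ne_top.2 ⟨hB₂t, ENNReal.add_ne_top.2 ⟨ENNReal.one_ne_top, hAt⟩⟩
  set D := B₃ * (1 + b * A₀) ^ (1 / σ) with hD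
  have hDt : D ≠ ∞ := ENNReal.mul_ne_top hB₃t (ENNReal.rpow_ne_top_of_nonneg (by positivity)
    (ENNReal.add_ne_top.2 ⟨ENNReal.one_ne_top, ENNReal.mul_ne_top hbt ENNReal.ofReal_ne_top⟩))
  have hDpos : D ≠ 0 := by
    refine mul_ne_zero ?_ ?_
    · simp [hB₃]
    · rw [Ne, ENNReal.rpow_eq_zero_iff_of_pos (by positivity)]
      simp
  refine ⟨D.toNNReal, fun u g hg E hE x₀ R hR hug => ?_⟩
  rw [ENNReal.coe_toNNReal hDt]
  set K := (⨍⁻ y in ball x₀ (2 * R), g y ^ l ∂μ) ^ (1 / l) with hK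
  set S := ENNReal.ofReal (R ^ t) with hS
  have hSpos : S ≠ 0 := by
    rw [hS, Ne, ENNReal.ofReal_eq_zero, not_le]
    positivity
  rcases eq_or_ne K ∞ with hKt | hKt
  · refine ⟨0, ?_⟩
    rw [hKt, ENNReal.mul_top hSpos, ENNReal.mul_top hDpos]
    exact le_top
  have hKl : ⨍⁻ y in ball x₀ (2 * R), g y ^ l ∂μ = K ^ l := by
    rw [hK, ← ENNReal.rpow_mul, one_div_mul_cancel hl.ne', ENNReal.rpow_one]
  -- Near x, at each scale R/2^i, some point outside E has g^l no larger than its average over that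
  -- ball, which is compared with the average over the ball of radius 2R about x₀.
  have hsel : ∀ x, dist x x₀ < R → ∀ i : ℕ, ∃ y ∉ E, dist y x < R / 2 ^ i ∧ g y ≤ A * β ^ i * K := by
    intro x hx i
    have hρ : 0 < R / 2 ^ i := by positivity
    obtain ⟨y, hyE, hy, hgy⟩ := h.exists_mem_ball_le_setLAverage (hg.pow_const l) hE x hρ
    refine ⟨y, hyE, hy, ?_⟩
    have h1 : R / 2 ^ i ≤ R := div_le_self hR.le (one_le_pow₀ one_le_two)
    have h2 : 4 * 2 ^ i * (R / 2 ^ i) = 4 * R := by field_simp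
    have h3 := h.setLAverage_ball_le (x := x) (y := x₀) (R := 2 * R) (a := 4 * 2 ^ i) hρ
      (by have : (1 : ℝ) ≤ 2 ^ i := one_le_pow₀ one_le_two
          linarith) (by linarith) (by rw [h2]; linarith) (fun z => g z ^ l)
    have h4 : ENNReal.ofReal (C * (4 * 2 ^ i) ^ n) = A₀ * b ^ i := by
      rw [hA₀, hb, ← ENNReal.ofReal_ofNat 2, ENNReal.ofReal_rpow_of_pos two_pos,
        ← ENNReal.ofReal_pow (by positivity), ← ENNReal.ofReal_mul (by positivity),
        Real.mul_rpow (by positivity) (by positivity), mul_assoc, ← Real.rpow_natCast,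
        ← Real.rpow_natCast, ← Real.rpow_mul two_pos.le, ← Real.rpow_mul two_pos.le, mul_comm n]
    have h5 := ENNReal.rpow_le_rpow (hgy.trans h3) (by positivity : 0 ≤ 1 / l)
    rw [← ENNReal.rpow_mul, mul_one_div_cancel hl.ne', ENNReal.rpow_one, h4,
      ENNReal.mul_rpow_of_nonneg _ _ (by positivity),
      ENNReal.mul_rpow_of_nonneg _ _ (by positivity)] at h5
    refine h5.trans_eq ?_
    congr 2
    exact pow_rpow_comm b i _
  obtain ⟨z, hzE, hz, hgz⟩ := hsel x₀ (by rw [dist_self]; exact hR) 0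
  rw [pow_zero, mul_one] at hgz
  rw [pow_zero, div_one] at hz
  -- A chain runs from z through the points Y_0, ..., Y_N approaching x. The increments grow like
  -- γ^i, so the last one dominates, and the final step to x is of the same size when g(x) ≤ β^N K.
  have hpt : ∀ x ∉ E, dist x x₀ < R → ∀ N : ℕ, g x ≤ β ^ N * K →
      ENNReal.ofReal |u x - u z| ≤ S * B₃ * (γ ^ N * K) := by
    intro x hxE hx N hgx
    choose Y hYE hYd hYg using hsel x hx
    have hchain : ∀ i : ℕ, ENNReal.ofReal |u (Y i) - u z| ≤ S * B₂ * (γ ^ i * K) := by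
      intro i
      induction i with
      | zero =>
        have hY0 := hYd 0
        have hg0 := hYg 0
        rw [pow_zero, div_one] at hY0
        rw [pow_zero, mul_one] at hg0
        have hd : dist (Y 0) z ≤ 3 * (R / 2 ^ 0) := by
          have h1 := dist_triangle4 (Y 0) x x₀ z
          rw [dist_comm x₀ z] at h1
          rw [pow_zero, div_one]
          linarith
        refine (hug _ _ (hYE 0) hzE (by rw [pow_zero, div_one] at hd; linarith)).trans ?_
        calc _ ≤ (ENNReal.ofReal (3 ^ t) * (S * ((2 : ℝ≥0∞) ^ (-t)) ^ 0)) * (A * K + A * K) := by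
              gcongr
              exact ofReal_rpow_le_of_le_mul_div dist_nonneg (by norm_num) hR ht0.le 0 hd
          _ = S * (ENNReal.ofReal (3 ^ t) * (A + A)) * (γ ^ 0 * K) := by
              rw [pow_zero, pow_zero]; ring
          _ ≤ _ := by
              gcongr
              exact le_self_add
      | succ i ih =>
        have hd : dist (Y (i + 1)) (Y i) ≤ 2 * (R / 2 ^ i) := by
          have h1 := dist_triangle_right (Y (i + 1)) (Y i) x
          have h2 : R / 2 ^ (i + 1) ≤ R / 2 ^ i := by
            gcongr
            · exact one_le_two
            · omega
          linarith [hYd i, hYd (i + 1)]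
        have hd' : dist (Y (i + 1)) (Y i) < 4 * R := by
          have : R / 2 ^ i ≤ R := div_le_self hR.le (one_le_pow₀ one_le_two)
          linarith
        calc ENNReal.ofReal |u (Y (i + 1)) - u z|
            ≤ ENNReal.ofReal |u (Y (i + 1)) - u (Y i)| + ENNReal.ofReal |u (Y i) - u z| :=
              ofReal_abs_sub_le _ _ _
          _ ≤ (ENNReal.ofReal (2 ^ t) * (S * ((2 : ℝ≥0∞) ^ (-t)) ^ i)) *
                (A * β ^ (i + 1) * K + A * β ^ i * K) + S * B₂ * (γ ^ i * K) := by
              gcongr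
              refine (hug _ _ (hYE _) (hYE _) hd').trans ?_
              gcongr
              · exact ofReal_rpow_le_of_le_mul_div dist_nonneg (by norm_num) hR ht0.le i hd
              · exact hYg _
              · exact hYg _
          _ = S * (B₂ + B₁) * (((2 : ℝ≥0∞) ^ (-t) * β) ^ i * K) := by
              rw [hB₁, mul_pow, hτβ.symm, mul_pow, pow_succ]
              ring
          _ ≤ S * (B₂ * γ) * (γ ^ i * K) := by
              rw [hτβ]
              gcongr
          _ = _ := by rw [pow_succ]; ring
    have hd : dist x (Y N) ≤ 1 * (R / 2 ^ N) := by
      rw [one_mul, dist_comm]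
      exact (hYd N).le
    have hd' : dist x (Y N) < 4 * R := by
      have : R / 2 ^ N ≤ R := div_le_self hR.le (one_le_pow₀ one_le_two)
      linarith
    calc ENNReal.ofReal |u x - u z|
        ≤ ENNReal.ofReal |u x - u (Y N)| + ENNReal.ofReal |u (Y N) - u z| := ofReal_abs_sub_le _ _ _
      _ ≤ (ENNReal.ofReal (1 ^ t) * (S * ((2 : ℝ≥0∞) ^ (-t)) ^ N)) *
            (β ^ N * K + A * β ^ N * K) + S * B₂ * (γ ^ N * K) := by
          gcongr
          · refine (hug _ _ hxE (hYE _) hd').trans ?_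
            gcongr
            · exact ofReal_rpow_le_of_le_mul_div dist_nonneg one_pos hR ht0.le N hd
            · exact hYg _
          · exact hchain N
      _ = S * B₃ * (γ ^ N * K) := by
          rw [Real.one_rpow, ENNReal.ofReal_one, hB₃, ← hτβ, mul_pow]
          ring
  -- A suitable N exists wherever g is finite, since β > 1; if K = 0, then g vanishes almost
  -- everywhere on the larger ball and N = 0 serves.
  have hae : ∀ᵐ x ∂μ.restrict (ball x₀ R), ∃ N : ℕ, g x ≤ β ^ N * K := by
    have hint : ∫⁻ y in ball x₀ (2 * R), g y ^ l ∂μ ≠ ∞ := by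
      rw [← measure_mul_setLAverage _ (h.ball_ne_top x₀ _), hKl]
      exact ENNReal.mul_ne_top (h.ball_ne_top x₀ _) (ENNReal.rpow_ne_top_of_nonneg hl.le hKt)
    refine ae_restrict_of_ae_restrict_of_subset (ball_subset_ball (by linarith) :
      ball x₀ R ⊆ ball x₀ (2 * R)) ?_
    rcases eq_or_ne K 0 with hK0 | hK0
    · have h0 : ∫⁻ y in ball x₀ (2 * R), g y ^ l ∂μ = 0 := by
        rw [← measure_mul_setLAverage _ (h.ball_ne_top x₀ _), hKl, hK0, ENNReal.zero_rpow_of_pos hl,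
          mul_zero]
      rw [lintegral_eq_zero_iff' (hg.pow_const l).restrict] at h0
      filter_upwards [h0] with x hx
      refine ⟨0, ?_⟩
      simp only [Pi.zero_apply, ENNReal.rpow_eq_zero_iff_of_pos hl] at hx
      rw [hx]
      exact zero_le
    · filter_upwards [ae_lt_top' (hg.pow_const l).restrict hint] with x hx
      have hgx : g x ≠ ∞ := by
        intro h0
        rw [h0, ENNReal.top_rpow_of_pos hl] at hx
        exact lt_irrefl _ hx
      have htend := (ENNReal.tendsto_pow_atTop_nhds_top_iff.2 hβ1).eventually
        (eventually_ge_nhds (ENNReal.div_lt_top hgx hK0))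
      obtain ⟨N, hN⟩ := htend.exists
      exact ⟨N, (ENNReal.div_le_iff hK0 hKt).1 hN⟩
  refine ⟨u z, ?_⟩
  have hbound : ⨍⁻ y in ball x₀ R, ‖u y - u z‖ₑ ^ σ ∂μ
      ≤ ⨍⁻ y in ball x₀ R, ((S * B₃) ^ σ * K ^ σ + (S * B₃) ^ σ * (b * K ^ (σ - l)) * g y ^ l) ∂μ := by
    refine laverage_mono_ae ?_
    filter_upwards [hae, ae_restrict_mem measurableSet_ball,
      ae_restrict_of_ae (measure_eq_zero_iff_ae_notMem.1 hE)] with x hx hxR hxE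
    obtain ⟨N, hN, hN'⟩ := rpow_chain_le hl hlσ hx
    rw [Real.enorm_eq_ofReal_abs]
    refine (ENNReal.rpow_le_rpow (hpt x hxE hxR N hN) hσ.le).trans ?_
    rw [ENNReal.mul_rpow_of_nonneg _ _ hσ.le]
    calc _ ≤ (S * B₃) ^ σ * (K ^ σ + b * g x ^ l * K ^ (σ - l)) := by gcongr
      _ = _ := by ring
  have hball : ⨍⁻ y in ball x₀ R, g y ^ l ∂μ ≤ A₀ * K ^ l := by
    rw [← hKl]
    exact h.setLAverage_ball_le hR (by norm_num) (by rw [dist_self]; linarith)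
      (by rw [dist_self]; linarith) _
  have htotal : ⨍⁻ y in ball x₀ R, ‖u y - u z‖ₑ ^ σ ∂μ ≤ (D * (S * K)) ^ σ := by
    refine hbound.trans ?_
    rw [setLAverage_add_le aemeasurable_const, setLAverage_const (h.ball_ne_zero x₀ hR)
      (h.ball_ne_top x₀ R), setLAverage_const_mul _ (hg.pow_const l)]
    calc _ ≤ (S * B₃) ^ σ * K ^ σ + (S * B₃) ^ σ * (b * K ^ (σ - l)) * (A₀ * K ^ l) := by gcongr
      _ = (S * B₃) ^ σ * (1 + b * A₀) * K ^ σ := by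
          have h3 : K ^ σ = K ^ l * K ^ (σ - l) := by
            rw [← ENNReal.rpow_add_of_nonneg _ _ hl.le (by linarith), add_sub_cancel]
          rw [h3]
          ring
      _ = _ := by
          have h4 : 1 + b * A₀ = ((1 + b * A₀) ^ (1 / σ)) ^ σ := by
            rw [← ENNReal.rpow_mul, one_div_mul_cancel hσ.ne', ENNReal.rpow_one]
          nth_rewrite 1 [h4]
          rw [← ENNReal.mul_rpow_of_nonneg _ _ hσ.le, ← ENNReal.mul_rpow_of_nonneg _ _ hσ.le, hD]
          congr 1
          ring
  rw [one_div, ENNReal.rpow_inv_le_iff hσ]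
  exact htotal

end HajlaszTL

/-! ### Mean oscillations and their almost everywhere control of u -/

namespace HajlaszTL

section Arithmetic

lemma add_rpow_le_two_rpow_mul {z : ℝ} (hz : 0 ≤ z) (a b : ℝ≥0∞) :
    (a + b) ^ z ≤ 2 ^ z * (a ^ z + b ^ z) := by
  calc (a + b) ^ z ≤ (2 * max a b) ^ z := by
        gcongr
        rw [two_mul]
        exact add_le_add (le_max_left _ _) (le_max_right _ _)
    _ = 2 ^ z * max a b ^ z := ENNReal.mul_rpow_of_nonneg _ _ hz
    _ ≤ _ := by
        gcongr
        rcases max_choice a b with h | h <;> rw [h]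
        · exact le_self_add
        · exact le_add_self

lemma enorm_sub_le_add (a b c : ℝ) : ‖a - c‖ₑ ≤ ‖a - b‖ₑ + ‖c - b‖ₑ := by
  have : a - c = (a - b) - (c - b) := by ring
  rw [this]
  exact enorm_sub_le

lemma le_of_forall_pos_le_add_mul {a b : ℝ≥0∞} (M : ℝ≥0)
    (h : ∀ δ : ℝ≥0, 0 < δ → a ≤ b + M * δ) : a ≤ b := by
  refine ENNReal.le_of_forall_pos_le_add fun ε hε _ => ?_
  refine (h (ε / (M + 1)) (by positivity)).trans ?_
  gcongr
  rw [← ENNReal.coe_mul]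
  norm_cast
  rw [mul_div_assoc']
  refine div_le_of_le_mul₀ (by positivity) (by positivity) ?_
  rw [mul_comm]
  gcongr
  exact le_self_add

end Arithmetic

variable {X : Type*} [MetricSpace X] [MeasurableSpace X]

noncomputable section

/-- The mean deviation of `u` from `c` on a dyadic ball. -/
def meanDev (μ : Measure X) (σ : ℝ) (u : X → ℝ) (k : ℤ) (x : X) (c : ℝ) : ℝ≥0∞ :=
  (⨍⁻ y in ball x ((2 : ℝ) ^ (-k)), ‖u y - c‖ₑ ^ σ ∂μ) ^ (1 / σ)

/-- The mean oscillation of `u` on a dyadic ball. Only rational constants are admitted, which makes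
it measurable in the centre. -/
def osc (μ : Measure X) (σ : ℝ) (u : X → ℝ) (k : ℤ) (x : X) : ℝ≥0∞ :=
  (⨅ c : ℚ, ⨍⁻ y in ball x ((2 : ℝ) ^ (-k)), ‖u y - c‖ₑ ^ σ ∂μ) ^ (1 / σ)

/-- The mean oscillation, normalised by the smoothness `s`. -/
def scaledOsc (μ : Measure X) (s σ : ℝ) (u : X → ℝ) (k : ℤ) (x : X) : ℝ≥0∞ :=
  (2 : ℝ≥0∞) ^ ((k : ℝ) * s) * osc μ σ u k x

end

variable {μ : Measure X} {C n σ : ℝ}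

lemma measurable_osc [BorelSpace X] [SecondCountableTopology X] [SFinite μ] {u : X → ℝ}
    (hu : AEMeasurable u μ) (k : ℤ) : Measurable (osc μ σ u k) :=
  (Measurable.iInf fun c : ℚ => measurable_setLAverage_ball
    (((hu.sub_const (c : ℝ)).enorm).pow_const σ) _).pow_const _

lemma measurable_scaledOsc [BorelSpace X] [SecondCountableTopology X] [SFinite μ] {u : X → ℝ}
    {s : ℝ} (hu : AEMeasurable u μ) (k : ℤ) : Measurable (scaledOsc μ s σ u k) :=
  (measurable_osc hu k).const_mul _

lemma exists_meanDev_le_osc_add (hσ : 0 < σ) (u : X → ℝ) (k : ℤ) (x : X) {ε : ℝ≥0} (hε : 0 < ε) :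
    ∃ c : ℚ, meanDev μ σ u k x c ≤ osc μ σ u k x + ε := by
  rcases eq_or_ne (osc μ σ u k x) ∞ with h | h
  · exact ⟨0, by rw [h, top_add]; exact le_top⟩
  have hlt : osc μ σ u k x < osc μ σ u k x + ε :=
    ENNReal.lt_add_right h (by exact_mod_cast hε.ne')
  have h1 := (ENNReal.rpow_lt_rpow_iff hσ).2 hlt
  nth_rewrite 1 [osc] at h1
  rw [← ENNReal.rpow_mul, one_div_mul_cancel hσ.ne', ENNReal.rpow_one] at h1
  obtain ⟨c, hc⟩ := iInf_lt_iff.1 h1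
  refine ⟨c, ?_⟩
  rw [meanDev, one_div, ENNReal.rpow_inv_le_iff hσ]
  exact hc.le

namespace IsDoubling

/-- A quasi-triangle inequality for L^σ means that holds for every σ > 0. The elementary power
inequality is used with the exponents σ and 1/σ, giving the factors 2 and 2^{1/σ}. -/
lemma enorm_average_le (h : IsDoubling μ C n) (hσ : 0 < σ) {x : X} {ρ : ℝ} (hρ : 0 < ρ)
    {f g : X → ℝ≥0∞} (hf : AEMeasurable f μ) {a : ℝ≥0∞} (hle : ∀ y, a ≤ f y + g y) :
    a ≤ 2 * (2 : ℝ≥0∞) ^ (1 / σ) * ((⨍⁻ y in ball x ρ, f y ^ σ ∂μ) ^ (1 / σ)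
      + (⨍⁻ y in ball x ρ, g y ^ σ ∂μ) ^ (1 / σ)) := by
  have h1 : a ^ σ ≤ 2 ^ σ * (⨍⁻ y in ball x ρ, f y ^ σ ∂μ + ⨍⁻ y in ball x ρ, g y ^ σ ∂μ) := by
    rw [← setLAverage_add_le (hf.pow_const σ),
      ← setLAverage_const (h.ball_ne_zero x hρ) (h.ball_ne_top x ρ) (a ^ σ)]
    calc _ ≤ ⨍⁻ y in ball x ρ, 2 ^ σ * (f y ^ σ + g y ^ σ) ∂μ :=
          setLAverage_mono fun y => (ENNReal.rpow_le_rpow (hle y) hσ.le).trans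
            (add_rpow_le_two_rpow_mul hσ.le _ _)
      _ = _ := by
          simp only [laverage]
          exact lintegral_const_mul' _ _ (ENNReal.rpow_ne_top_of_nonneg hσ.le (by norm_num))
  rw [← ENNReal.le_rpow_inv_iff hσ, ENNReal.mul_rpow_of_nonneg _ _ (by positivity),
    ← ENNReal.rpow_mul, mul_inv_cancel₀ hσ.ne', ENNReal.rpow_one, ← one_div] at h1
  refine h1.trans ?_
  rw [mul_assoc]
  gcongr
  exact add_rpow_le_two_rpow_mul (by positivity) _ _

lemma average_add_const_le (h : IsDoubling μ C n) (hσ : 0 < σ) {x : X} {ρ : ℝ} (hρ : 0 < ρ)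
    {f g : X → ℝ≥0∞} {a : ℝ≥0∞} (hle : ∀ y, f y ≤ g y + a) :
    (⨍⁻ y in ball x ρ, f y ^ σ ∂μ) ^ (1 / σ)
      ≤ 2 * (2 : ℝ≥0∞) ^ (1 / σ) * ((⨍⁻ y in ball x ρ, g y ^ σ ∂μ) ^ (1 / σ) + a) := by
  have h1 : ⨍⁻ y in ball x ρ, f y ^ σ ∂μ ≤ 2 ^ σ * (⨍⁻ y in ball x ρ, g y ^ σ ∂μ + a ^ σ) := by
    calc _ ≤ ⨍⁻ y in ball x ρ, 2 ^ σ * (a ^ σ + g y ^ σ) ∂μ :=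
          setLAverage_mono fun y => by
            rw [add_comm (a ^ σ)]
            exact (ENNReal.rpow_le_rpow (hle y) hσ.le).trans (add_rpow_le_two_rpow_mul hσ.le _ _)
      _ = 2 ^ σ * ⨍⁻ y in ball x ρ, (a ^ σ + g y ^ σ) ∂μ := by
          simp only [laverage]
          exact lintegral_const_mul' _ _ (ENNReal.rpow_ne_top_of_nonneg hσ.le (by norm_num))
      _ = _ := by
          rw [setLAverage_add_le aemeasurable_const,
            setLAverage_const (h.ball_ne_zero x hρ) (h.ball_ne_top x ρ), add_comm]
  have h2 := ENNReal.rpow_le_rpow h1 (by positivity : 0 ≤ 1 / σ)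
  rw [ENNReal.mul_rpow_of_nonneg _ _ (by positivity), ← ENNReal.rpow_mul,
    mul_one_div_cancel hσ.ne', ENNReal.rpow_one] at h2
  refine h2.trans ?_
  rw [mul_assoc]
  gcongr
  refine (add_rpow_le_two_rpow_mul (by positivity) _ _).trans_eq ?_
  rw [← ENNReal.rpow_mul a, mul_one_div_cancel hσ.ne', ENNReal.rpow_one]

/-- Restricting the constants to be rational changes the oscillation by a bounded factor only. -/
lemma osc_le_meanDev (h : IsDoubling μ C n) (hσ : 0 < σ) (u : X → ℝ) (k : ℤ) (x : X) (c : ℝ) :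
    osc μ σ u k x ≤ 2 * (2 : ℝ≥0∞) ^ (1 / σ) * meanDev μ σ u k x c := by
  have hpos : (0 : ℝ) < 2 ^ (-k) := by positivity
  set M : ℝ≥0 := 2 * 2 ^ (1 / σ) with hM
  have hM' : 2 * (2 : ℝ≥0∞) ^ (1 / σ) = M := by
    rw [hM, ENNReal.coe_mul, ENNReal.coe_rpow_of_nonneg _ (by positivity)]
    rfl
  rw [hM']
  refine le_of_forall_pos_le_add_mul M fun δ hδ => ?_
  obtain ⟨r, hr1, hr2⟩ := exists_rat_btwn (lt_add_of_pos_right c (NNReal.coe_pos.2 hδ))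
  have h1 : ‖(r : ℝ) - c‖ₑ ≤ δ := by
    rw [Real.enorm_eq_ofReal_abs, ← ENNReal.ofReal_coe_nnreal]
    refine ENNReal.ofReal_le_ofReal ?_
    rw [abs_of_pos (by linarith)]
    linarith
  calc osc μ σ u k x ≤ meanDev μ σ u k x r := by
        rw [osc, meanDev]
        exact ENNReal.rpow_le_rpow (iInf_le _ r) (by positivity)
    _ ≤ M * (meanDev μ σ u k x c + δ) := by
        rw [← hM']
        exact h.average_add_const_le hσ hpos fun y =>
          (enorm_sub_le_add _ c _).trans (by gcongr)
    _ = _ := mul_add _ _ _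

lemma exists_meanDev_le (h : IsDoubling μ C n) (hσ : 0 < σ) :
    ∃ K : ℝ≥0, ∀ (u : X → ℝ) (k : ℤ) (x y : X) (c : ℝ), dist x y ≤ 2 ^ (-k) →
      meanDev μ σ u k y c ≤ K * meanDev μ σ u (k - 1) x c := by
  refine ⟨(C * 4 ^ n).toNNReal ^ (1 / σ), fun u k x y c hxy => ?_⟩
  have hpos : (0 : ℝ) < 2 ^ (-k) := by positivity
  have h1 : (2 : ℝ) ^ (-(k - 1)) = 2 * 2 ^ (-k) := by
    rw [show -(k - 1) = 1 + -k by ring, zpow_add₀ two_ne_zero, zpow_one]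
  rw [meanDev, meanDev, ENNReal.coe_rpow_of_nonneg _ (by positivity),
    ← ENNReal.mul_rpow_of_nonneg _ _ (by positivity)]
  refine ENNReal.rpow_le_rpow ?_ (by positivity)
  rw [dist_comm] at hxy
  exact h.setLAverage_ball_le hpos (by norm_num) (by rw [h1]; linarith) (by rw [h1]; linarith) _

/-- By Lebesgue density, at almost every point of S the set S eventually fills more than half of the
closed ball of radius 2^{-(j+1)}; doubling compares that ball with the open ball of radius 2^{-j}.
-/
lemma exists_measure_ball_le_mul_inter [BorelSpace X] [SecondCountableTopology X]
    (h : IsDoubling μ C n) :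
    ∃ K : ℝ≥0, ∀ S : Set X, ∀ᵐ x ∂μ, x ∈ S → ∀ᶠ j : ℕ in Filter.atTop,
      μ (ball x ((2 : ℝ) ^ (-(j : ℤ)))) ≤ K * μ (S ∩ ball x ((2 : ℝ) ^ (-(j : ℤ)))) := by
  have := h.isUnifLocDoublingMeasure
  have := h.isLocallyFiniteMeasure
  refine ⟨2 * (C * 3 ^ n).toNNReal, fun S => ?_⟩
  refine ae_imp_of_ae_restrict ?_
  filter_upwards [IsUnifLocDoublingMeasure.ae_tendsto_measure_inter_div μ S 1] with x hx
  have hδ : Filter.Tendsto (fun j : ℕ => (2 : ℝ) ^ (-((j : ℤ) + 1))) Filter.atTop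
      (nhdsWithin 0 (Ioi 0)) := by
    refine tendsto_nhdsWithin_iff.2 ⟨?_, Filter.Eventually.of_forall fun j => by
      simp only [mem_Ioi]; positivity⟩
    have h1 : (fun j : ℕ => (2 : ℝ) ^ (-((j : ℤ) + 1))) = fun j : ℕ => (1 / 2 : ℝ) ^ (j + 1) := by
      funext j
      rw [zpow_neg, one_div, inv_pow]
      norm_cast
    rw [h1]
    exact (tendsto_pow_atTop_nhds_zero_of_lt_one (by norm_num) (by norm_num)).comp
      (Filter.tendsto_add_atTop_nat 1)
  have ht := hx (fun _ => x) _ hδ (Filter.Eventually.of_forall fun j => by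
    simp only [mem_closedBall, dist_self]; positivity)
  filter_upwards [ht.eventually (eventually_gt_nhds (by norm_num : (2 : ℝ≥0∞)⁻¹ < 1))] with j hj
  have hpos : (0 : ℝ) < 2 ^ (-((j : ℤ) + 1)) := by positivity
  have h2 : (2 : ℝ) ^ (-(j : ℤ)) = 2 * 2 ^ (-((j : ℤ) + 1)) := by
    rw [show -(j : ℤ) = 1 + -((j : ℤ) + 1) by ring, zpow_add₀ two_ne_zero, zpow_one]
  have hcb0 : μ (closedBall x (2 ^ (-((j : ℤ) + 1)))) ≠ 0 := fun h0 =>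
    h.ball_ne_zero x hpos (measure_mono_null ball_subset_closedBall h0)
  have hsub : closedBall x (2 ^ (-((j : ℤ) + 1))) ⊆ ball x ((2 : ℝ) ^ (-(j : ℤ))) :=
    closedBall_subset_ball (by rw [h2]; linarith)
  have hcbt : μ (closedBall x (2 ^ (-((j : ℤ) + 1)))) ≠ ∞ :=
    ne_top_of_le_ne_top (h.ball_ne_top x _) (measure_mono hsub)
  rw [ENNReal.lt_div_iff_mul_lt (Or.inl hcb0) (Or.inl hcbt)] at hj
  calc μ (ball x ((2 : ℝ) ^ (-(j : ℤ))))
      ≤ μ (ball x (3 * (2 : ℝ) ^ (-((j : ℤ) + 1)))) := by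
        refine measure_mono (ball_subset_ball ?_)
        rw [h2]
        linarith
    _ ≤ ENNReal.ofReal (C * 3 ^ n) * μ (ball x (2 ^ (-((j : ℤ) + 1)))) :=
        h.measure_ball_mul_le x _ 3 hpos (by norm_num)
    _ ≤ ENNReal.ofReal (C * 3 ^ n) * μ (closedBall x (2 ^ (-((j : ℤ) + 1)))) := by
        gcongr
        exact ball_subset_closedBall
    _ = 2 * ENNReal.ofReal (C * 3 ^ n) *
          (2⁻¹ * μ (closedBall x (2 ^ (-((j : ℤ) + 1))))) := by
        rw [mul_comm 2, mul_assoc, ← mul_assoc 2, ENNReal.mul_inv_cancel (by norm_num)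
          (by norm_num), one_mul]
    _ ≤ 2 * ENNReal.ofReal (C * 3 ^ n) * μ (S ∩ ball x ((2 : ℝ) ^ (-(j : ℤ)))) := by
        refine mul_le_mul' le_rfl (hj.le.trans ?_)
        gcongr
    _ = _ := by rw [ENNReal.coe_mul]; rfl

/-- At almost every point, `u` is approximated by constants of small mean deviation. -/
lemma exists_ae_eventually_enorm_sub_le [BorelSpace X] [SecondCountableTopology X]
    (h : IsDoubling μ C n) (hσ : 0 < σ) :
    ∃ K : ℝ≥0, ∀ u : X → ℝ, AEMeasurable u μ → ∀ᵐ x ∂μ, ∀ δ : ℝ≥0, 0 < δ →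
      ∀ᶠ j : ℕ in Filter.atTop, ∀ c : ℝ,
        ‖u x - c‖ₑ ≤ 2 * δ + K * meanDev μ σ u j x c := by
  obtain ⟨K, hK⟩ := h.exists_measure_ball_le_mul_inter
  refine ⟨K ^ (1 / σ), fun u hu => ?_⟩
  -- Density is used for the countably many sets where u is within a rational η of a rational a. On
  -- the one around x, u differs from u(x) by at most 2δ, so |u - c| is at least |u(x) - c| - 2δ on
  -- a fixed fraction of the ball and Markov's inequality applies. No integrability of u is needed.
  have hae := ae_all_iff.2 fun a : ℚ => ae_all_iff.2 fun η : ℚ => hK {y | |u y - a| < η}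
  filter_upwards [hae] with x hx δ hδ
  obtain ⟨η, hη0, hηδ⟩ := exists_rat_btwn (NNReal.coe_pos.2 hδ)
  obtain ⟨a, ha1, ha2⟩ := exists_rat_btwn (lt_add_of_pos_right (u x) hη0)
  have hxa : |u x - a| < η := by
    rw [abs_sub_comm, abs_of_pos (by linarith)]
    linarith
  filter_upwards [hx a η hxa] with j hj c
  have hpos : (0 : ℝ) < 2 ^ (-(j : ℤ)) := by positivity
  set B := ball x ((2 : ℝ) ^ (-(j : ℤ))) with hB
  set T : ℝ≥0∞ := ‖u x - c‖ₑ - 2 * δ with hT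
  have hsub : {y | |u y - a| < η} ∩ B ⊆ {y | T ^ σ ≤ ‖u y - c‖ₑ ^ σ} ∩ B := by
    rintro y ⟨hy, hyB⟩
    refine ⟨ENNReal.rpow_le_rpow ?_ hσ.le, hyB⟩
    rw [hT, tsub_le_iff_left]
    have hxy : ‖u x - u y‖ₑ ≤ 2 * δ := by
      have h1 : |u x - u y| ≤ 2 * δ := by
        have h2 := abs_sub_le (u x) a (u y)
        rw [abs_sub_comm (a : ℝ)] at h2
        have hy : |u y - a| < η := hy
        linarith
      rw [Real.enorm_eq_ofReal_abs]
      refine (ENNReal.ofReal_le_ofReal h1).trans_eq ?_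
      rw [ENNReal.ofReal_mul (by norm_num), ENNReal.ofReal_ofNat, ENNReal.ofReal_coe_nnreal]
    calc ‖u x - c‖ₑ = ‖(u x - u y) + (u y - c)‖ₑ := by ring_nf
      _ ≤ ‖u x - u y‖ₑ + ‖u y - c‖ₑ := enorm_add_le _ _
      _ ≤ _ := by gcongr
  have hmarkov : T ^ σ * μ ({y | T ^ σ ≤ ‖u y - c‖ₑ ^ σ} ∩ B) ≤ ∫⁻ y in B, ‖u y - c‖ₑ ^ σ ∂μ := by
    have h1 := mul_meas_ge_le_lintegral₀ (μ := μ.restrict B)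
      (((hu.sub_const c).enorm).pow_const σ).restrict (T ^ σ)
    rwa [Measure.restrict_apply' measurableSet_ball] at h1
  have h3 : T ^ σ ≤ K * ⨍⁻ y in B, ‖u y - c‖ₑ ^ σ ∂μ := by
    rw [setLAverage_eq, ← mul_div_assoc, ENNReal.le_div_iff_mul_le (Or.inl (h.ball_ne_zero x hpos))
      (Or.inl (h.ball_ne_top x _))]
    calc T ^ σ * μ B ≤ T ^ σ * (K * μ ({y | |u y - a| < η} ∩ B)) := by gcongr
      _ ≤ T ^ σ * (K * μ ({y | T ^ σ ≤ ‖u y - c‖ₑ ^ σ} ∩ B)) := by gcongr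
      _ = K * (T ^ σ * μ ({y | T ^ σ ≤ ‖u y - c‖ₑ ^ σ} ∩ B)) := by ring
      _ ≤ _ := by gcongr
  rw [← ENNReal.le_rpow_inv_iff hσ, ENNReal.mul_rpow_of_nonneg _ _ (by positivity), ← one_div,
    hT, tsub_le_iff_left] at h3
  rw [ENNReal.coe_rpow_of_nonneg _ (by positivity)]
  exact h3

/-- Almost everywhere, the deviation of `u` from a constant is controlled by the mean deviation on
a ball and the oscillations on all smaller balls. -/
theorem exists_ae_enorm_sub_le [BorelSpace X] [SecondCountableTopology X]
    (h : IsDoubling μ C n) (hσ : 0 < σ) :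
    ∃ K : ℝ≥0, ∀ u : X → ℝ, AEMeasurable u μ → ∀ᵐ x ∂μ, ∀ (k : ℤ) (c : ℝ),
        ‖u x - c‖ₑ ≤ K * (meanDev μ σ u k x c + ∑' i : ℕ, osc μ σ u (k + i) x) := by
  obtain ⟨K₁, hK₁⟩ := h.exists_ae_eventually_enorm_sub_le hσ
  obtain ⟨K₂, hK₂⟩ := h.exists_meanDev_le hσ
  set M : ℝ≥0 := 2 * 2 ^ (1 / σ) with hM
  have hM' : 2 * (2 : ℝ≥0∞) ^ (1 / σ) = M := by
    rw [hM, ENNReal.coe_mul, ENNReal.coe_rpow_of_nonneg _ (by positivity)]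
    rfl
  set K := K₁ + M * (1 + K₂) with hK
  refine ⟨K, fun u hu => ?_⟩
  filter_upwards [hK₁ u hu] with x hx k c
  refine le_of_forall_pos_le_add_mul (2 + K) fun δ hδ => ?_
  obtain ⟨ε, hε, hεsum⟩ := ENNReal.exists_pos_sum_of_countable (ENNReal.coe_ne_zero.2 hδ.ne') ℕ
  choose r hr using fun i : ℕ => exists_meanDev_le_osc_add (μ := μ) hσ u (k + i) x (hε i)
  -- The telescoping sequence starts at the given c and continues with nearly optimal constants on
  -- the successive balls, with errors summing to less than δ.
  let d : ℕ → ℝ := fun i => if i = 0 then c else r i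
  let a : ℕ → ℝ≥0∞ := fun i => meanDev μ σ u (k + i) x (d i)
  have hstep : ∀ i, ‖d (i + 1) - d i‖ₑ ≤ M * (a (i + 1) + K₂ * a i) := by
    intro i
    have h1 : ‖d (i + 1) - d i‖ₑ ≤ M * (meanDev μ σ u (k + (i + 1 : ℕ)) x (d (i + 1))
        + meanDev μ σ u (k + (i + 1 : ℕ)) x (d i)) := by
      rw [← hM']
      refine h.enorm_average_le hσ (by positivity) (hu.sub_const _).enorm fun y => ?_
      calc ‖d (i + 1) - d i‖ₑ = ‖(u y - d i) - (u y - d (i + 1))‖ₑ := by ring_nf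
        _ ≤ ‖u y - d i‖ₑ + ‖u y - d (i + 1)‖ₑ := enorm_sub_le
        _ = _ := add_comm _ _
    refine h1.trans ?_
    gcongr
    have h2 := hK₂ u (k + (i + 1 : ℕ)) x x (d i) (by rw [dist_self]; positivity)
    rwa [show k + ((i + 1 : ℕ) : ℤ) - 1 = k + i by push_cast; ring] at h2
  have hchain : ∀ N : ℕ, ‖d N - c‖ₑ ≤ M * (1 + K₂) * ∑ i ∈ Finset.range (N + 1), a i := by
    have hstrong : ∀ N : ℕ, ‖d N - c‖ₑ ≤ M * (1 + K₂) * ∑ i ∈ Finset.range N, a i + M * a N := by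
      intro N
      induction N with
      | zero => simp [d]
      | succ N ih =>
        calc ‖d (N + 1) - c‖ₑ = ‖(d (N + 1) - d N) + (d N - c)‖ₑ := by ring_nf
          _ ≤ ‖d (N + 1) - d N‖ₑ + ‖d N - c‖ₑ := enorm_add_le _ _
          _ ≤ M * (a (N + 1) + K₂ * a N) +
              (M * (1 + K₂) * ∑ i ∈ Finset.range N, a i + M * a N) := add_le_add (hstep N) ih
          _ = _ := by rw [Finset.sum_range_succ]; ring
    intro N
    refine (hstrong N).trans ?_
    rw [Finset.sum_range_succ, mul_add _ _ (a N)]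
    refine add_le_add le_rfl (mul_le_mul' ?_ le_rfl)
    rw [mul_add, mul_one]
    exact le_self_add
  obtain ⟨j₀, hj₀⟩ := Filter.eventually_atTop.1 (hx δ hδ)
  -- The chain is stopped at a scale fine enough for the density estimate at x, which compares u(x)
  -- with the last constant.
  obtain ⟨N, hN⟩ : ∃ N : ℕ, ((j₀ : ℤ) ≤ k + N) := ⟨(j₀ - k).toNat, by omega⟩
  have hlast : ‖u x - d N‖ₑ ≤ 2 * δ + K₁ * a N := by
    have h1 := hj₀ (k + N).toNat (by omega) (d N)
    rwa [show (((k + N).toNat : ℕ) : ℤ) = k + N by omega] at h1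
  have ha : ∑ i ∈ Finset.range (N + 1), a i
      ≤ meanDev μ σ u k x c + (∑' i : ℕ, osc μ σ u (k + i) x + δ) := by
    calc ∑ i ∈ Finset.range (N + 1), a i
        = ∑ i ∈ Finset.range N, a (i + 1) + a 0 := Finset.sum_range_succ' _ _
      _ ≤ ∑ i ∈ Finset.range N, (osc μ σ u (k + (i + 1 : ℕ)) x + ε (i + 1)) + a 0 := by
          gcongr with i
          simp only [a, d, Nat.succ_ne_zero, if_false]
          exact hr (i + 1)
      _ ≤ ∑' i : ℕ, (osc μ σ u (k + i) x + ε i) + a 0 := by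
          gcongr
          have h1 := ENNReal.sum_le_tsum (f := fun i : ℕ => osc μ σ u (k + i) x + ε i)
            (Finset.range (N + 1))
          rw [Finset.sum_range_succ'] at h1
          exact le_self_add.trans h1
      _ ≤ _ := by
          rw [ENNReal.tsum_add, add_comm]
          gcongr
          simp [a, d]
  calc ‖u x - c‖ₑ = ‖(u x - d N) + (d N - c)‖ₑ := by ring_nf
    _ ≤ ‖u x - d N‖ₑ + ‖d N - c‖ₑ := enorm_add_le _ _
    _ ≤ (2 * δ + K₁ * a N) + M * (1 + K₂) * ∑ i ∈ Finset.range (N + 1), a i :=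
        add_le_add hlast (hchain N)
    _ ≤ (2 * δ + K₁ * ∑ i ∈ Finset.range (N + 1), a i)
          + M * (1 + K₂) * ∑ i ∈ Finset.range (N + 1), a i := by
        gcongr
        exact Finset.single_le_sum (f := a) (fun _ _ => zero_le) (by simp)
    _ = 2 * δ + K * ∑ i ∈ Finset.range (N + 1), a i := by rw [hK]; push_cast; ring
    _ ≤ 2 * δ + K * (meanDev μ σ u k x c + (∑' i : ℕ, osc μ σ u (k + i) x + δ)) := by gcongr
    _ = _ := by push_cast; ring

end IsDoubling

end HajlaszTL

/-! ### From integrals in dt/t to sums over dyadic shells -/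

namespace HajlaszTL

section Shells

/-- The dyadic interval `[2^{-k-1}, 2^{-k})`. -/
def shell (k : ℤ) : Set ℝ := Ico ((2 : ℝ) ^ (-(k + 1))) ((2 : ℝ) ^ (-k))

lemma measurableSet_shell (k : ℤ) : MeasurableSet (shell k) := measurableSet_Ico

lemma pos_of_mem_shell {k : ℤ} {t : ℝ} (ht : t ∈ shell k) : 0 < t :=
  lt_of_lt_of_le (by positivity) ht.1

lemma two_zpow_neg_eq (k : ℤ) : (2 : ℝ) ^ (-k) = 2 * 2 ^ (-(k + 1)) := by
  rw [show -k = 1 + -(k + 1) by ring, zpow_add₀ two_ne_zero, zpow_one]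

lemma exists_mem_shell {t : ℝ} (ht : 0 < t) : ∃ k, t ∈ shell k := by
  obtain ⟨i, hi⟩ := exists_mem_Ico_zpow ht one_lt_two
  refine ⟨-(i + 1), ?_⟩
  rw [shell, neg_neg, show -(-(i + 1) + 1) = i by ring]
  exact hi

lemma lt_add_one_of_mem_shell {j k : ℤ} {t : ℝ} (h1 : t ∈ shell j) (h2 : t < 2 ^ (-k)) :
    k < j + 1 := by
  have h3 := (zpow_lt_zpow_iff_right₀ (one_lt_two (α := ℝ))).1 (h1.1.trans_lt h2)
  omega

lemma pairwise_disjoint_shell : Pairwise (Function.onFun Disjoint shell) := by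
  intro j k hjk
  refine disjoint_left.2 fun t hj hk => hjk ?_
  have h1 := lt_add_one_of_mem_shell hj hk.2
  have h2 := lt_add_one_of_mem_shell hk hj.2
  omega

lemma volume_shell (k : ℤ) : volume (shell k) = ENNReal.ofReal (2 ^ (-(k + 1))) := by
  rw [shell, Real.volume_Ico, two_zpow_neg_eq]
  ring_nf

/-- The dt/t-mass of a shell is log 2, which lies between 1/2 and 1; this explains the constant here
and the factor 2 in the next lemma. Comparison with a constant avoids any measurability of G. -/
lemma lintegral_shell_le {G : ℝ → ℝ≥0∞} {B : ℝ≥0∞} {k : ℤ} (h : ∀ t ∈ shell k, G t ≤ B) :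
    ∫⁻ t in shell k, G t * ENNReal.ofReal (1 / t) ≤ B := by
  have hpos : (0 : ℝ) < 2 ^ (-(k + 1)) := by positivity
  calc ∫⁻ t in shell k, G t * ENNReal.ofReal (1 / t)
      ≤ ∫⁻ _ in shell k, B * ENNReal.ofReal (1 / 2 ^ (-(k + 1))) := by
        refine setLIntegral_mono' (measurableSet_shell k) fun t ht => ?_
        refine mul_le_mul' (h t ht) (ENNReal.ofReal_le_ofReal ?_)
        exact one_div_le_one_div_of_le hpos ht.1
    _ = B := by
        rw [setLIntegral_const, volume_shell, mul_assoc, ← ENNReal.ofReal_mul (by positivity),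
          one_div_mul_cancel hpos.ne', ENNReal.ofReal_one, mul_one]

lemma le_two_mul_lintegral_shell {G : ℝ → ℝ≥0∞} {B : ℝ≥0∞} {k : ℤ} (h : ∀ t ∈ shell k, B ≤ G t) :
    B ≤ 2 * ∫⁻ t in shell k, G t * ENNReal.ofReal (1 / t) := by
  have hpos : (0 : ℝ) < 2 ^ (-(k + 1)) := by positivity
  calc B = 2 * ∫⁻ _ in shell k, B * ENNReal.ofReal (1 / 2 ^ (-k)) := by
        rw [setLIntegral_const, volume_shell, mul_assoc, ← ENNReal.ofReal_mul (by positivity),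
          two_zpow_neg_eq, mul_left_comm, ← ENNReal.ofReal_ofNat, ← ENNReal.ofReal_mul two_pos.le]
        rw [show (2 : ℝ) * (1 / (2 * 2 ^ (-(k + 1))) * 2 ^ (-(k + 1))) = 1 by field_simp,
          ENNReal.ofReal_one, mul_one]
    _ ≤ _ := by
        refine mul_le_mul' le_rfl (setLIntegral_mono' (measurableSet_shell k) fun t ht => ?_)
        refine mul_le_mul' (h t ht) (ENNReal.ofReal_le_ofReal ?_)
        exact one_div_le_one_div_of_le (pos_of_mem_shell ht) ht.2.le

variable {q : ℝ≥0∞}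

lemma dtNorm_le_lqNorm (hq0 : q ≠ 0) {f : ℝ → ℝ≥0∞} {b : ℤ → ℝ≥0∞}
    (h : ∀ k, ∀ t ∈ shell k, f t ≤ b k) : dtNorm q f ≤ lqNorm q b := by
  rcases eq_or_ne q ∞ with rfl | hq
  · rw [lqNorm_top, dtNorm, if_pos rfl]
    refine iSup₂_le fun t ht => ?_
    obtain ⟨k, hk⟩ := exists_mem_shell ht
    exact (h k t hk).trans (le_iSup b k)
  · have hQ : 0 < q.toReal := ENNReal.toReal_pos hq0 hq
    rw [lqNorm_of_ne_top hq, dtNorm, if_neg hq]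
    refine ENNReal.rpow_le_rpow ?_ (by positivity)
    have hsub : Ioi (0 : ℝ) ⊆ ⋃ k, shell k := fun t ht => mem_iUnion.2 (exists_mem_shell ht)
    refine (lintegral_mono_set hsub).trans ((lintegral_iUnion_le _ _).trans ?_)
    exact ENNReal.tsum_le_tsum fun k => lintegral_shell_le fun t ht =>
      ENNReal.rpow_le_rpow (h k t ht) hQ.le

/-- The shell of index k - 1 consists of radii t ≥ 2^{-k}: in the applications a_k lives on the ball
of radius 2^{-k} and is controlled by functionals on balls containing it. -/
lemma lqNorm_le_dtNorm (hq0 : q ≠ 0) {f : ℝ → ℝ≥0∞} {a : ℤ → ℝ≥0∞}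
    (h : ∀ k, ∀ t ∈ shell (k - 1), a k ≤ f t) :
    lqNorm q a ≤ (2 : ℝ≥0∞) ^ (1 / q.toReal) * dtNorm q f := by
  rcases eq_or_ne q ∞ with rfl | hq
  · rw [lqNorm_top, dtNorm, if_pos rfl]
    simp only [ENNReal.toReal_top, div_zero, ENNReal.rpow_zero, one_mul]
    refine iSup_le fun k => ?_
    have hk : (2 : ℝ) ^ (-k) ∈ shell (k - 1) := by
      rw [shell, sub_add_cancel, two_zpow_neg_eq (k - 1), sub_add_cancel, left_mem_Ico]
      linarith [show (0 : ℝ) < 2 ^ (-k) by positivity]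
    exact (h k _ hk).trans (le_iSup₂ (f := fun (t : ℝ) (_ : 0 < t) => f t) _ (by positivity))
  · have hQ : 0 < q.toReal := ENNReal.toReal_pos hq0 hq
    rw [lqNorm_of_ne_top hq, dtNorm, if_neg hq, ← ENNReal.mul_rpow_of_nonneg _ _ (by positivity)]
    refine ENNReal.rpow_le_rpow ?_ (by positivity)
    calc ∑' k, a k ^ q.toReal
        ≤ ∑' k : ℤ, 2 * ∫⁻ t in shell (k - 1), f t ^ q.toReal * ENNReal.ofReal (1 / t) :=
          ENNReal.tsum_le_tsum fun k => le_two_mul_lintegral_shell fun t ht =>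
            ENNReal.rpow_le_rpow (h k t ht) hQ.le
      _ = 2 * ∫⁻ t in ⋃ k, shell k, f t ^ q.toReal * ENNReal.ofReal (1 / t) := by
          rw [ENNReal.tsum_mul_left, lintegral_iUnion measurableSet_shell pairwise_disjoint_shell]
          congr 1
          exact (Equiv.subRight (1 : ℤ)).tsum_eq
            fun k => ∫⁻ t in shell k, f t ^ q.toReal * ENNReal.ofReal (1 / t)
      _ ≤ _ := by
          refine mul_le_mul' le_rfl (lintegral_mono_set ?_)
          exact iUnion_subset fun k t ht => pos_of_mem_shell ht

end Shells

variable {X : Type*} [MetricSpace X] [MeasurableSpace X] {μ : Measure X} {C n : ℝ} {p q : ℝ≥0∞}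

lemma normF_mono (hq0 : q ≠ 0) {F G : X → ℝ → ℝ≥0∞} (h : ∀ x t, 0 < t → F x t ≤ G x t) :
    normF μ p q F ≤ normF μ p q G := by
  rw [normF, normF]
  split_ifs with hp hq
  · exact iSup₂_mono fun t ht => eLpNorm_mono_enorm fun x => h x t ht
  · have hQ : 0 < q.toReal := ENNReal.toReal_pos hq0 hq
    refine iSup_mono fun x => iSup₂_mono fun r hr => ENNReal.rpow_le_rpow ?_ (by positivity)
    refine setLIntegral_mono' measurableSet_Ioo fun t ht => mul_le_mul' ?_ le_rfl
    exact setLAverage_mono fun y => ENNReal.rpow_le_rpow (h y t ht.1) hQ.le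
  · refine eLpNorm_mono_enorm fun x => ?_
    simp only [enorm_eq_self]
    rw [dtNorm, dtNorm]
    split_ifs with hq
    · exact iSup₂_mono fun t ht => h x t ht
    · refine ENNReal.rpow_le_rpow ?_ (by positivity)
      refine setLIntegral_mono' measurableSet_Ioi fun t ht => mul_le_mul' ?_ le_rfl
      exact ENNReal.rpow_le_rpow (h x t ht) (by positivity)

/-- Shell by shell the integral is at most the sum. In the Carleson case a radius ρ in the shell of
index k is enlarged to 2^{-k}, and (0, ρ) is covered by the shells of index at least k. -/
theorem IsDoubling.exists_normF_le_gradNorm (h : IsDoubling μ C n) (hq0 : q ≠ 0) :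
    ∃ K : ℝ≥0, ∀ (F : X → ℝ → ℝ≥0∞) (b : ℤ → X → ℝ≥0∞),
      (∀ᵐ x ∂μ, ∀ k, ∀ t ∈ shell k, F x t ≤ b k x) →
      normF μ p q F ≤ K * gradNorm μ p q b := by
  rcases eq_or_ne p ∞ with rfl | hp
  swap
  · refine ⟨1, fun F b hFb => ?_⟩
    rw [normF, if_neg hp, gradNorm_of_not (fun h => hp h.1), ENNReal.coe_one, one_mul]
    refine eLpNorm_mono_enorm_ae ?_
    filter_upwards [hFb] with x hx
    simp only [enorm_eq_self]
    exact dtNorm_le_lqNorm hq0 hx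
  rcases eq_or_ne q ∞ with rfl | hq
  · refine ⟨1, fun F b hFb => ?_⟩
    rw [normF, if_pos rfl, if_pos rfl, gradNorm_of_not (by simp), ENNReal.coe_one, one_mul]
    refine iSup₂_le fun t ht => eLpNorm_mono_enorm_ae ?_
    obtain ⟨k, hk⟩ := exists_mem_shell ht
    filter_upwards [hFb] with x hx
    simp only [enorm_eq_self, lqNorm_top]
    exact (hx k t hk).trans (le_iSup (fun k => b k x) k)
  have hQ : 0 < q.toReal := ENNReal.toReal_pos hq0 hq
  refine ⟨(C * 3 ^ n).toNNReal ^ (1 / q.toReal), fun F b hFb => ?_⟩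
  rw [normF, if_pos rfl, if_neg hq]
  refine iSup_le fun x => iSup₂_le fun ρ hρ => ?_
  rw [one_div, ENNReal.rpow_inv_le_iff hQ, ENNReal.mul_rpow_of_nonneg _ _ hQ.le,
    ENNReal.coe_rpow_of_nonneg _ (by positivity), ← ENNReal.rpow_mul, inv_mul_cancel₀ hQ.ne',
    ENNReal.rpow_one]
  obtain ⟨k, hk⟩ := exists_mem_shell hρ
  have hsub : Ioo 0 ρ ⊆ ⋃ m : ℕ, shell (k + m) := by
    intro t ht
    obtain ⟨j, hj⟩ := exists_mem_shell ht.1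
    have := lt_add_one_of_mem_shell hj (ht.2.trans hk.2)
    refine mem_iUnion.2 ⟨(j - k).toNat, ?_⟩
    rwa [show k + ((j - k).toNat : ℤ) = j by omega]
  refine (lintegral_mono_set hsub).trans ((lintegral_iUnion_le _ _).trans ?_)
  refine le_trans ?_ (mul_le_mul' le_rfl (tsum_setLAverage_le_gradNorm_top hq0 hq b k x))
  rw [← ENNReal.tsum_mul_left]
  refine ENNReal.tsum_le_tsum fun m => lintegral_shell_le fun t ht => ?_
  calc ⨍⁻ y in ball x ρ, F y t ^ q.toReal ∂μ ≤ ⨍⁻ y in ball x ρ, b (k + m) y ^ q.toReal ∂μ := by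
        refine setLAverage_mono_ae _ ?_
        filter_upwards [hFb] with y hy
        exact ENNReal.rpow_le_rpow (hy _ t ht) hQ.le
    _ ≤ _ := by
        refine h.setLAverage_ball_le hρ (by norm_num) ?_ ?_ _
        · rw [dist_self, zero_add]
          exact hk.2.le
        · rw [dist_self, zero_add, two_zpow_neg_eq]
          linarith [hk.1]

theorem IsDoubling.exists_gradNorm_le_normF [BorelSpace X] (h : IsDoubling μ C n) (hq0 : q ≠ 0) :
    ∃ K : ℝ≥0, ∀ (F : X → ℝ → ℝ≥0∞) (a : ℤ → X → ℝ≥0∞), (∀ k, AEMeasurable (a k) μ) →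
      (∀ x k, ∀ t ∈ shell (k - 1), a k x ≤ F x t) →
      gradNorm μ p q a ≤ K * normF μ p q F := by
  have hpw : ∀ k : ℤ, (2 : ℝ) ^ (-k) ∈ shell (k - 1) := by
    intro k
    rw [shell, sub_add_cancel, two_zpow_neg_eq (k - 1), sub_add_cancel, left_mem_Ico]
    linarith [show (0 : ℝ) < 2 ^ (-k) by positivity]
  rcases eq_or_ne p ∞ with rfl | hp
  swap
  · refine ⟨2 ^ (1 / q.toReal), fun F a _ hFa => ?_⟩
    rw [normF, if_neg hp, gradNorm_of_not (fun h => hp h.1)]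
    refine (eLpNorm_le_nnreal_smul_eLpNorm_of_ae_le_mul' (c := 2 ^ (1 / q.toReal))
      (g := fun x => dtNorm q (F x)) ?_ p).trans_eq (by rw [ENNReal.smul_def, smul_eq_mul])
    filter_upwards with x
    simp only [enorm_eq_self]
    rw [ENNReal.coe_rpow_of_nonneg _ (by positivity)]
    exact lqNorm_le_dtNorm hq0 (hFa x)
  rcases eq_or_ne q ∞ with rfl | hq
  · refine ⟨1, fun F a _ hFa => ?_⟩
    rw [normF, if_pos rfl, if_pos rfl, gradNorm_of_not (by simp), ENNReal.coe_one, one_mul]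
    simp only [lqNorm_top, eLpNorm_exponent_top, eLpNormEssSup, enorm_eq_self]
    refine essSup_le_of_ae_le _ ?_
    have hk : ∀ k : ℤ, ∀ᵐ x ∂μ, a k x
        ≤ ⨆ (t : ℝ) (_ : 0 < t), essSup (fun x => F x t) μ := by
      intro k
      filter_upwards [ENNReal.ae_le_essSup fun x => F x (2 ^ (-k))] with x hx
      refine (hFa x k _ (hpw k)).trans (hx.trans ?_)
      exact le_iSup₂ (f := fun (t : ℝ) (_ : 0 < t) => essSup (fun x => F x t) μ) _ (by positivity)
    filter_upwards [ae_all_iff.2 hk] with x hx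
    exact iSup_le hx
  have hQ : 0 < q.toReal := ENNReal.toReal_pos hq0 hq
  -- The shells of index k + m - 1 reach up to radius 2^{-(k-1)}, so the ball is doubled to match.
  obtain ⟨D, hD⟩ := h.exists_setLAverage_zpow_le 1
  refine ⟨(D * 2) ^ (1 / q.toReal), fun F a ha hFa => gradNorm_top_le hq0 hq fun k x => ?_⟩
  rw [ENNReal.mul_rpow_of_nonneg _ _ hQ.le, ENNReal.coe_rpow_of_nonneg _ (by positivity),
    ← ENNReal.rpow_mul, one_div_mul_cancel hQ.ne', ENNReal.rpow_one]
  set B := ball x ((2 : ℝ) ^ (-(k - 1))) with hB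
  have hle : ∫⁻ t in Ioo (0 : ℝ) (2 ^ (-(k - 1))),
      (⨍⁻ y in B, F y t ^ q.toReal ∂μ) * ENNReal.ofReal (1 / t) ≤ normF μ ∞ q F ^ q.toReal := by
    rw [← ENNReal.rpow_inv_le_iff hQ, normF, if_pos rfl, if_neg hq, ← one_div]
    refine le_trans ?_ (le_iSup _ x)
    exact le_iSup₂ (f := fun (r : ℝ) (_ : 0 < r) => (∫⁻ t in Ioo (0 : ℝ) r,
      (⨍⁻ y in ball x r, F y t ^ q.toReal ∂μ) * ENNReal.ofReal (1 / t)) ^ (1 / q.toReal))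
      _ (by positivity)
  calc ∑' m : ℕ, ⨍⁻ y in ball x ((2 : ℝ) ^ (-k)), a (k + m) y ^ q.toReal ∂μ
      ≤ ∑' m : ℕ, D * (2 * ∫⁻ t in shell (k + m - 1),
          (⨍⁻ y in B, F y t ^ q.toReal ∂μ) * ENNReal.ofReal (1 / t)) := by
        refine ENNReal.tsum_le_tsum fun m => (hD _ x k).trans (mul_le_mul' le_rfl ?_)
        refine le_two_mul_lintegral_shell fun t ht => ?_
        exact setLAverage_mono fun y => ENNReal.rpow_le_rpow (hFa y _ t ht) hQ.le
    _ = D * 2 * ∫⁻ t in ⋃ m : ℕ, shell (k + m - 1),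
          (⨍⁻ y in B, F y t ^ q.toReal ∂μ) * ENNReal.ofReal (1 / t) := by
        rw [lintegral_iUnion (fun m => measurableSet_shell _), ENNReal.tsum_mul_left,
          ENNReal.tsum_mul_left, mul_assoc]
        intro i j hij
        exact pairwise_disjoint_shell (by omega)
    _ ≤ D * 2 * ∫⁻ t in Ioo (0 : ℝ) (2 ^ (-(k - 1))),
          (⨍⁻ y in B, F y t ^ q.toReal ∂μ) * ENNReal.ofReal (1 / t) := by
        refine mul_le_mul' le_rfl (lintegral_mono_set ?_)
        refine iUnion_subset fun m t ht => ⟨pos_of_mem_shell ht, ht.2.trans_le ?_⟩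
        exact zpow_le_zpow_right₀ one_le_two (by omega)
    _ ≤ _ := by
        rw [ENNReal.coe_mul]
        exact mul_le_mul' le_rfl hle

end HajlaszTL

/-! ### The functionals C, A, I, S against oscillations -/

namespace HajlaszTL

section Powers

lemma ofReal_two_zpow_rpow (k : ℤ) (z : ℝ) :
    ENNReal.ofReal (((2 : ℝ) ^ k) ^ z) = (2 : ℝ≥0∞) ^ ((k : ℝ) * z) := by
  rw [← Real.rpow_intCast, ← Real.rpow_mul two_pos.le, ← ENNReal.ofReal_rpow_of_pos two_pos,
    ENNReal.ofReal_ofNat]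

lemma two_rpow_add (a b : ℝ) : (2 : ℝ≥0∞) ^ (a + b) = 2 ^ a * 2 ^ b :=
  ENNReal.rpow_add _ _ (by norm_num) (by norm_num)

lemma two_rpow_pow (a : ℝ) (i : ℕ) : ((2 : ℝ≥0∞) ^ a) ^ i = 2 ^ (a * i) := by
  rw [← ENNReal.rpow_natCast, ← ENNReal.rpow_mul]

lemma ofReal_rpow_neg_le {k : ℤ} {t s : ℝ} (hs : 0 ≤ s) (ht : t ∈ shell k) :
    ENNReal.ofReal (t ^ (-s)) ≤ (2 : ℝ≥0∞) ^ (((k : ℝ) + 1) * s) := by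
  have h1 : ((k : ℝ) + 1) * s = ((-(k + 1) : ℤ) : ℝ) * (-s) := by push_cast; ring
  rw [h1, ← ofReal_two_zpow_rpow]
  exact ENNReal.ofReal_le_ofReal
    (Real.rpow_le_rpow_of_nonpos (by positivity) ht.1 (by linarith))

lemma le_ofReal_rpow_neg {k : ℤ} {t s : ℝ} (hs : 0 ≤ s) (ht : t ∈ shell k) :
    (2 : ℝ≥0∞) ^ ((k : ℝ) * s) ≤ ENNReal.ofReal (t ^ (-s)) := by
  have h1 : (k : ℝ) * s = ((-k : ℤ) : ℝ) * (-s) := by push_cast; ring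
  rw [h1, ← ofReal_two_zpow_rpow]
  exact ENNReal.ofReal_le_ofReal
    (Real.rpow_le_rpow_of_nonpos (pos_of_mem_shell ht) ht.2.le (by linarith))

lemma two_rpow_neg_lt_one {s : ℝ} (hs : 0 < s) : (2 : ℝ≥0∞) ^ (-s) < 1 :=
  ENNReal.rpow_lt_one_of_one_lt_of_neg (by norm_num) (by linarith)

lemma coe_two_mul_rpow {z : ℝ} (hz : 0 ≤ z) :
    2 * (2 : ℝ≥0∞) ^ z = ((2 * 2 ^ z : ℝ≥0) : ℝ≥0∞) := by
  rw [ENNReal.coe_mul, ENNReal.coe_rpow_of_nonneg _ hz]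
  rfl

lemma coe_two_rpow {z : ℝ} (hz : 0 ≤ z) : ((2 ^ z : ℝ≥0) : ℝ≥0∞) = (2 : ℝ≥0∞) ^ z := by
  rw [ENNReal.coe_rpow_of_nonneg _ hz]
  rfl

end Powers

variable {X : Type*} [MetricSpace X] [MeasurableSpace X] {μ : Measure X} {C n : ℝ} {s σ ε : ℝ}

/-- At the ratio 2^{-s} the geometric weight cancels the smoothness weight, leaving the plain tail
sum of oscillations produced by the almost everywhere estimate. -/
lemma hardySum_scaledOsc (u : X → ℝ) (M : ℕ) (k : ℤ) (x : X) :
    hardySum (2 ^ (-s)) M (fun j => scaledOsc μ s σ u j x) k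
      = (2 : ℝ≥0∞) ^ (((k : ℝ) - M) * s) * ∑' i : ℕ, osc μ σ u (k - M + i) x := by
  rw [hardySum, ← ENNReal.tsum_mul_left]
  refine tsum_congr fun i => ?_
  rw [scaledOsc, ← mul_assoc, two_rpow_pow, ← two_rpow_add]
  congr 2
  push_cast
  ring

lemma le_hardySum_zero (θ : ℝ≥0∞) (a : ℤ → ℝ≥0∞) (k : ℤ) : a k ≤ hardySum θ 0 a k := by
  simpa using le_hardySum θ 0 a k 0

lemma opI_le_opC (u : X → ℝ) (x : X) (t : ℝ) (hσ : 0 < σ) :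
    opI μ s σ u x t ≤ opC μ s σ u x t := by
  rw [opI, opC]
  refine mul_le_mul' le_rfl (ENNReal.rpow_le_rpow ?_ (by positivity))
  refine (iInf_le _ (u x)).trans (le_of_eq ?_)
  simp only [enorm_sub_rev]

lemma opI_le_opA (u : X → ℝ) (x : X) (t : ℝ) (hσ : 0 < σ) :
    opI μ s σ u x t ≤ opA μ s σ u x t := by
  rw [opI, opA]
  exact mul_le_mul' le_rfl (ENNReal.rpow_le_rpow (iInf_le _ _) (by positivity))

lemma opI_le_opS (u : X → ℝ) (x : X) {t : ℝ} (ht : 0 < t) :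
    opI μ s σ u x t ≤ opS μ s ε σ u x t := by
  have h1 : t ^ (-s) = t ^ (ε - s) * t ^ (-ε) := by
    rw [← Real.rpow_add ht]
    ring_nf
  rw [opI, opS, h1, ENNReal.ofReal_mul (by positivity), mul_assoc]
  refine mul_le_mul' le_rfl ?_
  exact le_iSup₂ (f := fun (r : ℝ) (_ : r ∈ Ioc (0 : ℝ) t) => ENNReal.ofReal (r ^ (-ε)) *
      (⨅ c : ℝ, ⨍⁻ y in ball x r, ‖u y - c‖ₑ ^ σ ∂μ) ^ (1 / σ)) t ⟨ht, le_rfl⟩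

namespace IsDoubling

lemma setLAverage_shell_le (h : IsDoubling μ C n) {k : ℤ} {t : ℝ} (ht : t ∈ shell k)
    (f : X → ℝ≥0∞) (x : X) :
    ⨍⁻ y in ball x t, f y ∂μ
      ≤ ENNReal.ofReal (C * 3 ^ n) * ⨍⁻ y in ball x ((2 : ℝ) ^ (-k)), f y ∂μ := by
  have ht0 := pos_of_mem_shell ht
  refine h.setLAverage_ball_le ht0 (by norm_num) ?_ ?_ f
  · rw [dist_self, zero_add]
    exact ht.2.le
  · rw [dist_self, zero_add, two_zpow_neg_eq]
    linarith [ht.1]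

lemma exists_average_shell_le (h : IsDoubling μ C n) (hσ : 0 < σ) :
    ∃ K : ℝ≥0, ∀ (u : X → ℝ) (k : ℤ), ∀ t ∈ shell k, ∀ (x : X) (c : ℝ),
      (⨍⁻ y in ball x t, ‖u y - c‖ₑ ^ σ ∂μ) ^ (1 / σ) ≤ K * meanDev μ σ u k x c := by
  refine ⟨(C * 3 ^ n).toNNReal ^ (1 / σ), fun u k t ht x c => ?_⟩
  rw [meanDev, ENNReal.coe_rpow_of_nonneg _ (by positivity),
    ← ENNReal.mul_rpow_of_nonneg _ _ (by positivity)]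
  exact ENNReal.rpow_le_rpow (h.setLAverage_shell_le ht _ x) (by positivity)

lemma exists_iInf_shell_le (h : IsDoubling μ C n) (hσ : 0 < σ) :
    ∃ K : ℝ≥0, ∀ (u : X → ℝ) (k : ℤ), ∀ t ∈ shell k, ∀ x : X,
      (⨅ c : ℝ, ⨍⁻ y in ball x t, ‖u y - c‖ₑ ^ σ ∂μ) ^ (1 / σ) ≤ K * osc μ σ u k x := by
  obtain ⟨K, hK⟩ := h.exists_average_shell_le hσ
  refine ⟨K, fun u k t ht x => le_of_forall_pos_le_add_mul K fun δ hδ => ?_⟩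
  obtain ⟨c, hc⟩ := exists_meanDev_le_osc_add (μ := μ) hσ u k x hδ
  rw [← mul_add]
  refine le_trans ?_ ((hK u k t ht x c).trans (mul_le_mul' le_rfl hc))
  exact ENNReal.rpow_le_rpow (iInf_le _ (c : ℝ)) (by positivity)

/-- The ball of radius 2^{-k} lies in the ball of radius t, and rational constants cost a bounded
factor. The constant is recorded as nonzero because it is later inverted. -/
lemma exists_scaledOsc_le_opI (h : IsDoubling μ C n) (hσ : 0 < σ) (hs : 0 < s) :
    ∃ K : ℝ≥0, K ≠ 0 ∧ ∀ (u : X → ℝ) (x : X) (k : ℤ), ∀ t ∈ shell (k - 1),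
      scaledOsc μ s σ u k x ≤ K * opI μ s σ u x t := by
  have hC := h.one_lt
  set D : ℝ≥0 := (C * 3 ^ n).toNNReal with hD
  have hDpos : 0 < D := by
    rw [hD, Real.toNNReal_pos]
    positivity
  set M : ℝ≥0 := 2 * 2 ^ (1 / σ) with hM
  have hM' : 2 * (2 : ℝ≥0∞) ^ (1 / σ) = M := coe_two_mul_rpow (by positivity)
  have hMpos : 0 < M := by positivity
  refine ⟨2 ^ s * (M * D ^ (1 / σ)), by positivity, fun u x k t ht => ?_⟩
  have ht0 := pos_of_mem_shell ht
  have hosc : osc μ σ u k x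
      ≤ (M * D ^ (1 / σ) : ℝ≥0) * (⨅ c : ℝ, ⨍⁻ y in ball x t, ‖u y - c‖ₑ ^ σ ∂μ) ^ (1 / σ) := by
    have h1 : osc μ σ u k x ^ σ
        ≤ ((M ^ σ * D : ℝ≥0) : ℝ≥0∞) * ⨅ c : ℝ, ⨍⁻ y in ball x t, ‖u y - c‖ₑ ^ σ ∂μ := by
      rw [ENNReal.mul_iInf_of_ne (by simp [hMpos.ne', hDpos.ne']) ENNReal.coe_ne_top]
      refine le_iInf fun c => ?_
      have h2 := ENNReal.rpow_le_rpow (h.osc_le_meanDev hσ u k x c) hσ.le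
      rw [hM', ENNReal.mul_rpow_of_nonneg _ _ hσ.le, meanDev, ← ENNReal.rpow_mul,
        one_div_mul_cancel hσ.ne', ENNReal.rpow_one] at h2
      refine h2.trans ?_
      rw [ENNReal.coe_mul (M ^ σ) D, mul_assoc, ENNReal.coe_rpow_of_nonneg M hσ.le]
      refine mul_le_mul' le_rfl ?_
      refine h.setLAverage_ball_le (by positivity) (by norm_num) ?_ ?_ _
      · rw [dist_self, zero_add]
        have := ht.1
        rwa [sub_add_cancel] at this
      · have := ht.2
        rw [two_zpow_neg_eq, sub_add_cancel] at this
        rw [dist_self, zero_add]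
        linarith [show (0 : ℝ) < 2 ^ (-k) by positivity]
    have h3 := ENNReal.rpow_le_rpow h1 (by positivity : 0 ≤ 1 / σ)
    rw [← ENNReal.rpow_mul, mul_one_div_cancel hσ.ne', ENNReal.rpow_one,
      ENNReal.mul_rpow_of_nonneg _ _ (by positivity),
      ← ENNReal.coe_rpow_of_nonneg _ (by positivity), NNReal.mul_rpow, ← NNReal.rpow_mul,
      mul_one_div_cancel hσ.ne', NNReal.rpow_one] at h3
    exact h3
  rw [scaledOsc, opI]
  have h4 := le_ofReal_rpow_neg hs.le ht
  calc (2 : ℝ≥0∞) ^ ((k : ℝ) * s) * osc μ σ u k x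
      = 2 ^ s * (2 ^ (((k - 1 : ℤ) : ℝ) * s) * osc μ σ u k x) := by
        rw [← mul_assoc, ← two_rpow_add]
        congr 2
        push_cast
        ring
    _ ≤ 2 ^ s * (ENNReal.ofReal (t ^ (-s)) * ((M * D ^ (1 / σ) : ℝ≥0)
          * (⨅ c : ℝ, ⨍⁻ y in ball x t, ‖u y - c‖ₑ ^ σ ∂μ) ^ (1 / σ))) := by gcongr
    _ = _ := by
        rw [ENNReal.coe_mul (2 ^ s), coe_two_rpow hs.le]
        ring

/-- For a radius in the shell of index k + i the weights combine to 2^{(k+i)s} 2^{-i(s-ε)} up to a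
constant, so each term of the supremum is a term of the smoothing with ratio 2^{-(s-ε)}. -/
lemma exists_opS_le (h : IsDoubling μ C n) (hσ : 0 < σ) (hε : 0 ≤ ε) (hεs : ε < s) :
    ∃ K : ℝ≥0, ∀ (u : X → ℝ) (x : X) (k : ℤ), ∀ t ∈ shell k,
      opS μ s ε σ u x t
        ≤ K * hardySum (2 ^ (-(s - ε))) 0 (fun j => scaledOsc μ s σ u j x) k := by
  obtain ⟨K, hK⟩ := h.exists_iInf_shell_le hσ
  refine ⟨2 ^ s * K, fun u x k t ht => ?_⟩
  rw [opS, ENNReal.mul_iSup]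
  refine iSup_le fun r => ?_
  rw [ENNReal.mul_iSup]
  refine iSup_le fun hr => ?_
  obtain ⟨j, hj⟩ := exists_mem_shell hr.1
  obtain ⟨i, rfl⟩ : ∃ i : ℕ, j = k + i := by
    have := lt_add_one_of_mem_shell hj (hr.2.trans_lt ht.2)
    exact ⟨(j - k).toNat, by omega⟩
  have h1 := ofReal_rpow_neg_le (by linarith : 0 ≤ s - ε) ht
  rw [neg_sub] at h1
  calc _ ≤ (2 : ℝ≥0∞) ^ (((k : ℝ) + 1) * (s - ε)) * (2 ^ ((((k + i : ℤ) : ℝ) + 1) * ε) *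
        (K * osc μ σ u (k + i) x)) := by
        gcongr
        · exact ofReal_rpow_neg_le hε hj
        · exact hK u _ r hj x
    _ = (2 ^ s * K : ℝ≥0) * (((2 : ℝ≥0∞) ^ (-(s - ε))) ^ i *
          scaledOsc μ s σ u (k - (0 : ℕ) + i) x) := by
        rw [scaledOsc, ENNReal.coe_mul, coe_two_rpow (by linarith), two_rpow_pow,
          show k - ((0 : ℕ) : ℤ) + i = k + i by simp]
        have h2 : (2 : ℝ≥0∞) ^ (((k : ℝ) + 1) * (s - ε)) * 2 ^ ((((k + i : ℤ) : ℝ) + 1) * ε)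
            = 2 ^ s * (2 ^ (-(s - ε) * i) * 2 ^ (((k + i : ℤ) : ℝ) * s)) := by
          rw [← two_rpow_add, ← two_rpow_add, ← two_rpow_add]
          congr 1
          push_cast
          ring
        calc _ = ((2 : ℝ≥0∞) ^ (((k : ℝ) + 1) * (s - ε)) * 2 ^ ((((k + i : ℤ) : ℝ) + 1) * ε)) *
              (K * osc μ σ u (k + i) x) := by ring
          _ = _ := by rw [h2]; ring
    _ ≤ _ := mul_le_mul' le_rfl (le_hardySum _ _ (fun j => scaledOsc μ s σ u j x) k i)

/-- By Jensen at τ ≥ max(σ, 1), the average of u differs from any c by at most the L^τ mean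
deviation from c. Replacing a nearly optimal c by the average therefore costs only a constant
factor. -/
lemma exists_opA_le (h : IsDoubling μ C n) (hσ : 0 < σ) {τ : ℝ}
    (hστ : σ ≤ τ) (hτ : 1 ≤ τ) (hs : 0 < s) :
    ∃ K : ℝ≥0, ∀ u : X → ℝ, AEMeasurable u μ → MemLpLoc μ 1 u → ∀ x k, ∀ t ∈ shell k,
      opA μ s σ u x t ≤ K * hardySum (2 ^ (-s)) 0 (fun j => scaledOsc μ s τ u j x) k := by
  have hτ0 : 0 < τ := hσ.trans_le hστ
  obtain ⟨K, hK⟩ := h.exists_average_shell_le hτ0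
  set M : ℝ≥0 := 2 * 2 ^ (1 / τ) with hM
  have hM' : 2 * (2 : ℝ≥0∞) ^ (1 / τ) = M := coe_two_mul_rpow (by positivity)
  refine ⟨2 ^ s * (M * (2 * K)), fun u hu hloc x k t ht => ?_⟩
  have ht0 := pos_of_mem_shell ht
  have hfin : IsFiniteMeasure (μ.restrict (ball x t)) :=
    ⟨by rw [Measure.restrict_apply_univ]; exact h.measure_ball_lt_top x t⟩
  have hint : Integrable u (μ.restrict (ball x t)) := by
    have := hloc x t
    rwa [ENNReal.ofReal_one, memLp_one_iff_integrable] at this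
  set a := ⨍ z in ball x t, u z ∂μ with ha
  have hjensen : ∀ f : X → ℝ≥0∞, AEMeasurable f μ → ∀ z : ℝ, 0 < z → z ≤ τ →
      (⨍⁻ y in ball x t, f y ^ z ∂μ) ^ (1 / z) ≤ (⨍⁻ y in ball x t, f y ^ τ ∂μ) ^ (1 / τ) := by
    intro f hf z hz hzτ
    have h1 := setLAverage_rpow_le (h.ball_ne_zero x ht0) (h.ball_ne_top x t) (hf.pow_const z)
      ((one_le_div hz).2 hzτ)
    simp only [← ENNReal.rpow_mul, mul_div_cancel₀ _ hz.ne'] at h1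
    have h2 := ENNReal.rpow_le_rpow h1 (by positivity : 0 ≤ 1 / τ)
    rw [← ENNReal.rpow_mul] at h2
    rwa [show τ / z * (1 / τ) = 1 / z by field_simp] at h2
  have hmean : ∀ c : ℝ, ‖a - c‖ₑ ≤ (⨍⁻ y in ball x t, ‖u y - c‖ₑ ^ τ ∂μ) ^ (1 / τ) := by
    intro c
    have h1 : a - c = ⨍ z in ball x t, (u z - c) ∂μ := by
      rw [ha, setAverage_eq, setAverage_eq, integral_sub hint (integrable_const c), smul_sub,
        setIntegral_const, smul_smul, inv_mul_cancel₀, one_smul]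
      rw [Measure.real, ENNReal.toReal_ne_zero]
      exact ⟨h.ball_ne_zero x ht0, h.ball_ne_top x t⟩
    have h2 : ‖a - c‖ₑ ≤ ⨍⁻ y in ball x t, ‖u y - c‖ₑ ∂μ := by
      rw [h1, average, laverage]
      exact enorm_integral_le_lintegral_enorm _
    refine h2.trans ?_
    simpa using hjensen _ (hu.sub_const c).enorm 1 one_pos hτ
  have hmain : (⨍⁻ y in ball x t, ‖u y - a‖ₑ ^ σ ∂μ) ^ (1 / σ)
      ≤ (M * (2 * K) : ℝ≥0) * osc μ τ u k x := by
    refine (hjensen _ (hu.sub_const a).enorm σ hσ hστ).trans ?_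
    refine le_of_forall_pos_le_add_mul (M * (2 * K)) fun δ hδ => ?_
    obtain ⟨c, hc⟩ := exists_meanDev_le_osc_add (μ := μ) hτ0 u k x hδ
    calc (⨍⁻ y in ball x t, ‖u y - a‖ₑ ^ τ ∂μ) ^ (1 / τ)
        ≤ M * ((⨍⁻ y in ball x t, ‖u y - c‖ₑ ^ τ ∂μ) ^ (1 / τ) + ‖a - c‖ₑ) := by
          rw [← hM']
          exact h.average_add_const_le hτ0 ht0 fun y => enorm_sub_le_add _ _ _
      _ ≤ M * (K * meanDev μ τ u k x c + K * meanDev μ τ u k x c) := by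
          gcongr
          · exact hK u k t ht x c
          · exact (hmean c).trans (hK u k t ht x c)
      _ ≤ M * (K * (osc μ τ u k x + δ) + K * (osc μ τ u k x + δ)) := by gcongr
      _ = _ := by push_cast; ring
  rw [opA]
  calc _ ≤ (2 : ℝ≥0∞) ^ (((k : ℝ) + 1) * s) * ((M * (2 * K) : ℝ≥0) * osc μ τ u k x) := by
        gcongr
        exact ofReal_rpow_neg_le hs.le ht
    _ = (2 ^ s * (M * (2 * K)) : ℝ≥0) * scaledOsc μ s τ u k x := by
        rw [scaledOsc, ENNReal.coe_mul (2 ^ s), coe_two_rpow hs.le, add_mul, two_rpow_add, one_mul]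
        ring
    _ ≤ _ := mul_le_mul' le_rfl (le_hardySum_zero _ (fun j => scaledOsc μ s τ u j x) k)

variable [BorelSpace X]

/-- Both u(x) and u on the ball are compared with one nearly optimal constant, the former by the
almost everywhere estimate. -/
lemma exists_opC_le [SecondCountableTopology X] (h : IsDoubling μ C n) (hσ : 0 < σ)
    (hs : 0 < s) :
    ∃ K : ℝ≥0, ∀ u : X → ℝ, AEMeasurable u μ → ∀ᵐ x ∂μ, ∀ k, ∀ t ∈ shell k,
      opC μ s σ u x t ≤ K * hardySum (2 ^ (-s)) 0 (fun j => scaledOsc μ s σ u j x) k := by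
  obtain ⟨K₁, hK₁⟩ := h.exists_ae_enorm_sub_le hσ
  obtain ⟨K₂, hK₂⟩ := h.exists_average_shell_le hσ
  set M : ℝ≥0 := 2 * 2 ^ (1 / σ) with hM
  have hM' : 2 * (2 : ℝ≥0∞) ^ (1 / σ) = M := coe_two_mul_rpow (by positivity)
  refine ⟨2 ^ s * (M * (K₁ + K₂) * 2), fun u hu => ?_⟩
  filter_upwards [hK₁ u hu] with x hx k t ht
  have ht0 := pos_of_mem_shell ht
  set O := ∑' i : ℕ, osc μ σ u (k + i) x with hO
  have hosc : osc μ σ u k x ≤ O := by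
    have := ENNReal.le_tsum (f := fun i : ℕ => osc μ σ u (k + i) x) 0
    simpa using this
  have h1 : (⨍⁻ y in ball x t, ‖u x - u y‖ₑ ^ σ ∂μ) ^ (1 / σ)
      ≤ (M * (K₁ + K₂) * 2 : ℝ≥0) * O := by
    refine le_of_forall_pos_le_add_mul (M * (K₁ + K₂)) fun δ hδ => ?_
    obtain ⟨c, hc⟩ := exists_meanDev_le_osc_add (μ := μ) hσ u k x hδ
    calc (⨍⁻ y in ball x t, ‖u x - u y‖ₑ ^ σ ∂μ) ^ (1 / σ)
        ≤ M * ((⨍⁻ y in ball x t, ‖u y - c‖ₑ ^ σ ∂μ) ^ (1 / σ) + ‖u x - c‖ₑ) := by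
          rw [← hM']
          exact h.average_add_const_le hσ ht0 fun y =>
            (enorm_sub_le_add _ (c : ℝ) _).trans_eq (add_comm _ _)
      _ ≤ M * (K₂ * meanDev μ σ u k x c + K₁ * (meanDev μ σ u k x c + O)) := by
          gcongr
          · exact hK₂ u k t ht x c
          · exact hx k c
      _ ≤ M * (K₂ * (O + δ + O) + K₁ * (O + δ + O)) := by
          have h2 : meanDev μ σ u k x c ≤ O + δ := hc.trans (by gcongr)
          gcongr
          exact h2.trans le_self_add
      _ = _ := by push_cast; ring
  rw [opC, hardySum_scaledOsc]
  simp only [Nat.cast_zero, sub_zero]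
  calc _ ≤ (2 : ℝ≥0∞) ^ (((k : ℝ) + 1) * s) * ((M * (K₁ + K₂) * 2 : ℝ≥0) * O) := by
        gcongr
        exact ofReal_rpow_neg_le hs.le ht
    _ = _ := by
        rw [ENNReal.coe_mul (2 ^ s), coe_two_rpow hs.le, add_mul, two_rpow_add, one_mul]
        ring

/-- The oscillations of `u` provide a Hajłasz gradient of `u`. -/
lemma exists_isHajlaszGradient [SecondCountableTopology X] [SFinite μ] (h : IsDoubling μ C n)
    (hσ : 0 < σ) (hs : 0 < s) :
    ∃ K : ℝ≥0, ∀ u : X → ℝ, AEMeasurable u μ →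
      IsHajlaszGradient μ s u fun k x =>
        K * hardySum (2 ^ (-s)) 1 (fun j => scaledOsc μ s σ u j x) k := by
  obtain ⟨K₁, hK₁⟩ := h.exists_ae_enorm_sub_le hσ
  obtain ⟨K₂, hK₂⟩ := h.exists_meanDev_le hσ
  -- The factor 4^s bridges the lower bound 2^{-(k+1)s} for the power of the distance and the weight
  -- 2^{(k-1)s} of the smoothing.
  refine ⟨4 ^ s * (K₁ * (2 + K₂)), fun u hu => ⟨fun k => ?_, ?_⟩⟩
  · refine AEMeasurable.const_mul (Measurable.aemeasurable ?_) _
    exact Measurable.tsum fun i => (measurable_scaledOsc hu _).const_mul _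
  refine ⟨_, hK₁ u hu, fun k x y hx hy hxy hxy' => ?_⟩
  simp only [mem_compl_iff, mem_ofPred_eq, not_not] at hx hy
  set O : X → ℝ≥0∞ := fun z => ∑' i : ℕ, osc μ σ u (k - 1 + i) z with hO
  have hOk : ∀ z, ∑' i : ℕ, osc μ σ u (k + i) z ≤ O z := by
    intro z
    have := ENNReal.tsum_comp_le_tsum_of_injective (add_left_injective 1)
      (fun i : ℕ => osc μ σ u (k - 1 + i) z)
    refine le_trans (le_of_eq (tsum_congr fun i => ?_)) this
    push_cast
    rw [show k - 1 + ((i : ℤ) + 1) = k + i by ring]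
  have hosc : osc μ σ u (k - 1) x ≤ O x := by
    have := ENNReal.le_tsum (f := fun i : ℕ => osc μ σ u (k - 1 + i) x) 0
    simpa using this
  have h1 : ENNReal.ofReal |u x - u y| ≤ (K₁ * (2 + K₂) : ℝ≥0) * (O x + O y) := by
    refine le_of_forall_pos_le_add_mul (K₁ * (1 + K₂)) fun δ hδ => ?_
    -- The common constant is nearly optimal on the ball of radius 2^{-(k-1)} about x, which
    -- contains the ball of radius 2^{-k} about y; hence the shift by one in the gradient.
    obtain ⟨c, hc⟩ := exists_meanDev_le_osc_add (μ := μ) hσ u (k - 1) x hδ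
    have h2 : meanDev μ σ u (k - 1) x c ≤ O x + δ := hc.trans (by gcongr)
    rw [← Real.enorm_eq_ofReal_abs]
    calc ‖u x - u y‖ₑ ≤ ‖u x - c‖ₑ + ‖u y - c‖ₑ := enorm_sub_le_add _ _ _
      _ ≤ K₁ * (meanDev μ σ u (k - 1) x c + O x)
            + K₁ * (meanDev μ σ u k y c + ∑' i : ℕ, osc μ σ u (k + i) y) :=
          add_le_add (hx _ _) (hy _ _)
      _ ≤ K₁ * (O x + δ + O x) + K₁ * (K₂ * (O x + δ) + O y) := by
          gcongr
          · exact (hK₂ u k x y c hxy'.le).trans (by gcongr)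
          · exact hOk y
      _ = (K₁ * (2 + K₂)) * O x + K₁ * O y + (K₁ * (1 + K₂)) * δ := by ring
      _ ≤ (K₁ * (2 + K₂)) * O x + (K₁ * (2 + K₂)) * O y + (K₁ * (1 + K₂)) * δ := by
          gcongr
          rw [mul_add]
          refine le_trans ?_ le_self_add
          rw [mul_two]
          exact le_self_add
      _ = _ := by push_cast; ring
  have h3 : (2 : ℝ≥0∞) ^ (-((k : ℝ) + 1) * s) ≤ ENNReal.ofReal (dist x y ^ s) := by
    have h4 : -((k : ℝ) + 1) * s = ((-k - 1 : ℤ) : ℝ) * s := by push_cast; ring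
    rw [h4, ← ofReal_two_zpow_rpow]
    exact ENNReal.ofReal_le_ofReal (Real.rpow_le_rpow (by positivity) hxy hs.le)
  simp only [hardySum_scaledOsc]
  push_cast
  calc ENNReal.ofReal |u x - u y| ≤ (K₁ * (2 + K₂) : ℝ≥0) * (O x + O y) := h1
    _ = 2 ^ (-((k : ℝ) + 1) * s) * ((4 : ℝ≥0∞) ^ s * (K₁ * (2 + K₂)) *
          (2 ^ (((k : ℝ) - 1) * s) * O x) + 4 ^ s * (K₁ * (2 + K₂)) *
          (2 ^ (((k : ℝ) - 1) * s) * O y)) := by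
        have h5 : (4 : ℝ≥0∞) ^ s = 2 ^ (2 * s) := by
          rw [ENNReal.rpow_mul]
          norm_num
        have h6 : (2 : ℝ≥0∞) ^ (-((k : ℝ) + 1) * s) * (2 ^ (2 * s) * 2 ^ (((k : ℝ) - 1) * s))
            = 1 := by
          rw [← two_rpow_add, ← two_rpow_add]
          ring_nf
          exact ENNReal.rpow_zero
        rw [h5]
        calc _ = 1 * ((K₁ * (2 + K₂) : ℝ≥0∞) * (O x + O y)) := by push_cast; ring
          _ = _ := by rw [← h6]; ring
    _ ≤ _ := by
        have h7 : (((4 : ℝ≥0) ^ s : ℝ≥0) : ℝ≥0∞) = 4 ^ s := by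
          rw [ENNReal.coe_rpow_of_nonneg _ hs.le]
          rfl
        rw [h7]
        gcongr

end IsDoubling

end HajlaszTL

/-! ### Oscillations controlled by gradients, and equality of the spaces -/

namespace HajlaszTL

section Exponents

variable {n s σ : ℝ}

/-- The exponent at which the Sobolev–Poincaré inequality is applied. -/
lemma exists_subcritical_exponent (hn : 0 < n) (hs : 0 < s) {r : ℝ≥0∞} (hr : 0 < r) (hσ : 0 < σ)
    (hσr : ENNReal.ofReal σ < starExponent n s r) :
    ∃ l : ℝ, 0 < l ∧ l < σ ∧ ENNReal.ofReal l < r ∧ n * (1 / l - 1 / σ) < s := by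
  have hns : 0 < s / n := by positivity
  -- in terms of `v = 1 / l`, the conditions are `1 / σ < v < 1 / σ + s / n` and `1 / r < v`
  have key : ∀ v : ℝ, 1 / σ < v → v < 1 / σ + s / n → ENNReal.ofReal (1 / v) < r →
      ∃ l : ℝ, 0 < l ∧ l < σ ∧ ENNReal.ofReal l < r ∧ n * (1 / l - 1 / σ) < s := by
    intro v h1 h2 h3
    have hv : 0 < v := lt_trans (by positivity) h1
    refine ⟨1 / v, by positivity, (one_div_lt hv hσ).2 h1, h3, ?_⟩
    rw [one_div_one_div]
    calc n * (v - 1 / σ) < n * (s / n) := by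
          have : v - 1 / σ < s / n := by linarith
          gcongr
      _ = s := by field_simp
  rcases eq_or_ne r ∞ with rfl | hrt
  · refine key (1 / σ + s / n / 2) (by linarith) (by linarith) ENNReal.ofReal_lt_top
  set ρ := r.toReal with hρ
  have hρ0 : 0 < ρ := ENNReal.toReal_pos hr.ne' hrt
  -- This is the condition σ < r_*(s) in terms of reciprocals; for r ≥ n/s it is automatic, since
  -- then 1/r ≤ s/n.
  have hlt : 1 / ρ < 1 / σ + s / n := by
    rw [starExponent] at hσr
    split_ifs at hσr with hcase
    · have h1 : ρ < n / s := by
        have := (ENNReal.lt_ofReal_iff_toReal_lt hrt).1 hcase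
        exact this
      have h2 : 0 < n - ρ * s := by
        rw [lt_div_iff₀ hs] at h1
        linarith
      have h3 : σ < n * ρ / (n - ρ * s) := (ENNReal.ofReal_lt_ofReal_iff_of_nonneg hσ.le).1 hσr
      have h4 : 1 / (n * ρ / (n - ρ * s)) < 1 / σ := one_div_lt_one_div_of_lt hσ h3
      have h5 : 1 / (n * ρ / (n - ρ * s)) = 1 / ρ - s / n := by field_simp
      linarith
    · rw [not_lt, ENNReal.ofReal_le_iff_le_toReal hrt, ← hρ] at hcase
      have h1 : 1 / ρ ≤ 1 / (n / s) := one_div_le_one_div_of_le (by positivity) hcase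
      rw [one_div_div] at h1
      have : 0 < 1 / σ := by positivity
      linarith
  obtain ⟨v, hv1, hv2⟩ := exists_between (max_lt hlt (by linarith : 1 / σ < 1 / σ + s / n))
  rw [max_lt_iff] at hv1
  refine key v hv1.2 hv2 ?_
  have hv0 : 0 < v := lt_trans (by positivity : 0 < 1 / ρ) hv1.1
  rw [ENNReal.ofReal_lt_iff_lt_toReal (by positivity) hrt]
  exact (one_div_lt hv0 hρ0).2 hv1.1

lemma one_lt_starExponent (hn : 0 < n) (hs : 0 < s) {r : ℝ≥0∞}
    (hr : ENNReal.ofReal (n / (n + s)) < r) : 1 < starExponent n s r := by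
  rw [starExponent]
  split_ifs with hcase
  · have hrt : r ≠ ∞ := ne_top_of_lt hcase
    have h1 : n / (n + s) < r.toReal := (ENNReal.ofReal_lt_iff_lt_toReal (by positivity) hrt).1 hr
    have h2 : r.toReal < n / s := (ENNReal.lt_ofReal_iff_toReal_lt hrt).1 hcase
    rw [lt_div_iff₀ hs] at h2
    rw [div_lt_iff₀ (by positivity)] at h1
    rw [← ENNReal.ofReal_one, ENNReal.ofReal_lt_ofReal_iff_of_nonneg zero_le_one,
      one_lt_div (by linarith)]
    linarith
  · exact ENNReal.one_lt_top

lemma le_starExponent (hn : 0 < n) (hs : 0 < s) (r : ℝ≥0∞) : r ≤ starExponent n s r := by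
  rw [starExponent]
  split_ifs with hcase
  · have hrt : r ≠ ∞ := ne_top_of_lt hcase
    have h2 : r.toReal < n / s := (ENNReal.lt_ofReal_iff_toReal_lt hrt).1 hcase
    rw [lt_div_iff₀ hs] at h2
    refine ENNReal.le_ofReal_iff_toReal_le hrt ?_ |>.2 ?_
    · have : 0 ≤ r.toReal := ENNReal.toReal_nonneg
      exact div_nonneg (by positivity) (by linarith)
    · rw [le_div_iff₀ (by linarith)]
      nlinarith [mul_nonneg (mul_nonneg (ENNReal.toReal_nonneg (a := r))
        (ENNReal.toReal_nonneg (a := r))) hs.le]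
  · exact le_top

end Exponents

/-- The pointwise bound behind the reduction to a single function: on a ball of radius `2^{2-k}`,
a Hajłasz gradient of order `s` yields one of smaller order. -/
lemma ofReal_abs_sub_le_hardySum {X : Type*} [MetricSpace X] {s t : ℝ} (hts : t < s) {u : X → ℝ}
    {g : ℤ → X → ℝ≥0∞} {E : Set X}
    (hg : ∀ (k : ℤ) (x y : X), x ∉ E → y ∉ E →
      (2 : ℝ) ^ (-k - 1) ≤ dist x y → dist x y < (2 : ℝ) ^ (-k) →
        ENNReal.ofReal |u x - u y| ≤ ENNReal.ofReal (dist x y ^ s) * (g k x + g k y))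
    (k : ℤ) {x y : X} (hx : x ∉ E) (hy : y ∉ E) (hxy : dist x y < 2 ^ (-(k - 2))) :
    ENNReal.ofReal |u x - u y| ≤ ENNReal.ofReal (dist x y ^ t) *
      (2 ^ (-((k : ℝ) - 2) * (s - t)) * hardySum (2 ^ (-(s - t))) 2 (fun j => g j x) k
        + 2 ^ (-((k : ℝ) - 2) * (s - t)) * hardySum (2 ^ (-(s - t))) 2 (fun j => g j y) k) := by
  rcases eq_or_ne x y with rfl | hne
  · simp
  have hd : 0 < dist x y := dist_pos.2 hne
  obtain ⟨j, hj⟩ := exists_mem_shell hd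
  obtain ⟨i, hi⟩ : ∃ i : ℕ, j = k - (2 : ℕ) + i := by
    have := lt_add_one_of_mem_shell hj hxy
    refine ⟨(j - (k - 2)).toNat, ?_⟩
    push_cast
    omega
  have h1 := hg j x y hx hy (by rw [show -j - 1 = -(j + 1) by ring]; exact hj.1) hj.2
  have h2 : ENNReal.ofReal (dist x y ^ s)
      ≤ ENNReal.ofReal (dist x y ^ t) * (2 : ℝ≥0∞) ^ (-(j : ℝ) * (s - t)) := by
    have h3 : -(j : ℝ) * (s - t) = ((-j : ℤ) : ℝ) * (s - t) := by push_cast; ring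
    rw [h3, ← ofReal_two_zpow_rpow, ← ENNReal.ofReal_mul (by positivity)]
    refine ENNReal.ofReal_le_ofReal ?_
    calc dist x y ^ s = dist x y ^ t * dist x y ^ (s - t) := by
          rw [← Real.rpow_add hd, add_sub_cancel]
      _ ≤ _ := by
          gcongr
          exact hj.2.le
  have h4 : (2 : ℝ≥0∞) ^ (-(j : ℝ) * (s - t))
      = 2 ^ (-((k : ℝ) - 2) * (s - t)) * (2 ^ (-(s - t))) ^ i := by
    rw [two_rpow_pow, ← two_rpow_add, hi]
    congr 1
    push_cast
    ring
  refine h1.trans ?_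
  calc _ ≤ ENNReal.ofReal (dist x y ^ t) * (2 : ℝ≥0∞) ^ (-(j : ℝ) * (s - t)) *
        (g j x + g j y) := by gcongr
    _ = ENNReal.ofReal (dist x y ^ t) * (2 ^ (-((k : ℝ) - 2) * (s - t)) *
          ((2 ^ (-(s - t))) ^ i * g (k - (2 : ℕ) + i) x) + 2 ^ (-((k : ℝ) - 2) * (s - t)) *
          ((2 ^ (-(s - t))) ^ i * g (k - (2 : ℕ) + i) y)) := by
        rw [h4, ← hi]
        ring
    _ ≤ _ := by
        gcongr
        · exact le_hardySum _ 2 (fun j => g j x) k i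
        · exact le_hardySum _ 2 (fun j => g j y) k i

lemma measurable_hardySum {X : Type*} [MeasurableSpace X] {μ : Measure X} {θ : ℝ≥0∞} {M : ℕ} {g : ℤ → X → ℝ≥0∞}
    (hg : ∀ k, AEMeasurable (g k) μ) (k : ℤ) :
    AEMeasurable (fun x => hardySum θ M (fun j => g j x) k) μ :=
  AEMeasurable.tsum fun _ => (hg _).const_mul _

variable {X : Type*} [MetricSpace X] [MeasurableSpace X] {μ : Measure X} {C n : ℝ} {s σ : ℝ}
  {p q : ℝ≥0∞}

lemma ae_restrict_lt_top_of_gradNorm_lt_top (hp : 0 < p) (hq : 0 < q)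
    (h : IsDoubling μ C n) {a : ℤ → X → ℝ≥0∞} (ha : ∀ k, AEMeasurable (a k) μ)
    (hfin : gradNorm μ p q a < ∞) (k : ℤ) (x : X) :
    ∀ᵐ y ∂μ.restrict (ball x (2 ^ (-k))), a k y < ∞ := by
  by_cases hpq : p = ∞ ∧ q ≠ ∞
  · obtain ⟨rfl, hqt⟩ := hpq
    have hQ : 0 < q.toReal := ENNReal.toReal_pos hq.ne' hqt
    have h1 : ⨍⁻ y in ball x ((2 : ℝ) ^ (-k)), a k y ^ q.toReal ∂μ ≠ ∞ := by
      refine ne_top_of_le_ne_top (ENNReal.rpow_ne_top_of_nonneg hQ.le hfin.ne)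
        (le_trans ?_ (tsum_setLAverage_le_gradNorm_top hq.ne' hqt a k x))
      have := ENNReal.le_tsum (f := fun m : ℕ =>
        ⨍⁻ y in ball x ((2 : ℝ) ^ (-k)), a (k + m) y ^ q.toReal ∂μ) 0
      simpa using this
    have h2 : ∫⁻ y in ball x ((2 : ℝ) ^ (-k)), a k y ^ q.toReal ∂μ ≠ ∞ := by
      rw [← measure_mul_setLAverage _ (h.ball_ne_top x _)]
      exact ENNReal.mul_ne_top (h.ball_ne_top x _) h1
    filter_upwards [ae_lt_top' ((ha k).pow_const _).restrict h2] with y hy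
    exact (ENNReal.rpow_lt_top_iff_of_pos hQ).1 hy
  · refine ae_restrict_of_ae ?_
    rw [gradNorm_of_not hpq] at hfin
    have hle : ∀ y, a k y ≤ lqNorm q fun k => a k y := fun y => le_lqNorm hq.ne' (fun k => a k y) k
    have h1 : eLpNorm (a k) p μ < ∞ := (eLpNorm_mono_enorm fun y => by
      simpa only [enorm_eq_self] using hle y).trans_lt hfin
    rcases eq_or_ne p ∞ with rfl | hpt
    · rw [eLpNorm_exponent_top, eLpNormEssSup] at h1
      filter_upwards [ENNReal.ae_le_essSup (a k)] with y hy
      exact hy.trans_lt h1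
    · have hP : 0 < p.toReal := ENNReal.toReal_pos hp.ne' hpt
      rw [eLpNorm_lt_top_iff_lintegral_rpow_enorm_lt_top hp.ne' hpt] at h1
      simp only [enorm_eq_self] at h1
      filter_upwards [ae_lt_top' ((ha k).pow_const _) h1.ne] with y hy
      exact (ENNReal.rpow_lt_top_iff_of_pos hP).1 hy

lemma MemLpLoc.mono (h : IsDoubling μ C n) {τ : ℝ} (hστ : σ ≤ τ) {u : X → ℝ}
    (hu : MemLpLoc μ τ u) : MemLpLoc μ σ u := by
  intro x r
  have : IsFiniteMeasure (μ.restrict (ball x r)) :=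
    ⟨by rw [Measure.restrict_apply_univ]; exact h.measure_ball_lt_top x r⟩
  exact (hu x r).mono_exponent (ENNReal.ofReal_le_ofReal hστ)

lemma aemeasurable_of_memLpLoc {u : X → ℝ} (hu : MemLpLoc μ σ u) :
    AEMeasurable u μ := by
  rcases isEmpty_or_nonempty X with hX | ⟨⟨o⟩⟩
  · rw [Measure.eq_zero_of_isEmpty μ]
    exact aemeasurable_zero_measure
  · have h1 : AEMeasurable u (μ.restrict (⋃ N : ℕ, ball o N)) :=
      (aemeasurable_iUnion_iff).2 fun N => (hu o N).1.aemeasurable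
    rwa [iUnion_ball_nat, Measure.restrict_univ] at h1

variable [BorelSpace X]

/-- The scaled oscillations are controlled by every Hajłasz gradient. -/
theorem IsDoubling.exists_gradNorm_scaledOsc_le [SecondCountableTopology X] [SFinite μ]
    (h : IsDoubling μ C n) (hs : 0 < s) (hp : 0 < p) (hq : 0 < q) (hσ : 0 < σ)
    (hσr : ENNReal.ofReal σ < starExponent n s (min p q)) :
    ∃ K : ℝ≥0, ∀ (u : X → ℝ) (g : ℤ → X → ℝ≥0∞), IsHajlaszGradient μ s u g →
      gradNorm μ p q (scaledOsc μ s σ u) ≤ K * gradNorm μ p q g := by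
  obtain ⟨l, hl, hlσ, hlr, hls⟩ := exists_subcritical_exponent h.dim_pos hs (lt_min hp hq) hσ hσr
  rw [lt_min_iff] at hlr
  set t := n * (1 / l - 1 / σ) with ht
  have ht0 : 0 ≤ t := mul_nonneg h.dim_pos.le (by
    have := one_div_lt_one_div_of_lt hl hlσ
    linarith)
  have hst : 0 < s - t := by linarith
  set θ : ℝ≥0∞ := 2 ^ (-(s - t)) with hθdef
  have hθ : θ < 1 := two_rpow_neg_lt_one hst
  obtain ⟨K₁, hK₁⟩ := h.exists_sobolevPoincare hl hlσ ht
  obtain ⟨K₂, hK₂⟩ := h.exists_gradNorm_hardySum_le (p := p) hθ 1 hq.ne'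
  obtain ⟨K₃, hK₃⟩ := h.exists_gradNorm_setLAverage_le hp.ne' hq.ne' hl hlr.1 hlr.2
  set M : ℝ≥0 := 2 * 2 ^ (1 / σ) with hM
  have hM' : 2 * (2 : ℝ≥0∞) ^ (1 / σ) = M := coe_two_mul_rpow (by positivity)
  refine ⟨M * K₁ * 2 ^ (2 * (s - t)) * (K₂ * (K₃ * K₂)), fun u g hg => ?_⟩
  obtain ⟨hgm, E, hE, hgE⟩ := hg
  -- The single function replacing the sequence g on balls of radius comparable to 2^{-k}. Lowering
  -- the order from s to t gives the decay ratio 2^{-(s-t)} < 1.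
  set G : ℤ → X → ℝ≥0∞ := fun k x => hardySum θ 1 (fun j => g j x) k with hG
  have hGm : ∀ k, AEMeasurable (G k) μ := measurable_hardySum hgm
  have hGshift : ∀ k x, hardySum θ 2 (fun j => g j x) k = G (k - 1) x := by
    intro k x
    simp only [hG, hardySum]
    refine tsum_congr fun i => ?_
    rw [show k - ((2 : ℕ) : ℤ) + i = k - 1 - ((1 : ℕ) : ℤ) + i by push_cast; ring]
  set c : ℤ → X → ℝ≥0∞ := fun k x =>
    (⨍⁻ y in ball x ((2 : ℝ) ^ (-k)), G k y ^ l ∂μ) ^ (1 / l) with hc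
  have hcm : ∀ k, AEMeasurable (c k) μ := fun k =>
    ((measurable_setLAverage_ball ((hGm k).pow_const l) _).pow_const _).aemeasurable
  have hpt : ∀ k x, scaledOsc μ s σ u k x
      ≤ (M * K₁ * 2 ^ (2 * (s - t)) : ℝ≥0) * hardySum θ 1 (fun j => c j x) k := by
    intro k x
    set A : ℝ≥0∞ := 2 ^ (-((k : ℝ) - 2) * (s - t)) with hA
    have h4R : (4 : ℝ) * 2 ^ (-k) = 2 ^ (-(k - 2)) := by
      rw [show -(k - 2) = 2 + -k by ring, zpow_add₀ two_ne_zero]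
      norm_num
    have h2R : (2 : ℝ) * 2 ^ (-k) = 2 ^ (-(k - 1)) := by
      rw [two_zpow_neg_eq (k - 1), sub_add_cancel]
    -- Sobolev–Poincaré with R = 2^{-k}: the gradient condition up to distance 4R involves the
    -- indices from k - 2 on, that is, G at index k - 1.
    obtain ⟨b, hb⟩ := hK₁ u (fun y => A * G (k - 1) y) ((hGm _).const_mul _) E hE x (2 ^ (-k))
      (by positivity) (fun y z hy hz hyz => by
        rw [h4R] at hyz
        have := ofReal_abs_sub_le_hardySum hls hgE k hy hz hyz
        simpa only [← hθdef, hGshift] using this)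
    have havg : (⨍⁻ y in ball x (2 * 2 ^ (-k)), (A * G (k - 1) y) ^ l ∂μ) ^ (1 / l)
        = A * c (k - 1) x := by
      simp only [ENNReal.mul_rpow_of_nonneg _ _ hl.le]
      rw [setLAverage_const_mul _ ((hGm _).pow_const l),
        ENNReal.mul_rpow_of_nonneg _ _ (by positivity), ← ENNReal.rpow_mul,
        mul_one_div_cancel hl.ne', ENNReal.rpow_one, h2R]
    rw [havg, ofReal_two_zpow_rpow] at hb
    -- The average lives on the ball of radius 2R, hence the index k - 1. Bounding it by a smoothing
    -- shifted by one lets the Hardy inequality also absorb this index shift.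
    have hcle : c (k - 1) x ≤ hardySum θ 1 (fun j => c j x) k := by
      simpa using le_hardySum θ 1 (fun j => c j x) k 0
    calc scaledOsc μ s σ u k x
        ≤ 2 ^ ((k : ℝ) * s) * (M * (K₁ * (2 ^ (((-k : ℤ) : ℝ) * t) * (A * c (k - 1) x)))) := by
          rw [scaledOsc]
          refine mul_le_mul' le_rfl ((h.osc_le_meanDev hσ u k x b).trans ?_)
          rw [hM']
          exact mul_le_mul' le_rfl hb
      _ = (M * K₁ * 2 ^ (2 * (s - t)) : ℝ≥0) * c (k - 1) x := by
          have h5 : (2 : ℝ≥0∞) ^ ((k : ℝ) * s) * (2 ^ (((-k : ℤ) : ℝ) * t) * A)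
              = 2 ^ (2 * (s - t)) := by
            rw [hA, ← two_rpow_add, ← two_rpow_add]
            congr 1
            push_cast
            ring
          rw [ENNReal.coe_mul (M * K₁), ENNReal.coe_mul M K₁,
            coe_two_rpow (z := 2 * (s - t)) (by linarith), ← h5]
          ring
      _ ≤ _ := mul_le_mul' le_rfl hcle
  calc gradNorm μ p q (scaledOsc μ s σ u)
      ≤ (M * K₁ * 2 ^ (2 * (s - t)) : ℝ≥0) *
          gradNorm μ p q (fun k x => hardySum θ 1 (fun j => c j x) k) :=
        gradNorm_le_mul hq.ne' fun k => Filter.Eventually.of_forall fun x => hpt k x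
    _ ≤ (M * K₁ * 2 ^ (2 * (s - t)) : ℝ≥0) * (K₂ * (K₃ * (K₂ * gradNorm μ p q g))) := by
        gcongr
        exact (hK₂ c hcm).trans (mul_le_mul' le_rfl
          ((hK₃ G hGm).trans (mul_le_mul' le_rfl (hK₂ g hgm))))
    _ = _ := by push_cast; ring

/-- Functions with finite oscillation norm are locally `σ`-integrable. -/
lemma memLpLoc_of_gradNorm_lt_top [SecondCountableTopology X] [SFinite μ] (h : IsDoubling μ C n)
    (hp : 0 < p) (hq : 0 < q) (hσ : 0 < σ) {u : X → ℝ} (hu : AEMeasurable u μ)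
    (hfin : gradNorm μ p q (scaledOsc μ s σ u) < ∞) : MemLpLoc μ σ u := by
  intro x₀ r
  obtain ⟨N, hN⟩ := pow_unbounded_of_one_lt (|r| + 1) (one_lt_two (α := ℝ))
  have hN' : |r| + 1 < (2 : ℝ) ^ (-(-(N : ℤ))) := by rwa [neg_neg, zpow_natCast]
  set k : ℤ := -(N : ℤ) with hk
  have hae := ae_restrict_lt_top_of_gradNorm_lt_top hp hq h
    (fun j => (measurable_scaledOsc (s := s) (σ := σ) hu j).aemeasurable) hfin k x₀
  have hsub : ball x₀ 1 ⊆ ball x₀ (2 ^ (-k)) :=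
    ball_subset_ball (by have := abs_nonneg r; linarith)
  have hae' := ae_restrict_of_ae_restrict_of_subset hsub hae
  have hne : (ae (μ.restrict (ball x₀ 1))).NeBot := by
    rw [ae_neBot, Ne, Measure.restrict_eq_zero]
    exact h.ball_ne_zero x₀ one_pos
  -- One centre within distance 1 of x₀ with finite oscillation suffices: the ball about it of
  -- radius 2^N > |r| + 1 contains the given ball.
  obtain ⟨x, hx, hxb⟩ := (hae'.and (ae_restrict_mem measurableSet_ball)).exists
  have hosc : osc μ σ u k x ≠ ∞ := by
    intro h0
    rw [scaledOsc, h0, ENNReal.mul_top] at hx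
    · exact lt_irrefl _ hx
    · rw [Ne, ENNReal.rpow_eq_zero_iff]
      simp
  obtain ⟨c, hc⟩ := exists_meanDev_le_osc_add (μ := μ) hσ u k x one_pos
  have hdev : meanDev μ σ u k x c ≠ ∞ :=
    ne_top_of_le_ne_top (ENNReal.add_ne_top.2 ⟨hosc, ENNReal.coe_ne_top⟩) hc
  have hint : ∫⁻ y in ball x ((2 : ℝ) ^ (-k)), ‖u y - c‖ₑ ^ σ ∂μ < ∞ := by
    rw [← measure_mul_setLAverage _ (h.ball_ne_top x _)]
    refine ENNReal.mul_lt_top (h.measure_ball_lt_top x _) ?_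
    rw [meanDev] at hdev
    exact (ENNReal.rpow_lt_top_iff_of_pos (by positivity : 0 < 1 / σ)).1 hdev.lt_top
  have hfinm : ∀ (z : X) (ρ : ℝ), IsFiniteMeasure (μ.restrict (ball z ρ)) := fun z ρ =>
    ⟨by rw [Measure.restrict_apply_univ]; exact h.measure_ball_lt_top z ρ⟩
  have hmem : MemLp (fun y => u y - (c : ℝ)) (ENNReal.ofReal σ)
      (μ.restrict (ball x ((2 : ℝ) ^ (-k)))) := by
    refine ⟨(hu.sub_const _).restrict.aestronglyMeasurable, ?_⟩
    rw [eLpNorm_lt_top_iff_lintegral_rpow_enorm_lt_top (by simpa using hσ) ENNReal.ofReal_ne_top,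
      ENNReal.toReal_ofReal hσ.le]
    exact hint
  have hmem' := hmem.add (memLp_const (c : ℝ))
  have hu' : (fun y => u y - (c : ℝ)) + (fun _ => (c : ℝ)) = u := by
    funext y
    simp
  rw [hu'] at hmem'
  refine hmem'.mono_measure (Measure.restrict_mono (ball_subset_ball' ?_) le_rfl)
  have h1 := mem_ball.1 hxb
  rw [dist_comm] at h1
  have := le_abs_self r
  linarith

/-- If `F` is pointwise controlled by smoothed oscillations, and controls the functional `opI`, then
it defines the Hajłasz–Triebel–Lizorkin space. -/
theorem IsDoubling.spaceM_equal [SecondCountableTopology X] [SFinite μ] (h : IsDoubling μ C n)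
    (hs : 0 < s) (hp : 0 < p) (hq : 0 < q) {τ : ℝ} (hσ : 0 < σ) (hτ : 0 < τ)
    (hτr : ENNReal.ofReal τ < starExponent n s (min p q)) {δ : ℝ} (hδ : 0 < δ)
    (F : (X → ℝ) → X → ℝ → ℝ≥0∞) (A : FunctionSpace X) (hnorm : ∀ u, A.norm u = normF μ p q (F u))
    (hmemσ : ∀ u ∈ A.carrier, MemLpLoc μ σ u ∧ normF μ p q (F u) < ∞)
    (hmem : ∀ u, MemLpLoc μ τ u → normF μ p q (F u) < ∞ → u ∈ A.carrier)
    (hlower : ∀ u, ∀ x t, 0 < t → opI μ s σ u x t ≤ F u x t)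
    (hupper : ∃ K : ℝ≥0, ∀ u, AEMeasurable u μ → MemLpLoc μ τ u → ∀ᵐ x ∂μ, ∀ k, ∀ t ∈ shell k,
      F u x t ≤ K * hardySum (2 ^ (-δ)) 0 (fun j => scaledOsc μ s τ u j x) k) :
    (spaceM μ s p q).Equal A := by
  constructor
  · obtain ⟨K₁, hK₁⟩ := hupper
    obtain ⟨K₂, hK₂⟩ := h.exists_gradNorm_scaledOsc_le hs hp hq hτ hτr
    obtain ⟨K₃, hK₃⟩ := h.exists_normF_le_gradNorm (p := p) hq.ne'
    obtain ⟨K₄, hK₄⟩ := h.exists_gradNorm_hardySum_le (p := p) (two_rpow_neg_lt_one hδ) 0 hq.ne'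
    refine ⟨K₃ * (K₁ * (K₄ * K₂)), fun u hu => ?_⟩
    obtain ⟨hum, hufin⟩ := hu
    have hosc : gradNorm μ p q (scaledOsc μ s τ u) ≤ K₂ * normM μ s p q u := by
      rw [normM]
      -- A zero constant is not moved inside the infimum; finiteness of the norm supplies some
      -- gradient, and that one gives the bound.
      by_cases hK0 : (K₂ : ℝ≥0∞) = 0
      · obtain ⟨g, hg⟩ := iInf_lt_iff.1 hufin
        obtain ⟨hg, -⟩ := iInf_lt_iff.1 hg
        have := hK₂ u g hg
        rw [hK0, zero_mul] at this ⊢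
        exact this
      · simp only [ENNReal.mul_iInf_of_ne hK0 ENNReal.coe_ne_top]
        exact le_iInf₂ fun g hg => hK₂ u g hg
    have hloc : MemLpLoc μ τ u := memLpLoc_of_gradNorm_lt_top h hp hq hτ hum
      (hosc.trans_lt (ENNReal.mul_lt_top ENNReal.coe_lt_top hufin))
    have hle : normF μ p q (F u) ≤ (K₃ * (K₁ * (K₄ * K₂)) : ℝ≥0) * normM μ s p q u := by
      calc normF μ p q (F u)
          ≤ K₃ * gradNorm μ p q (fun k x =>
              K₁ * hardySum (2 ^ (-δ)) 0 (fun j => scaledOsc μ s τ u j x) k) :=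
            hK₃ _ _ (hK₁ u hum hloc)
        _ ≤ K₃ * (K₁ * (K₄ * (K₂ * normM μ s p q u))) := by
            refine mul_le_mul' le_rfl ?_
            refine (gradNorm_le_mul (b := fun k x =>
              hardySum (2 ^ (-δ)) 0 (fun j => scaledOsc μ s τ u j x) k) hq.ne'
              fun k => Filter.Eventually.of_forall fun x => le_rfl).trans ?_
            refine mul_le_mul' le_rfl ?_
            refine (hK₄ (scaledOsc μ s τ u) fun k => (measurable_scaledOsc hum k).aemeasurable).trans ?_
            exact mul_le_mul' le_rfl hosc
        _ = _ := by push_cast; ring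
    refine ⟨hmem u hloc (hle.trans_lt (ENNReal.mul_lt_top ENNReal.coe_lt_top hufin)), ?_⟩
    rw [hnorm]
    exact hle
  -- The converse inclusion uses oscillations of exponent σ and works for any σ > 0; the upper bound
  -- on exponents enters only in the first inclusion, through τ.
  · obtain ⟨K₁, hK₁⟩ := h.exists_isHajlaszGradient (μ := μ) hσ hs
    obtain ⟨K₂, hK₂⟩ := h.exists_gradNorm_hardySum_le (p := p) (two_rpow_neg_lt_one hs) 1 hq.ne'
    obtain ⟨K₃, hK₃0, hK₃⟩ := h.exists_scaledOsc_le_opI (μ := μ) hσ hs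
    obtain ⟨K₄, hK₄⟩ := h.exists_gradNorm_le_normF (p := p) hq.ne'
    refine ⟨K₁ * (K₂ * (K₃ * K₄)), fun u hu => ?_⟩
    obtain ⟨hloc, hfin⟩ := hmemσ u hu
    have hum := aemeasurable_of_memLpLoc hloc
    have hosc : gradNorm μ p q (scaledOsc μ s σ u) ≤ K₃ * (K₄ * normF μ p q (F u)) := by
      have hK₃0' : (K₃ : ℝ≥0∞) ≠ 0 := ENNReal.coe_ne_zero.2 hK₃0
      -- The constant is divided out first, since the shell comparison requires a pointwise bound
      -- without a factor.
      calc gradNorm μ p q (scaledOsc μ s σ u)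
          ≤ K₃ * gradNorm μ p q (fun k x => (K₃ : ℝ≥0∞)⁻¹ * scaledOsc μ s σ u k x) :=
            gradNorm_le_mul hq.ne' fun k => Filter.Eventually.of_forall fun x => by
              rw [← mul_assoc, ENNReal.mul_inv_cancel hK₃0' ENNReal.coe_ne_top, one_mul]
        _ ≤ K₃ * (K₄ * normF μ p q (opI μ s σ u)) := by
            refine mul_le_mul' le_rfl (hK₄ _ _
              (fun k => ((measurable_scaledOsc hum k).const_mul _).aemeasurable) fun x k t ht => ?_)
            rw [mul_comm, ← div_eq_mul_inv]
            exact ENNReal.div_le_of_le_mul' (hK₃ u x k t ht)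
        _ ≤ _ := by
            gcongr
            exact normF_mono hq.ne' (hlower u)
    have hle : normM μ s p q u ≤ (K₁ * (K₂ * (K₃ * K₄)) : ℝ≥0) * normF μ p q (F u) := by
      calc normM μ s p q u
          ≤ gradNorm μ p q (fun k x =>
              K₁ * hardySum (2 ^ (-s)) 1 (fun j => scaledOsc μ s σ u j x) k) :=
            iInf₂_le _ (hK₁ u hum)
        _ ≤ K₁ * (K₂ * gradNorm μ p q (scaledOsc μ s σ u)) := by
            refine (gradNorm_le_mul (b := fun k x =>
              hardySum (2 ^ (-s)) 1 (fun j => scaledOsc μ s σ u j x) k) hq.ne'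
              fun k => Filter.Eventually.of_forall fun x => le_rfl).trans ?_
            exact mul_le_mul' le_rfl
              (hK₂ (scaledOsc μ s σ u) fun k => (measurable_scaledOsc hum k).aemeasurable)
        _ ≤ K₁ * (K₂ * (K₃ * (K₄ * normF μ p q (F u)))) := by gcongr
        _ = _ := by push_cast; ring
    refine ⟨⟨hum, hle.trans_lt (ENNReal.mul_lt_top ENNReal.coe_lt_top hfin)⟩, ?_⟩
    rw [hnorm]
    exact hle

end HajlaszTL

theorem theorem3p1 {X : Type*} [MetricSpace X] [MeasurableSpace X] [BorelSpace X]
    (μ : Measure X)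
    (hball : ∀ (x : X) (ρ : ℝ), 0 < ρ → 0 < μ (ball x ρ) ∧ μ (ball x ρ) < ∞)
    (C₁ n : ℝ) (hC₁ : 1 < C₁) (hn : 0 < n)
    (hdoubling : ∀ (x : X) (ρ a : ℝ), 0 < ρ → 1 < a →
      μ (ball x (a * ρ)) ≤ ENNReal.ofReal (C₁ * a ^ n) * μ (ball x ρ))
    (s : ℝ) (hs : 0 < s) (p q : ℝ≥0∞) (hp : 0 < p) (hq : 0 < q)
    (r : ℝ≥0∞) (hr : r = min p q) :
    (∀ σ : ℝ, 0 < σ → ENNReal.ofReal σ < r →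
      (HajlaszTL.spaceM μ s p q).Equal (HajlaszTL.spaceC μ s σ p q)) ∧
    (∀ σ : ℝ, 0 < σ → ENNReal.ofReal σ < HajlaszTL.starExponent n s r →
      (HajlaszTL.spaceM μ s p q).Equal (HajlaszTL.spaceI μ s σ p q)) ∧
    (∀ ε σ : ℝ, 0 ≤ ε → ε < s → 0 < σ → ENNReal.ofReal σ < HajlaszTL.starExponent n s r →
      (HajlaszTL.spaceM μ s p q).Equal (HajlaszTL.spaceS μ s ε σ p q)) ∧
    (ENNReal.ofReal (n / (n + s)) < r →
      ∀ σ : ℝ, 0 < σ → ENNReal.ofReal σ < HajlaszTL.starExponent n s r →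
        (HajlaszTL.spaceM μ s p q).Equal (HajlaszTL.spaceA μ s σ p q)) := by
  subst hr
  have h : HajlaszTL.IsDoubling μ C₁ n :=
    { one_lt := hC₁
      dim_pos := hn
      measure_ball_pos := fun x ρ hρ => (hball x ρ hρ).1
      measure_ball_lt_top := fun x ρ => by
        rcases le_or_gt ρ 0 with hρ | hρ
        · rw [ball_eq_empty.2 hρ, measure_empty]
          exact ENNReal.zero_lt_top
        · exact (hball x ρ hρ).2
      measure_ball_mul_le := hdoubling }
  have := h.sigmaFinite
  have := h.secondCountableTopology
  refine ⟨fun σ hσ hσr => ?_, fun σ hσ hσr => ?_, fun ε σ hε hεs hσ hσr => ?_,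
    fun hr σ hσ hσr => ?_⟩
  · obtain ⟨K, hK⟩ := h.exists_opC_le (μ := μ) hσ hs
    exact h.spaceM_equal hs hp hq hσ hσ
      (hσr.trans_le (HajlaszTL.le_starExponent hn hs _)) hs (HajlaszTL.opC μ s σ) _
      (fun _ => rfl) (fun _ hu => hu) (fun _ h1 h2 => ⟨h1, h2⟩)
      (fun u x t _ => HajlaszTL.opI_le_opC u x t hσ) ⟨K, fun u hu _ => hK u hu⟩
  -- I is dominated by S with ε = 0 and inherits its upper bound.
  · obtain ⟨K, hK⟩ := h.exists_opS_le (μ := μ) hσ le_rfl hs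
    exact h.spaceM_equal hs hp hq hσ hσ hσr (by linarith : 0 < s - 0) (HajlaszTL.opI μ s σ) _
      (fun _ => rfl) (fun _ hu => hu) (fun _ h1 h2 => ⟨h1, h2⟩) (fun u x t _ => le_rfl)
      ⟨K, fun u _ _ => Filter.Eventually.of_forall fun x k t ht =>
        (HajlaszTL.opI_le_opS u x (HajlaszTL.pos_of_mem_shell ht)).trans (hK u x k t ht)⟩
  · obtain ⟨K, hK⟩ := h.exists_opS_le (μ := μ) hσ hε hεs
    exact h.spaceM_equal hs hp hq hσ hσ hσr (by linarith : 0 < s - ε) (HajlaszTL.opS μ s ε σ) _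
      (fun _ => rfl) (fun _ hu => hu) (fun _ h1 h2 => ⟨h1, h2⟩)
      (fun u x t ht => HajlaszTL.opI_le_opS u x ht)
      ⟨K, fun u _ _ => Filter.Eventually.of_forall fun x => hK u x⟩
  -- Exponent at least 1 is needed to handle averages of u; it stays below r_*(s) because r >
  -- n/(n+s) gives r_*(s) > 1. It also yields the local integrability required of the members of the
  -- space.
  · have hτ : 0 < max σ 1 := lt_max_of_lt_left hσ
    have hτr : ENNReal.ofReal (max σ 1) < HajlaszTL.starExponent n s (min p q) := by
      rcases max_choice σ 1 with h1 | h1 <;> rw [h1]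
      · exact hσr
      · rw [ENNReal.ofReal_one]
        exact HajlaszTL.one_lt_starExponent hn hs hr
    obtain ⟨K, hK⟩ := h.exists_opA_le (μ := μ) hσ (le_max_left σ 1) (le_max_right σ 1) hs
    exact h.spaceM_equal hs hp hq hσ hτ hτr hs (HajlaszTL.opA μ s σ) _
      (fun _ => rfl) (fun _ hu => ⟨hu.1, hu.2.2⟩)
      (fun _ h1 h2 => ⟨h1.mono h (le_max_left σ 1), h1.mono h (le_max_right σ 1), h2⟩)
      (fun u x t _ => HajlaszTL.opI_le_opA u x t hσ)
      ⟨K, fun u hu hloc => Filter.Eventually.of_forall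
        (hK u hu (hloc.mono h (le_max_right σ 1)))⟩
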